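/- **Setting.** Let $\pi\colon E\to M$ and $\zeta\colon Z\to M$ be smooth vector bundles over a smooth (Hausdorff, second countable) manifold $M$, and let $F$ be a smooth nonlinear differential operator from sections of $\pi$ to sections of $\zeta$. Let $\mathcal F(\pi)$ be the algebra of smooth functions of finite order on $J^\infty(\pi)$. The Cartan plane of $J^\infty(\pi)$ at a point is spanned by the total derivatives. The *differential equation* $\mathcal E\subset J^\infty(\pi)$ given by $F=0$ is its infinite prolongation, $\mathcal E=\{D_\alpha(F^i)=0,\ |\alpha|\ge 0\}$. It is assumed to be regular: a function $f\in\mathcal F(\pi)$ vanishes on $\mathcal E$ if and only if $f=\Delta(F)$ for some total differential operator $\Delta=\Delta_i^\alpha D_\alpha$ of finite order with smooth coefficients of finite order. In particular, the Cartan planes of $J^\infty(\pi)$ at points of $\mathcal E$ are tangent to $\mathcal E$, and they form the Cartan distribution of $\mathcal E$. Let $I\subset\mathcal F(\pi)$ be the ideal of functions vanishing on $\mathcal E$, put $\mathcal F(\mathcal E)=\mathcal F(\pi)/I$ and $\Lambda^1(\mathcal E)=\Lambda^1(\pi)/(I\cdot\Lambda^1(\pi)+\mathcal F(\pi)\cdot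 dI)$, and let $\Lambda^*(\mathcal E)$ be the exterior algebra of $\Lambda^1(\mathcal E)$ over $\mathcal F(\mathcal E)$, with the de Rham differential $d$. Let $\mathcal C^p\Lambda^*(\mathcal E)$ be the $p$-th power of the ideal generated by the differential forms that vanish on the Cartan planes of $\mathcal E$ (and $\mathcal C^p\Lambda^*(\mathcal E)=\Lambda^*(\mathcal E)$ for $p\le 0$). The $\mathcal C$-spectral sequence $E_r^{p,q}(\mathcal E)$ is the spectral sequence of the de Rham complex $(\Lambda^\bullet(\mathcal E),d)$ with this filtration: $$E_r^{p,q}=\frac{Z_r^{p,q}}{Z_{r-1}^{p+1,q-1}+d\,Z_{r-1}^{p-r+1,q+r-2}},\qquad Z_r^{p,q}=\{\omega\in\mathcal C^p\Lambda^{p+q}(\mathcal E)\colon d\omega\in\mathcal C^{p+r}\Lambda^{p+q+1}(\mathcal E)\}.$$ A *DE-morphism* $g\colon\mathcal E_1\to\mathcal E_2$ is a smooth map (that is, $g^*\mathcal F(\mathcal E_2)\subset\mathcal F(\mathcal E_1)$) whose differential maps the Cartan plane at each point $\rho\in\mathcal E_1$ into the Cartan plane at $g(\rho)$. Its pullback of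 differential forms preserves the filtrations and commutes with $d$, so it induces homomorphisms $E_r^{p,q}(\mathcal E_2)\to E_r^{p,q}(\mathcal E_1)$. **Lemma.** Let $\mathcal E_1,\mathcal E_2$ be differential equations (possibly over different manifolds and in different bundles), and let $f_0,f_1\colon\mathcal E_1\to\mathcal E_2$ be DE-morphisms. Suppose that they are related by a homotopy: a smooth map $f\colon\mathcal E_1\times[0,1]\to\mathcal E_2$ such that $f(\rho,0)=f_0(\rho)$ and $f(\rho,1)=f_1(\rho)$ for all $\rho\in\mathcal E_1$, and such that $f_\tau=f(\cdot,\tau)$ is a DE-morphism for each $\tau\in[0,1]$. Here smoothness means that $f$ pulls functions in $\mathcal F(\mathcal E_2)$ back to restrictions to $\mathcal E_1\times[0,1]$ of smooth functions of finite order on $J^\infty(\pi_1)\times[0,1]$, where $\mathcal E_1\subset J^\infty(\pi_1)$. Then $f_0^*$ and $f_1^*$ induce the same homomorphisms $$E_2^{p,q}(\mathcal E_2)\to E_2^{p,q}(\mathcal E_1)\qquad\text{for all } p,q.$$ -/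

import Mathlib

open scoped Manifold ContDiff Bundle

noncomputable section

/-! ### Algebras of smooth functions and their differential forms -/

/-- An algebra of real functions on a set `X` that is closed under composition with smooth functions
of finitely many variables. -/
structure SmoothAlgebra (X : Type*) extends Subalgebra ℝ (X → ℝ) where
  comp_mem : ∀ {L : ℕ} (β : (Fin L → ℝ) → ℝ), ContDiff ℝ ∞ β →
    ∀ b : Fin L → X → ℝ, (∀ i, b i ∈ toSubalgebra) → (fun x => β fun i => b i x) ∈ toSubalgebra

/-- The type of the functions that belong to a smooth algebra. -/
abbrev SmoothAlgebra.Fn {X : Type*} (A : SmoothAlgebra X) : Type _ := A.toSubalgebra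

/-- The composite `β(b₁, …, b_L)`. -/
def SmoothAlgebra.comp {X : Type*} (A : SmoothAlgebra X) {L : ℕ} (β : (Fin L → ℝ) → ℝ)
    (hβ : ContDiff ℝ ∞ β) (b : Fin L → A.Fn) : A.Fn :=
  ⟨fun x => β fun i => (b i : X → ℝ) x, A.comp_mem β hβ (fun i => b i) fun i => (b i).2⟩

/-- The partial derivative `∂β/∂z_j`. -/
def partialDeriv {L : ℕ} (β : (Fin L → ℝ) → ℝ) (j : Fin L) : (Fin L → ℝ) → ℝ :=
  fun z => fderiv ℝ β z (Pi.single j 1)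

theorem partialDeriv_contDiff {L : ℕ} {β : (Fin L → ℝ) → ℝ} (hβ : ContDiff ℝ ∞ β) (j : Fin L) :
    ContDiff ℝ ∞ (partialDeriv β j) :=
  (hβ.fderiv_right (m := ∞) (by simp)).clm_apply contDiff_const

theorem partialDeriv_comm {L : ℕ} {β : (Fin L → ℝ) → ℝ} (hβ : ContDiff ℝ ∞ β) (j k : Fin L) :
    partialDeriv (partialDeriv β j) k = partialDeriv (partialDeriv β k) j := by
  have key : ∀ (j k : Fin L) (z : Fin L → ℝ), partialDeriv (partialDeriv β j) k z =
      fderiv ℝ (fderiv ℝ β) z (Pi.single k 1) (Pi.single j 1) := by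
    intro j k z
    have hd : DifferentiableAt ℝ (fderiv ℝ β) z :=
      ((hβ.fderiv_right (m := ∞) (by simp)).differentiable (by simp)) z
    unfold partialDeriv
    rw [fderiv_clm_apply hd (differentiableAt_const _)]
    simp
  funext z
  rw [key, key]
  have hs : IsSymmSndFDerivAt ℝ β z := (hβ.contDiffAt).isSymmSndFDerivAt (by
    simpa using (WithTop.coe_le_coe.mpr (le_top : (2 : ℕ∞) ≤ ⊤)))
  exact hs _ _

namespace SmoothAlgebra

variable {X : Type*} (A : SmoothAlgebra X)

/-- Generators of the algebra of forms: `inl a` stands for the function `a`, `inr b` for the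
differential `db`. -/
abbrev PreForms : Type _ := FreeAlgebra ℝ (A.Fn ⊕ A.Fn)

/-- The relations between functions and differentials: the functions form the algebra `A`, they
commute with differentials, differentials anticommute, and the chain rule
`d(β(b₁, …, b_L)) = ∑ⱼ (∂β/∂zⱼ)(b₁, …, b_L) dbⱼ` holds for all smooth `β`. -/
inductive FormRel : A.PreForms → A.PreForms → Prop
  | fn_add (a b : A.Fn) : FormRel (FreeAlgebra.ι ℝ (Sum.inl (a + b)))
      (FreeAlgebra.ι ℝ (Sum.inl a) + FreeAlgebra.ι ℝ (Sum.inl b))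
  | fn_mul (a b : A.Fn) : FormRel (FreeAlgebra.ι ℝ (Sum.inl (a * b)))
      (FreeAlgebra.ι ℝ (Sum.inl a) * FreeAlgebra.ι ℝ (Sum.inl b))
  | fn_const (r : ℝ) : FormRel (FreeAlgebra.ι ℝ (Sum.inl (algebraMap ℝ A.Fn r)))
      (algebraMap ℝ A.PreForms r)
  | fn_comm (a b : A.Fn) :
      FormRel (FreeAlgebra.ι ℝ (Sum.inl a) * FreeAlgebra.ι ℝ (Sum.inr b))
        (FreeAlgebra.ι ℝ (Sum.inr b) * FreeAlgebra.ι ℝ (Sum.inl a))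
  | anticomm (a b : A.Fn) :
      FormRel (FreeAlgebra.ι ℝ (Sum.inr a) * FreeAlgebra.ι ℝ (Sum.inr b))
        (-(FreeAlgebra.ι ℝ (Sum.inr b) * FreeAlgebra.ι ℝ (Sum.inr a)))
  | chain {L : ℕ} (β : (Fin L → ℝ) → ℝ) (hβ : ContDiff ℝ ∞ β) (b : Fin L → A.Fn) :
      FormRel (FreeAlgebra.ι ℝ (Sum.inr (A.comp β hβ b)))
        (∑ j, FreeAlgebra.ι ℝ (Sum.inl (A.comp (partialDeriv β j) (partialDeriv_contDiff hβ j) b)) *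
          FreeAlgebra.ι ℝ (Sum.inr (b j)))

/-- The algebra `Λ^*` of differential forms: the exterior algebra, over the functions, of the module
of `1`-forms spanned by the differentials `db` subject to the chain rule (the Kähler differentials of
smooth calculus). For the smooth functions on a manifold `N` it is the usual algebra `Λ^*(N)`; for the
functions on `N` modulo an ideal `I` it is the quotient of `Λ^*(N)` by the ideal generated by `I` and
`dI`, so that `Λ¹ = Λ¹(N) / (I Λ¹(N) + C^∞(N) dI)`; and it commutes with increasing unions. -/
def Forms : Type _ := RingQuot A.FormRel

instance : Ring A.Forms := inferInstanceAs (Ring (RingQuot A.FormRel))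
instance : Algebra ℝ A.Forms := inferInstanceAs (Algebra ℝ (RingQuot A.FormRel))

/-- The quotient map onto the algebra of forms. -/
def mkForm : A.PreForms →ₐ[ℝ] A.Forms := RingQuot.mkAlgHom ℝ A.FormRel

/-- A function as a `0`-form. -/
def fn (a : A.Fn) : A.Forms := A.mkForm (FreeAlgebra.ι ℝ (Sum.inl a))

/-- The differential `db` of a function. -/
def df (b : A.Fn) : A.Forms := A.mkForm (FreeAlgebra.ι ℝ (Sum.inr b))

variable {A}

theorem mkForm_rel {x y : A.PreForms} (h : A.FormRel x y) : A.mkForm x = A.mkForm y :=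
  RingQuot.mkAlgHom_rel ℝ h

theorem fn_add (a b : A.Fn) : A.fn (a + b) = A.fn a + A.fn b := by
  simpa [fn] using mkForm_rel (FormRel.fn_add a b)

theorem fn_mul (a b : A.Fn) : A.fn (a * b) = A.fn a * A.fn b := by
  simpa [fn] using mkForm_rel (FormRel.fn_mul a b)

theorem fn_const (r : ℝ) : A.fn (algebraMap ℝ A.Fn r) = algebraMap ℝ A.Forms r := by
  simpa only [fn, AlgHom.commutes] using mkForm_rel (A := A) (FormRel.fn_const r)

theorem fn_df_comm (a b : A.Fn) : A.fn a * A.df b = A.df b * A.fn a := by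
  simpa [fn, df] using mkForm_rel (FormRel.fn_comm a b)

theorem df_anticomm (a b : A.Fn) : A.df a * A.df b = -(A.df b * A.df a) := by
  simpa [df] using mkForm_rel (FormRel.anticomm a b)

theorem df_comp {L : ℕ} (β : (Fin L → ℝ) → ℝ) (hβ : ContDiff ℝ ∞ β) (b : Fin L → A.Fn) :
    A.df (A.comp β hβ b) =
      ∑ j, A.fn (A.comp (partialDeriv β j) (partialDeriv_contDiff hβ j) b) * A.df (b j) := by
  simpa [fn, df] using mkForm_rel (FormRel.chain β hβ b)

theorem df_const (r : ℝ) : A.df (algebraMap ℝ A.Fn r) = 0 := by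
  have h := df_comp (A := A) (L := 0) (fun _ => r) contDiff_const Fin.elim0
  rw [Finset.univ_eq_empty, Finset.sum_empty] at h
  exact h

theorem df_add (a b : A.Fn) : A.df (a + b) = A.df a + A.df b := by
  have hβ : ContDiff ℝ ∞ (fun z : Fin 2 → ℝ => z 0 + z 1) := by fun_prop
  have h := df_comp (A := A) _ hβ ![a, b]
  have hp : ∀ j : Fin 2, partialDeriv (fun z : Fin 2 → ℝ => z 0 + z 1) j = fun _ => 1 := by
    intro j; funext z
    have : fderiv ℝ (fun z : Fin 2 → ℝ => z 0 + z 1) z =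
        ContinuousLinearMap.proj (R := ℝ) (φ := fun _ : Fin 2 => ℝ) 0 +
        ContinuousLinearMap.proj (R := ℝ) (φ := fun _ : Fin 2 => ℝ) 1 :=
      ((ContinuousLinearMap.proj (R := ℝ) (φ := fun _ : Fin 2 => ℝ) 0 +
        ContinuousLinearMap.proj (R := ℝ) (φ := fun _ : Fin 2 => ℝ) 1).hasFDerivAt).fderiv
    unfold partialDeriv
    rw [this]
    fin_cases j <;> simp
  have h1 : ∀ j : Fin 2, A.comp (partialDeriv (fun z : Fin 2 → ℝ => z 0 + z 1) j)
      (partialDeriv_contDiff hβ j) ![a, b] = algebraMap ℝ A.Fn 1 := by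
    intro j; apply Subtype.ext; funext x
    simp [comp, hp]
  have h2 : A.comp (fun z : Fin 2 → ℝ => z 0 + z 1) hβ ![a, b] = a + b := by
    apply Subtype.ext; funext x; simp [comp]
  rw [h2] at h
  rw [h, Fin.sum_univ_two, h1, h1, fn_const]
  simp

theorem df_mul (a b : A.Fn) : A.df (a * b) = A.fn a * A.df b + A.df a * A.fn b := by
  have hβ : ContDiff ℝ ∞ (fun z : Fin 2 → ℝ => z 0 * z 1) := by fun_prop
  have h := df_comp (A := A) _ hβ ![a, b]
  have hd : ∀ z : Fin 2 → ℝ, fderiv ℝ (fun z : Fin 2 → ℝ => z 0 * z 1) z =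
      z 0 • ContinuousLinearMap.proj 1 + z 1 • ContinuousLinearMap.proj 0 := by
    intro z
    exact (((ContinuousLinearMap.proj (R := ℝ) (φ := fun _ : Fin 2 => ℝ) 0).hasFDerivAt).mul
      ((ContinuousLinearMap.proj (R := ℝ) (φ := fun _ : Fin 2 => ℝ) 1).hasFDerivAt)).fderiv
  have h0 : A.comp (partialDeriv (fun z : Fin 2 → ℝ => z 0 * z 1) 0)
      (partialDeriv_contDiff hβ 0) ![a, b] = b := by
    apply Subtype.ext; funext x
    simp [comp, partialDeriv, hd]
  have h1 : A.comp (partialDeriv (fun z : Fin 2 → ℝ => z 0 * z 1) 1)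
      (partialDeriv_contDiff hβ 1) ![a, b] = a := by
    apply Subtype.ext; funext x
    simp [comp, partialDeriv, hd]
  have h2 : A.comp (fun z : Fin 2 → ℝ => z 0 * z 1) hβ ![a, b] = a * b := by
    apply Subtype.ext; funext x; simp [comp]
  rw [h2] at h
  rw [h, Fin.sum_univ_two, h0, h1, add_comm, ← fn_df_comm b a]
  simp

theorem sum_df_partialDeriv {L : ℕ} (β : (Fin L → ℝ) → ℝ) (hβ : ContDiff ℝ ∞ β)
    (b : Fin L → A.Fn) :
    ∑ j, A.df (A.comp (partialDeriv β j) (partialDeriv_contDiff hβ j) b) * A.df (b j) = 0 := by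
  have e : ∀ j, A.df (A.comp (partialDeriv β j) (partialDeriv_contDiff hβ j) b) * A.df (b j) =
      ∑ k, A.fn (A.comp (partialDeriv (partialDeriv β j) k)
        (partialDeriv_contDiff (partialDeriv_contDiff hβ j) k) b) * (A.df (b k) * A.df (b j)) := by
    intro j
    rw [df_comp, Finset.sum_mul]
    simp only [mul_assoc]
  simp only [e]
  set S := ∑ j, ∑ k, A.fn (A.comp (partialDeriv (partialDeriv β j) k)
    (partialDeriv_contDiff (partialDeriv_contDiff hβ j) k) b) * (A.df (b k) * A.df (b j)) with hS
  have hneg : S = -S := by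
    conv_lhs => rw [hS, Finset.sum_comm]
    rw [hS, ← Finset.sum_neg_distrib]
    refine Finset.sum_congr rfl fun j _ => ?_
    rw [← Finset.sum_neg_distrib]
    refine Finset.sum_congr rfl fun k _ => ?_
    have hc : A.comp (partialDeriv (partialDeriv β k) j)
        (partialDeriv_contDiff (partialDeriv_contDiff hβ k) j) b =
        A.comp (partialDeriv (partialDeriv β j) k)
        (partialDeriv_contDiff (partialDeriv_contDiff hβ j) k) b := by
      apply Subtype.ext; funext x
      simp only [comp]
      rw [partialDeriv_comm hβ j k]
    rw [hc, df_anticomm (b j) (b k), mul_neg]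
  have h2 : (2 : ℝ) • S = 0 := by
    rw [two_smul]; nth_rewrite 1 [hneg]; simp
  exact (smul_eq_zero.mp h2).resolve_left two_ne_zero

/-- The values on generators of the homomorphism `w ↦ ((ε w, dw), (0, w))`, with `ε` the parity
automorphism. It is multiplicative exactly because `d(wη) = dw η + ε(w) dη`. -/
def dGen : A.Fn ⊕ A.Fn → Matrix (Fin 2) (Fin 2) A.Forms :=
  Sum.elim (fun a => !![A.fn a, A.df a; 0, A.fn a]) (fun b => !![-A.df b, 0; 0, A.df b])

theorem dGen_rel {x y : A.PreForms} (h : A.FormRel x y) :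
    FreeAlgebra.lift ℝ (dGen (A := A)) x = FreeAlgebra.lift ℝ (dGen (A := A)) y := by
  induction h with
  | fn_add a b =>
    simp only [map_add, FreeAlgebra.lift_ι_apply, dGen, Sum.elim_inl, fn_add, df_add]
    ext i j; fin_cases i <;> fin_cases j <;> simp
  | fn_mul a b =>
    simp only [map_mul, FreeAlgebra.lift_ι_apply, dGen, Sum.elim_inl, fn_mul, df_mul]
    ext i j; fin_cases i <;> fin_cases j <;> simp [Matrix.mul_apply, Fin.sum_univ_two]
  | fn_const r =>
    simp only [AlgHom.commutes, FreeAlgebra.lift_ι_apply, dGen, Sum.elim_inl, fn_const, df_const]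
    ext i j; fin_cases i <;> fin_cases j <;> simp [Matrix.algebraMap_matrix_apply]
  | fn_comm a b =>
    simp only [map_mul, FreeAlgebra.lift_ι_apply, dGen, Sum.elim_inl, Sum.elim_inr]
    ext i j; fin_cases i <;> fin_cases j <;>
      simp [Matrix.mul_apply, Fin.sum_univ_two, fn_df_comm, df_anticomm a b]
  | anticomm a b =>
    simp only [map_mul, map_neg, FreeAlgebra.lift_ι_apply, dGen, Sum.elim_inr]
    ext i j; fin_cases i <;> fin_cases j <;>
      simp [Matrix.mul_apply, Fin.sum_univ_two, df_anticomm a b]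
  | chain β hβ b =>
    have hs := sum_df_partialDeriv β hβ b
    simp only [map_mul, map_sum, FreeAlgebra.lift_ι_apply, dGen, Sum.elim_inl, Sum.elim_inr]
    ext i j; fin_cases i <;> fin_cases j
    · simp [Matrix.sum_apply, df_comp]
    · simp [Matrix.sum_apply, hs]
    · simp [Matrix.sum_apply]
    · simp [Matrix.sum_apply, df_comp]

variable (A) in
/-- The homomorphism `w ↦ ((ε w, dw), (0, w))`. -/
def dHom : A.Forms →ₐ[ℝ] Matrix (Fin 2) (Fin 2) A.Forms :=
  RingQuot.liftAlgHom ℝ ⟨FreeAlgebra.lift ℝ dGen, fun _ _ h => dGen_rel h⟩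

variable (A) in
/-- The de Rham differential. -/
def d : A.Forms →ₗ[ℝ] A.Forms where
  toFun w := A.dHom w 0 1
  map_add' w η := by simp
  map_smul' r w := by simp

theorem dHom_mkForm (x : A.PreForms) : A.dHom (A.mkForm x) = FreeAlgebra.lift ℝ dGen x :=
  RingQuot.liftAlgHom_mkAlgHom_apply _ _ _ _

theorem dHom_fn (a : A.Fn) : A.dHom (A.fn a) = !![A.fn a, A.df a; 0, A.fn a] := by
  simp only [fn, dHom_mkForm, FreeAlgebra.lift_ι_apply, dGen, Sum.elim_inl]

theorem dHom_df (b : A.Fn) : A.dHom (A.df b) = !![-A.df b, 0; 0, A.df b] := by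
  simp only [df, dHom_mkForm, FreeAlgebra.lift_ι_apply, dGen, Sum.elim_inr]

@[simp] theorem d_fn (a : A.Fn) : A.d (A.fn a) = A.df a := by
  simp [d, dHom_fn]

@[simp] theorem d_df (a : A.Fn) : A.d (A.df a) = 0 := by
  simp [d, dHom_df]

variable (A) in
/-- The monomial form `a db₁ ∧ … ∧ db_k`. -/
def monomial {k : ℕ} (a : A.Fn) (b : Fin k → A.Fn) : A.Forms :=
  A.fn a * (List.ofFn fun i => A.df (b i)).prod

variable (A) in
/-- The space `Λ^k` of `k`-forms (zero for `k < 0`). -/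
def degree (k : ℤ) : Submodule ℝ A.Forms :=
  Submodule.span ℝ {w | ∃ (j : ℕ) (a : A.Fn) (b : Fin j → A.Fn), (j : ℤ) = k ∧ w = A.monomial a b}

end SmoothAlgebra

/-! ### Pullback of functions and forms -/

section Pullback

variable {X Y : Type*}

/-- A map is smooth if it pulls smooth functions back to smooth functions. -/
def IsSmoothMap (A : SmoothAlgebra X) (B : SmoothAlgebra Y) (f : X → Y) : Prop :=
  ∀ b : B.Fn, (b : Y → ℝ) ∘ f ∈ A.toSubalgebra

variable {A : SmoothAlgebra X} {B : SmoothAlgebra Y} {f : X → Y}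

/-- The pullback of functions, `b ↦ b ∘ f`. -/
def IsSmoothMap.pullFn (hf : IsSmoothMap A B f) : B.Fn →ₐ[ℝ] A.Fn where
  toFun b := ⟨(b : Y → ℝ) ∘ f, hf b⟩
  map_one' := rfl
  map_mul' _ _ := rfl
  map_zero' := rfl
  map_add' _ _ := rfl
  commutes' _ := rfl

/-- The values of the pullback of forms on generators: `a ↦ f^*a`, `db ↦ d(f^*b)`. -/
def IsSmoothMap.pullGen (hf : IsSmoothMap A B f) : B.Fn ⊕ B.Fn → A.Forms :=
  Sum.elim (fun a => A.fn (hf.pullFn a)) (fun b => A.df (hf.pullFn b))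

theorem IsSmoothMap.pullGen_rel (hf : IsSmoothMap A B f) {x y : B.PreForms} (h : B.FormRel x y) :
    FreeAlgebra.lift ℝ hf.pullGen x = FreeAlgebra.lift ℝ hf.pullGen y := by
  induction h with
  | fn_add a b => simp [pullGen, SmoothAlgebra.fn_add]
  | fn_mul a b => simp [pullGen, SmoothAlgebra.fn_mul]
  | fn_const r =>
    simp only [AlgHom.commutes, FreeAlgebra.lift_ι_apply, pullGen, Sum.elim_inl,
      SmoothAlgebra.fn_const]
  | fn_comm a b => simpa [pullGen] using SmoothAlgebra.fn_df_comm _ _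
  | anticomm a b => simpa [pullGen] using SmoothAlgebra.df_anticomm _ _
  | chain β hβ b =>
    simp only [map_mul, map_sum, FreeAlgebra.lift_ι_apply, pullGen, Sum.elim_inl, Sum.elim_inr]
    exact SmoothAlgebra.df_comp β hβ fun i => hf.pullFn (b i)

/-- The pullback `f^*` of differential forms. -/
def IsSmoothMap.pull (hf : IsSmoothMap A B f) : B.Forms →ₐ[ℝ] A.Forms :=
  RingQuot.liftAlgHom ℝ ⟨FreeAlgebra.lift ℝ hf.pullGen, fun _ _ h => hf.pullGen_rel h⟩

theorem IsSmoothMap.pull_mkForm (hf : IsSmoothMap A B f) (x : B.PreForms) :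
    hf.pull (B.mkForm x) = FreeAlgebra.lift ℝ hf.pullGen x :=
  RingQuot.liftAlgHom_mkAlgHom_apply _ _ _ _

@[simp] theorem IsSmoothMap.pull_fn (hf : IsSmoothMap A B f) (a : B.Fn) :
    hf.pull (B.fn a) = A.fn (hf.pullFn a) := by
  simp [SmoothAlgebra.fn, pull_mkForm, pullGen]

@[simp] theorem IsSmoothMap.pull_df (hf : IsSmoothMap A B f) (a : B.Fn) :
    hf.pull (B.df a) = A.df (hf.pullFn a) := by
  simp [SmoothAlgebra.df, pull_mkForm, pullGen]

theorem IsSmoothMap.pull_monomial (hf : IsSmoothMap A B f) {k : ℕ} (a : B.Fn) (b : Fin k → B.Fn) :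
    hf.pull (B.monomial a b) = A.monomial (hf.pullFn a) fun i => hf.pullFn (b i) := by
  simp [SmoothAlgebra.monomial, map_list_prod, List.map_ofFn, Function.comp_def]

theorem IsSmoothMap.pull_d (hf : IsSmoothMap A B f) (w : B.Forms) :
    hf.pull (B.d w) = A.d (hf.pull w) := by
  have h : (hf.pull.mapMatrix (m := Fin 2)).comp B.dHom = A.dHom.comp hf.pull := by
    apply RingQuot.ringQuot_ext' ℝ
    apply FreeAlgebra.hom_ext
    funext s
    cases s with
    | inl a =>
      change (B.dHom (B.fn a)).map hf.pull = A.dHom (hf.pull (B.fn a))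
      rw [hf.pull_fn]
      rw [SmoothAlgebra.dHom_fn, SmoothAlgebra.dHom_fn]
      ext i j; fin_cases i <;> fin_cases j <;> simp
    | inr a =>
      change (B.dHom (B.df a)).map hf.pull = A.dHom (hf.pull (B.df a))
      rw [hf.pull_df]
      rw [SmoothAlgebra.dHom_df, SmoothAlgebra.dHom_df]
      ext i j; fin_cases i <;> fin_cases j <;> simp
  exact congrFun (congrFun (DFunLike.congr_fun h w) 0) 1

theorem IsSmoothMap.pull_degree (hf : IsSmoothMap A B f) {k : ℤ} {w : B.Forms}
    (hw : w ∈ B.degree k) : hf.pull w ∈ A.degree k := by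
  have : (B.degree k).map hf.pull.toLinearMap ≤ A.degree k := by
    rw [SmoothAlgebra.degree, Submodule.map_span, Submodule.span_le]
    rintro _ ⟨_, ⟨j, a, b, hj, rfl⟩, rfl⟩
    exact Submodule.subset_span ⟨j, _, _, hj, hf.pull_monomial a b⟩
  exact this ⟨w, hw, rfl⟩

end Pullback

/-! ### The `𝒞`-spectral sequence -/

/-- A set with an algebra of smooth functions and a distribution: `plane ρ` is the set of those
tangent vectors at `ρ` (acting on functions) that belong to the distribution. -/
structure CartanSpace (X : Type*) where
  fns : SmoothAlgebra X
  plane : X → Set (fns.Fn →ₗ[ℝ] ℝ)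

namespace CartanSpace

variable {X Y : Type*} (𝒳 : CartanSpace X) (𝒴 : CartanSpace Y)

/-- The Cartan forms: the homogeneous forms `∑ₛ aₛ dbₛ₁ ∧ … ∧ dbₛₖ` that vanish on every plane
of the distribution. -/
def cartanForms : Set 𝒳.fns.Forms :=
  {w | ∃ (k N : ℕ) (a : Fin N → 𝒳.fns.Fn) (b : Fin N → Fin k → 𝒳.fns.Fn),
    w = ∑ s, 𝒳.fns.monomial (a s) (b s) ∧
    ∀ (ρ : X) (v : Fin k → (𝒳.fns.Fn →ₗ[ℝ] ℝ)), (∀ i, v i ∈ 𝒳.plane ρ) →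
      ∑ s, (a s : X → ℝ) ρ * (Matrix.of fun i j => v i (b s j)).det = 0}

/-- The Cartan ideal `𝒞Λ^*`: the two-sided ideal generated by the Cartan forms. -/
def cartanIdeal : Submodule ℝ 𝒳.fns.Forms := ⊤ * Submodule.span ℝ 𝒳.cartanForms * ⊤

/-- The filtration by the powers `𝒞^pΛ^*` of the Cartan ideal, with `𝒞^pΛ^* = Λ^*` for `p ≤ 0`. -/
def filtration (p : ℤ) : Submodule ℝ 𝒳.fns.Forms := 𝒳.cartanIdeal ^ p.toNat * ⊤

/-- `𝒞^pΛ^k`. -/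
def filtDegree (p k : ℤ) : Submodule ℝ 𝒳.fns.Forms := 𝒳.filtration p ⊓ 𝒳.fns.degree k

/-- `Z_r^{p,q} = {w ∈ 𝒞^pΛ^{p+q} : dw ∈ 𝒞^{p+r}Λ^{p+q+1}}`. -/
def cycles (r p q : ℤ) : Submodule ℝ 𝒳.fns.Forms :=
  𝒳.filtDegree p (p + q) ⊓ (𝒳.filtDegree (p + r) (p + q + 1)).comap 𝒳.fns.d

/-- `Z_{r-1}^{p+1,q-1} + d Z_{r-1}^{p-r+1,q+r-2}`. -/
def boundaries (r p q : ℤ) : Submodule ℝ 𝒳.fns.Forms :=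
  𝒳.cycles (r - 1) (p + 1) (q - 1) ⊔ (𝒳.cycles (r - 1) (p - r + 1) (q + r - 2)).map 𝒳.fns.d

/-- The term `E_r^{p,q}` of the spectral sequence of the de Rham complex filtered by the powers of
the Cartan ideal. -/
abbrev Page (r p q : ℤ) : Type _ :=
  𝒳.cycles r p q ⧸ (𝒳.boundaries r p q).comap (𝒳.cycles r p q).subtype

variable {𝒳 𝒴}

variable (𝒳 𝒴) in
/-- A smooth map whose differential maps the planes of the first distribution to the respective
planes of the second one. -/
structure IsDEMorphism (f : X → Y) : Prop where
  smooth : IsSmoothMap 𝒳.fns 𝒴.fns f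
  map_plane : ∀ (ρ : X), ∀ v ∈ 𝒳.plane ρ, v ∘ₗ smooth.pullFn.toLinearMap ∈ 𝒴.plane (f ρ)

variable {f : X → Y}

/-- The pullback of forms along a morphism. -/
def IsDEMorphism.pull (hf : IsDEMorphism 𝒳 𝒴 f) : 𝒴.fns.Forms →ₐ[ℝ] 𝒳.fns.Forms := hf.smooth.pull

theorem IsDEMorphism.pull_cartanForms (hf : IsDEMorphism 𝒳 𝒴 f) {w : 𝒴.fns.Forms}
    (hw : w ∈ 𝒴.cartanForms) : hf.pull w ∈ 𝒳.cartanForms := by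
  obtain ⟨k, N, a, b, rfl, h⟩ := hw
  refine ⟨k, N, fun s => hf.smooth.pullFn (a s), fun s i => hf.smooth.pullFn (b s i), ?_, ?_⟩
  · simp [pull, IsSmoothMap.pull_monomial]
  · intro ρ v hv
    exact h (f ρ) (fun i => v i ∘ₗ hf.smooth.pullFn.toLinearMap)
      fun i => hf.map_plane ρ (v i) (hv i)

theorem IsDEMorphism.pull_cartanIdeal (hf : IsDEMorphism 𝒳 𝒴 f) :
    𝒴.cartanIdeal.map hf.pull.toLinearMap ≤ 𝒳.cartanIdeal := by
  unfold cartanIdeal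
  rw [Submodule.map_mul, Submodule.map_mul]
  refine mul_le_mul' (mul_le_mul' le_top ?_) le_top
  rw [Submodule.map_span]
  refine Submodule.span_mono ?_
  rintro _ ⟨w, hw, rfl⟩
  exact hf.pull_cartanForms hw

theorem IsDEMorphism.pull_filtration (hf : IsDEMorphism 𝒳 𝒴 f) (p : ℤ) :
    (𝒴.filtration p).map hf.pull.toLinearMap ≤ 𝒳.filtration p := by
  unfold filtration
  rw [Submodule.map_mul, Submodule.map_pow]
  exact mul_le_mul' (pow_le_pow_left' hf.pull_cartanIdeal _) le_top

theorem IsDEMorphism.pull_filtDegree (hf : IsDEMorphism 𝒳 𝒴 f) {p k : ℤ} {w : 𝒴.fns.Forms}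
    (hw : w ∈ 𝒴.filtDegree p k) : hf.pull w ∈ 𝒳.filtDegree p k :=
  ⟨hf.pull_filtration p ⟨w, hw.1, rfl⟩, hf.smooth.pull_degree hw.2⟩

theorem IsDEMorphism.pull_cycles (hf : IsDEMorphism 𝒳 𝒴 f) {r p q : ℤ} {w : 𝒴.fns.Forms}
    (hw : w ∈ 𝒴.cycles r p q) : hf.pull w ∈ 𝒳.cycles r p q := by
  refine ⟨hf.pull_filtDegree hw.1, ?_⟩
  change 𝒳.fns.d (hf.smooth.pull w) ∈ 𝒳.filtDegree (p + r) (p + q + 1)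
  rw [← hf.smooth.pull_d]
  exact hf.pull_filtDegree hw.2

theorem IsDEMorphism.pull_boundaries (hf : IsDEMorphism 𝒳 𝒴 f) {r p q : ℤ} {w : 𝒴.fns.Forms}
    (hw : w ∈ 𝒴.boundaries r p q) : hf.pull w ∈ 𝒳.boundaries r p q := by
  unfold boundaries at hw ⊢
  obtain ⟨α, hα, _, ⟨η, hη, rfl⟩, rfl⟩ := Submodule.mem_sup.mp hw
  rw [map_add]
  have h : hf.pull (𝒴.fns.d η) = 𝒳.fns.d (hf.pull η) := hf.smooth.pull_d η
  rw [h]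
  exact Submodule.add_mem_sup (hf.pull_cycles hα) (Submodule.mem_map_of_mem (hf.pull_cycles hη))

/-- The homomorphism `E_r^{p,q}(𝒴) → E_r^{p,q}(𝒳)` induced by the pullback of forms. -/
def IsDEMorphism.pageMap (hf : IsDEMorphism 𝒳 𝒴 f) (r p q : ℤ) :
    𝒴.Page r p q →ₗ[ℝ] 𝒳.Page r p q :=
  Submodule.mapQ _ _
    (hf.pull.toLinearMap.restrict fun _ hw => hf.pull_cycles hw)
    (fun _ hw => hf.pull_boundaries hw)

end CartanSpace

/-! ### Infinite jets of sections of a vector bundle -/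

/-- Euclidean space. -/
abbrev Euc (n : ℕ) : Type := EuclideanSpace ℝ (Fin n)

/-- The coordinate space of `k`-jets of maps from `ℝⁿ` to `ℝᵐ` without the point of the source: a
derivative of each order at most `k`. -/
abbrev Derivs (n m k : ℕ) : Type := (j : Fin (k + 1)) → (Euc n [×(j : ℕ)]→L[ℝ] Euc m)

section Jets

variable {n m : ℕ} {M : Type*} [TopologicalSpace M] [ChartedSpace (Euc n) M]
  (E : M → Type*) [∀ x, AddCommGroup (E x)] [∀ x, Module ℝ (E x)] [∀ x, TopologicalSpace (E x)]
  [TopologicalSpace (Bundle.TotalSpace (Euc m) E)] [FiberBundle (Euc m) E]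
  [VectorBundle ℝ (Euc m) E]

/-- Smooth sections of the bundle `E`. -/
abbrev Sec (n m : ℕ) {M : Type*} [TopologicalSpace M] [ChartedSpace (Euc n) M]
    (E : M → Type*) [∀ x, AddCommGroup (E x)] [∀ x, Module ℝ (E x)] [∀ x, TopologicalSpace (E x)]
    [TopologicalSpace (Bundle.TotalSpace (Euc m) E)] [FiberBundle (Euc m) E]
    [VectorBundle ℝ (Euc m) E] : Type _ :=
  ContMDiffSection (𝓡 n) (Euc m) ∞ E

variable (n m) in
/-- The open set around `x₀` on which the chart and the trivialization at `x₀` are both defined. -/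
def domAt (x₀ : M) : Set M :=
  (chartAt (Euc n) x₀).source ∩ (trivializationAt (Euc m) E x₀).baseSet

variable {E}

/-- A section in the chart and the trivialization at `x₀`, as a map from `ℝⁿ` to `ℝᵐ`. -/
def locRep (x₀ : M) (σ : Sec n m E) : Euc n → Euc m := fun y =>
  (trivializationAt (Euc m) E x₀
    ⟨(chartAt (Euc n) x₀).symm y, σ ((chartAt (Euc n) x₀).symm y)⟩).2

/-- The derivatives of order at most `k` at the point `x` of the section `σ`, in the chart and the
trivialization at `x₀`. -/
def derivsAt (k : ℕ) (x₀ x : M) (σ : Sec n m E) : Derivs n m k := fun j =>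
  iteratedFDeriv ℝ j (locRep x₀ σ) (chartAt (Euc n) x₀ x)

/-- Two pairs (point, section) define the same infinite jet if the points agree and so do all
derivatives of the sections at that point. -/
def jetSetoid (n m : ℕ) {M : Type*} [TopologicalSpace M] [ChartedSpace (Euc n) M]
    (E : M → Type*) [∀ x, AddCommGroup (E x)] [∀ x, Module ℝ (E x)] [∀ x, TopologicalSpace (E x)]
    [TopologicalSpace (Bundle.TotalSpace (Euc m) E)] [FiberBundle (Euc m) E]
    [VectorBundle ℝ (Euc m) E] : Setoid (M × Sec n m E) where
  r a b := a.1 = b.1 ∧ ∀ k, derivsAt k a.1 a.1 a.2 = derivsAt k a.1 a.1 b.2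
  iseqv :=
    { refl := fun _ => ⟨rfl, fun _ => rfl⟩
      symm := by
        rintro ⟨x, σ⟩ ⟨y, τ⟩ ⟨h, h'⟩
        obtain rfl : x = y := h
        exact ⟨rfl, fun k => (h' k).symm⟩
      trans := by
        rintro ⟨x, σ⟩ ⟨y, τ⟩ ⟨z, υ⟩ ⟨h, h'⟩ ⟨g, g'⟩
        obtain rfl : x = y := h
        obtain rfl : x = z := g
        exact ⟨rfl, fun k => (h' k).trans (g' k)⟩ }

/-- The space `J^∞(π)` of infinite jets of sections of the bundle `E`. -/
def JetSpace (n m : ℕ) {M : Type*} [TopologicalSpace M] [ChartedSpace (Euc n) M]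
    (E : M → Type*) [∀ x, AddCommGroup (E x)] [∀ x, Module ℝ (E x)] [∀ x, TopologicalSpace (E x)]
    [TopologicalSpace (Bundle.TotalSpace (Euc m) E)] [FiberBundle (Euc m) E]
    [VectorBundle ℝ (Euc m) E] : Type _ :=
  Quotient (jetSetoid n m E)

/-- The infinite jet `[σ]^∞_x`. -/
def jet (x : M) (σ : Sec n m E) : JetSpace n m E := Quotient.mk (jetSetoid n m E) (x, σ)

/-- Smooth functions on `J^∞(π)`: for some `k`, smooth functions of the point and the derivatives of
order at most `k` in the local coordinates. -/
def IsSmoothJetFn (H : JetSpace n m E → ℝ) : Prop :=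
  ∃ k : ℕ, ∀ x₀ : M, ∃ g : Euc n × Derivs n m k → ℝ,
    ContDiffOn ℝ ∞ g ((chartAt (Euc n) x₀ '' domAt n m E x₀) ×ˢ Set.univ) ∧
    ∀ x ∈ domAt n m E x₀, ∀ σ : Sec n m E,
      H (jet x σ) = g (chartAt (Euc n) x₀ x, derivsAt k x₀ x σ)

/-- Smooth functions on `J^∞(π) × [0, 1]`. -/
def IsSmoothJetFnI (H : JetSpace n m E → unitInterval → ℝ) : Prop :=
  ∃ k : ℕ, ∀ x₀ : M, ∃ g : (Euc n × Derivs n m k) × ℝ → ℝ,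
    ContDiffOn ℝ ∞ g
      (((chartAt (Euc n) x₀ '' domAt n m E x₀) ×ˢ Set.univ) ×ˢ Set.Icc (0 : ℝ) 1) ∧
    ∀ x ∈ domAt n m E x₀, ∀ (σ : Sec n m E) (τ : unitInterval),
      H (jet x σ) τ = g ((chartAt (Euc n) x₀ x, derivsAt k x₀ x σ), (τ : ℝ))

theorem IsSmoothJetFn.comp {L : ℕ} (β : (Fin L → ℝ) → ℝ) (hβ : ContDiff ℝ ∞ β)
    (H : Fin L → JetSpace n m E → ℝ) (hH : ∀ i, IsSmoothJetFn (H i)) :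
    IsSmoothJetFn fun θ => β fun i => H i θ := by
  choose k hk using hH
  refine ⟨Finset.univ.sup k, fun x₀ => ?_⟩
  have hle : ∀ i, k i ≤ Finset.univ.sup k := fun i => Finset.le_sup (Finset.mem_univ i)
  choose g hg hg' using fun i => hk i x₀
  let r : ∀ i, Euc n × Derivs n m (Finset.univ.sup k) → Euc n × Derivs n m (k i) := fun i z =>
    (z.1, fun j => z.2 (Fin.castLE (Nat.succ_le_succ (hle i)) j))
  have hr : ∀ i, ContDiff ℝ ∞ (r i) := fun i =>
    contDiff_fst.prodMk (contDiff_pi.mpr fun j =>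
      (ContinuousLinearMap.proj (R := ℝ)
        (φ := fun j : Fin (Finset.univ.sup k + 1) => (Euc n [×(j : ℕ)]→L[ℝ] Euc m))
        (Fin.castLE (Nat.succ_le_succ (hle i)) j)).contDiff.comp contDiff_snd)
  refine ⟨fun z => β fun i => g i (r i z), ?_, ?_⟩
  · refine hβ.comp_contDiffOn (contDiffOn_pi.mpr fun i => ?_)
    exact (hg i).comp (hr i).contDiffOn fun z hz => ⟨hz.1, trivial⟩
  · intro x hx σ
    simp only [hg' _ x hx σ]
    rfl

end Jets

/-! ### Differential equations -/

section Equations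

variable {n m l : ℕ} {M : Type*} [TopologicalSpace M] [ChartedSpace (Euc n) M]
  {E : M → Type*} [∀ x, AddCommGroup (E x)] [∀ x, Module ℝ (E x)] [∀ x, TopologicalSpace (E x)]
  [TopologicalSpace (Bundle.TotalSpace (Euc m) E)] [FiberBundle (Euc m) E]
  [VectorBundle ℝ (Euc m) E]
  {Z : M → Type*} [∀ x, AddCommGroup (Z x)] [∀ x, Module ℝ (Z x)] [∀ x, TopologicalSpace (Z x)]
  [TopologicalSpace (Bundle.TotalSpace (Euc l) Z)] [FiberBundle (Euc l) Z]
  [VectorBundle ℝ (Euc l) Z]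

/-- The smooth (nonlinear) differential operators `F : Γ(E) → Γ(Z)`: for some `r`, the value of `Fσ`
at a point is, in local coordinates, a smooth function `G` of the point and the derivatives of `σ` of
order at most `r` there. -/
def IsDiffOp (F : Sec n m E → Sec n l Z) : Prop :=
  ∃ r : ℕ, ∀ x₀ : M, ∃ G : Euc n × Derivs n m r → Euc l,
    ContDiffOn ℝ ∞ G ((chartAt (Euc n) x₀ '' (domAt n m E x₀ ∩ domAt n l Z x₀)) ×ˢ Set.univ) ∧
    ∀ x ∈ domAt n m E x₀ ∩ domAt n l Z x₀, ∀ σ : Sec n m E,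
      locRep x₀ (F σ) (chartAt (Euc n) x₀ x) = G (chartAt (Euc n) x₀ x, derivsAt r x₀ x σ)

/-- The infinite prolongation of `F = 0`, i.e. the set of its formal solutions in `J^∞(π)`: the jets
`[σ]^∞_x` at which all total derivatives `D_α F^i` vanish. The value of `D_α F^i` at `[σ]^∞_x` is the
partial derivative `∂^α (Fσ)^i` at `x`. -/
def prolongation (F : Sec n m E → Sec n l Z) : Set (JetSpace n m E) :=
  {θ | ∃ (x : M) (σ : Sec n m E), θ = jet x σ ∧ ∀ k, derivsAt k x x (F σ) = 0}

/-- `H = Δ(F)` for a total differential operator `Δ = Δ_i^α D_α`, with `|α| ≤ k`, whose coefficients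
are smooth functions of the point and the derivatives of order at most `k`. -/
def IsTotalDiffImage (F : Sec n m E → Sec n l Z) (H : JetSpace n m E → ℝ) : Prop :=
  ∃ k : ℕ, ∀ x₀ : M, ∃ Δ : Euc n × Derivs n m k → (Derivs n l k →L[ℝ] ℝ),
    ContDiffOn ℝ ∞ Δ ((chartAt (Euc n) x₀ '' (domAt n m E x₀ ∩ domAt n l Z x₀)) ×ˢ Set.univ) ∧
    ∀ x ∈ domAt n m E x₀ ∩ domAt n l Z x₀, ∀ σ : Sec n m E,
      H (jet x σ) = Δ (chartAt (Euc n) x₀ x, derivsAt k x₀ x σ) (derivsAt k x₀ x (F σ))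

variable (n m l E Z) in
/-- A differential equation `F = 0` for sections of `E`, with the regularity assumption that a smooth
function vanishes on the infinite prolongation if and only if it is of the form `Δ(F)`. -/
structure DiffEq where
  op : Sec n m E → Sec n l Z
  isDiffOp : IsDiffOp op
  regular : ∀ H : JetSpace n m E → ℝ, IsSmoothJetFn H →
    ((∀ θ ∈ prolongation op, H θ = 0) ↔ IsTotalDiffImage op H)

namespace DiffEq

variable (𝓔 : DiffEq n m l E Z)

/-- The points of the infinitely prolonged equation. -/
abbrev Pts : Type _ := prolongation 𝓔.op

/-- The algebra `𝓕(𝓔)` of smooth functions: the restrictions of smooth functions on `J^∞(π)`. -/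
def smoothFns : SmoothAlgebra 𝓔.Pts where
  carrier := {h | ∃ H : JetSpace n m E → ℝ, IsSmoothJetFn H ∧ ∀ ρ, h ρ = H ρ}
  mul_mem' := by
    rintro a b ⟨H, hH, h⟩ ⟨K, hK, k⟩
    refine ⟨_, IsSmoothJetFn.comp (fun z : Fin 2 → ℝ => z 0 * z 1) (by fun_prop) ![H, K] ?_, ?_⟩
    · intro i; fin_cases i <;> assumption
    · intro ρ; simp [h, k]
  add_mem' := by
    rintro a b ⟨H, hH, h⟩ ⟨K, hK, k⟩
    refine ⟨_, IsSmoothJetFn.comp (fun z : Fin 2 → ℝ => z 0 + z 1) (by fun_prop) ![H, K] ?_, ?_⟩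
    · intro i; fin_cases i <;> assumption
    · intro ρ; simp [h, k]
  algebraMap_mem' := fun r =>
    ⟨fun _ => r, ⟨0, fun _ => ⟨fun _ => r, contDiffOn_const, fun _ _ _ => rfl⟩⟩, fun _ => rfl⟩
  comp_mem := by
    intro L β hβ b hb
    choose H hH h using hb
    exact ⟨_, IsSmoothJetFn.comp β hβ H hH, fun ρ => by simp [h]⟩

/-- The restriction to `𝓔` of a smooth function on `J^∞(π)`. -/
def restr (H : JetSpace n m E → ℝ) (hH : IsSmoothJetFn H) : 𝓔.smoothFns.Fn :=
  ⟨fun ρ => H ρ, H, hH, fun _ => rfl⟩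

/-- An infinitely prolonged equation with its Cartan distribution. The Cartan plane of `J^∞(π)` at
`[σ]^∞_x` consists of the vectors `H ↦ ξ(y ↦ H([σ]^∞_y))` with `ξ` tangent to the base at `x`; in local
coordinates it is spanned by the total derivatives. The plane of `𝓔` at `ρ ∈ 𝓔` consists of these
vectors regarded as tangent vectors of `𝓔`, i.e. acting on restrictions of functions. -/
def cartan : CartanSpace 𝓔.Pts where
  fns := 𝓔.smoothFns
  plane ρ := {v | ∃ (x : M) (σ : Sec n m E) (ξ : TangentSpace (𝓡 n) x), (ρ : JetSpace n m E) = jet x σ ∧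
    ∀ (H : JetSpace n m E → ℝ) (hH : IsSmoothJetFn H),
      v (𝓔.restr H hH) = mfderiv (𝓡 n) 𝓘(ℝ, ℝ) (fun y => H (jet y σ)) x ξ}

/-- The smooth functions on `𝓔 × [0, 1]`: the restrictions of smooth functions on
`J^∞(π) × [0, 1]`. -/
def IsSmoothFnI (h : 𝓔.Pts × unitInterval → ℝ) : Prop :=
  ∃ H : JetSpace n m E → unitInterval → ℝ, IsSmoothJetFnI H ∧ ∀ ρ τ, h (ρ, τ) = H ρ τ

end DiffEq

end Equations

section Morphisms

variable {n₁ m₁ l₁ : ℕ} {M₁ : Type*} [TopologicalSpace M₁] [ChartedSpace (Euc n₁) M₁]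
  {E₁ : M₁ → Type*} [∀ x, AddCommGroup (E₁ x)] [∀ x, Module ℝ (E₁ x)]
  [∀ x, TopologicalSpace (E₁ x)] [TopologicalSpace (Bundle.TotalSpace (Euc m₁) E₁)]
  [FiberBundle (Euc m₁) E₁] [VectorBundle ℝ (Euc m₁) E₁]
  {Z₁ : M₁ → Type*} [∀ x, AddCommGroup (Z₁ x)] [∀ x, Module ℝ (Z₁ x)]
  [∀ x, TopologicalSpace (Z₁ x)] [TopologicalSpace (Bundle.TotalSpace (Euc l₁) Z₁)]
  [FiberBundle (Euc l₁) Z₁] [VectorBundle ℝ (Euc l₁) Z₁]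
  {n₂ m₂ l₂ : ℕ} {M₂ : Type*} [TopologicalSpace M₂] [ChartedSpace (Euc n₂) M₂]
  {E₂ : M₂ → Type*} [∀ x, AddCommGroup (E₂ x)] [∀ x, Module ℝ (E₂ x)]
  [∀ x, TopologicalSpace (E₂ x)] [TopologicalSpace (Bundle.TotalSpace (Euc m₂) E₂)]
  [FiberBundle (Euc m₂) E₂] [VectorBundle ℝ (Euc m₂) E₂]
  {Z₂ : M₂ → Type*} [∀ x, AddCommGroup (Z₂ x)] [∀ x, Module ℝ (Z₂ x)]
  [∀ x, TopologicalSpace (Z₂ x)] [TopologicalSpace (Bundle.TotalSpace (Euc l₂) Z₂)]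
  [FiberBundle (Euc l₂) Z₂] [VectorBundle ℝ (Euc l₂) Z₂]

/-- DE-morphisms: smooth maps whose differentials map Cartan planes to the respective Cartan
planes. -/
abbrev IsDEMorphism (𝓔₁ : DiffEq n₁ m₁ l₁ E₁ Z₁) (𝓔₂ : DiffEq n₂ m₂ l₂ E₂ Z₂)
    (f : 𝓔₁.Pts → 𝓔₂.Pts) : Prop :=
  CartanSpace.IsDEMorphism 𝓔₁.cartan 𝓔₂.cartan f

/-- A homotopy `f : 𝓔₁ × [0, 1] → 𝓔₂` from `f₀` to `f₁` through DE-morphisms: a smooth map such that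
all `f_τ = f(·, τ)` are DE-morphisms. -/
structure IsDEHomotopy (𝓔₁ : DiffEq n₁ m₁ l₁ E₁ Z₁) (𝓔₂ : DiffEq n₂ m₂ l₂ E₂ Z₂)
    (f₀ f₁ : 𝓔₁.Pts → 𝓔₂.Pts) (f : 𝓔₁.Pts × unitInterval → 𝓔₂.Pts) : Prop where
  smooth : ∀ b : 𝓔₂.smoothFns.Fn, 𝓔₁.IsSmoothFnI ((b : 𝓔₂.Pts → ℝ) ∘ f)
  zero : ∀ ρ, f (ρ, 0) = f₀ ρ
  one : ∀ ρ, f (ρ, 1) = f₁ ρ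
  morphism : ∀ τ : unitInterval, IsDEMorphism 𝓔₁ 𝓔₂ fun ρ => f (ρ, τ)

end Morphisms

end

open scoped Manifold ContDiff Bundle

noncomputable section

/-! ### Integrals depending on parameters -/

section ParametricIntegral

variable {H : Type} [NormedAddCommGroup H] [NormedSpace ℝ H] [ProperSpace H]

/-! Let `F` be the homotopy, reparametrized so that `t` runs over the whole line, and let `K` be the
operator `ω ↦ ∫₀¹ ι_{∂/∂t} F^*ω dt`. The classical homotopy formula reads `dK + Kd = f₁^* - f₀^*`.
Write `F^*ω = v + dt ∧ w` with `v`, `w` families of forms on the first equation. Every slice of `F`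
preserves Cartan forms, so if `ω` lies in the `p`-th power of the Cartan ideal, then so does `v`; in
`w` the contraction has spoiled at most one Cartan factor. Hence `K` lowers the filtration by at
most one. For `ω ∈ Z_2^{p,q}` the form `Kdω` then lies in filtration `p + 1` and `Kω` in filtration
`p - 1`; by the homotopy formula `d(Kdω)` lies in filtration `p + 2` and `d(Kω)` in filtration `p`.
So `f₁^*ω - f₀^*ω = Kdω + d(Kω)` belongs to the denominator of `E_2^{p,q}`
(`pageMap_two_eq_of_homotopy`).

The forms are given by generators and relations, so each ingredient has to be built algebraically.

The decomposition `v + dt ∧ w` is an algebra homomorphism `split` from the forms on the cylinder to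
upper triangular matrices over an algebra `Families` of sums `c(t) w`. It requires a differential
along `X` of a function `γ(t, a₁, …, a_L)` that does not depend on its presentation. Two families
are therefore identified when no multiplication followed by integration separates them, and
integration by parts yields independence (`baseDiffRep_eq`).

That `v` is a family of Cartan forms requires more than vanishing on the planes at every `t`: it
must be a combination of Cartan forms on `X` with coefficients depending on `t`. A finite frame of
total derivatives `D_j` with dual functions `y_j` lets every differential be replaced by `∑ D_j(·)
dy_j` modulo the ideal, and what remains after this replacement vanishes identically
(`Frame.sum_mem_famSpan`).

Lastly, functions pulled back by `F` must be smooth functions of `t` and of finitely many functions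
on the equation (`IsSmoothJetFnI.exists_factorization`). The base may be noncompact, so this and the
frame rest on a covering by coordinate domains in finitely many colours, with disjoint domains
within each colour. Each colour then behaves like a single chart. -/

theorem hasFDerivAt_intervalIntegral_of_contDiff {G : Type} [NormedAddCommGroup G]
    [NormedSpace ℝ G] {f : ℝ × H → G} (hf : ContDiff ℝ ∞ f) (z : H) :
    HasFDerivAt (fun z => ∫ t in (0 : ℝ)..1, f (t, z))
      (∫ t in (0 : ℝ)..1, (fderiv ℝ f (t, z)).comp (ContinuousLinearMap.inr ℝ ℝ H)) z := by
  have hf' : Continuous (fun w : ℝ × H => (fderiv ℝ f w).comp (ContinuousLinearMap.inr ℝ ℝ H)) :=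
    (hf.continuous_fderiv (by simp)).clm_comp continuous_const
  -- The derivative is bounded on the compact set `[0, 1] × closedBall z 1`; the bound serves as the
  -- dominating constant.
  obtain ⟨C, hC⟩ := ((isCompact_Icc (a := (0 : ℝ)) (b := 1)).prod
    (isCompact_closedBall z 1)).exists_bound_of_continuousOn hf'.continuousOn
  refine intervalIntegral.hasFDerivAt_integral_of_dominated_of_fderiv_le (𝕜 := ℝ)
    (F := fun z t => f (t, z))
    (F' := fun z t => (fderiv ℝ f (t, z)).comp (ContinuousLinearMap.inr ℝ ℝ H))
    (bound := fun _ => C) (Metric.ball_mem_nhds z one_pos) ?_ ?_ ?_ ?_ ?_ ?_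
  · exact Filter.Eventually.of_forall fun x =>
      (hf.continuous.comp (by fun_prop : Continuous fun t : ℝ => (t, x))).aestronglyMeasurable
  · exact (hf.continuous.comp (by fun_prop : Continuous fun t : ℝ => (t, z))).intervalIntegrable _ _
  · exact (hf'.comp (by fun_prop : Continuous fun t : ℝ => (t, z))).aestronglyMeasurable
  · refine Filter.Eventually.of_forall fun t ht x hx => hC (t, x) ⟨?_, Metric.ball_subset_closedBall hx⟩
    rw [Set.uIoc_of_le zero_le_one] at ht
    exact ⟨ht.1.le, ht.2⟩
  · exact intervalIntegrable_const
  · refine Filter.Eventually.of_forall fun t _ x _ => ?_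
    have h1 : HasFDerivAt f (fderiv ℝ f (t, x)) (t, x) :=
      (hf.differentiable (by simp) _).hasFDerivAt
    exact h1.comp x (hasFDerivAt_prodMk_right t x)

/-- The derivative in `z` is again an integral of a smooth function, now with values in continuous
linear maps. The induction on the order therefore runs over all target spaces `G` simultaneously. -/
theorem contDiff_intervalIntegral {G : Type} [NormedAddCommGroup G] [NormedSpace ℝ G]
    {f : ℝ × H → G} (hf : ContDiff ℝ ∞ f) :
    ContDiff ℝ ∞ (fun z => ∫ t in (0 : ℝ)..1, f (t, z)) := by
  rw [contDiff_infty]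
  intro n
  induction n generalizing G with
  | zero =>
    exact contDiff_zero.mpr (continuous_iff_continuousAt.mpr fun z =>
      (hasFDerivAt_intervalIntegral_of_contDiff hf z).continuousAt)
  | succ n ih =>
    refine contDiff_succ_iff_hasFDerivAt.mpr
      ⟨_, ih (f := fun w => (fderiv ℝ f w).comp (ContinuousLinearMap.inr ℝ ℝ H)) ?_,
        hasFDerivAt_intervalIntegral_of_contDiff hf⟩
    exact (hf.fderiv_right (m := ∞) (by simp)).clm_comp contDiff_const

end ParametricIntegral

/-! ### Partial derivatives of functions of `(t, z)` -/

section Calculus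

variable {L : ℕ}

theorem contDiff_finCons : ContDiff ℝ ∞ (fun w : ℝ × (Fin L → ℝ) => (Fin.cons w.1 w.2 : Fin (L + 1) → ℝ)) := by
  rw [contDiff_pi]
  intro i
  refine Fin.cases ?_ (fun j => ?_) i
  · simpa using contDiff_fst
  · simp only [Fin.cons_succ]; fun_prop

theorem hasFDerivAt_of_contDiff {β : (Fin L → ℝ) → ℝ} (hβ : ContDiff ℝ ∞ β) (z : Fin L → ℝ) :
    HasFDerivAt β (fderiv ℝ β z) z := (hβ.differentiable (by simp) z).hasFDerivAt

theorem fderiv_apply_eq_sum_partialDeriv (β : (Fin L → ℝ) → ℝ) (z w : Fin L → ℝ) :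
    fderiv ℝ β z w = ∑ j, partialDeriv β j z * w j := by
  conv_lhs => rw [pi_eq_sum_univ' w]
  simp [partialDeriv, mul_comm]

/-- The integral `∫₀¹ γ(t, z) dt`. -/
def paramInt (γ : (Fin (L + 1) → ℝ) → ℝ) : (Fin L → ℝ) → ℝ :=
  fun z => ∫ t in (0 : ℝ)..1, γ (Fin.cons t z)

variable {γ : (Fin (L + 1) → ℝ) → ℝ}

theorem paramInt_contDiff (hγ : ContDiff ℝ ∞ γ) : ContDiff ℝ ∞ (paramInt γ) :=
  contDiff_intervalIntegral (hγ.comp contDiff_finCons)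

theorem hasFDerivAt_finCons_right (t : ℝ) (z : Fin L → ℝ) :
    HasFDerivAt (fun z : Fin L → ℝ => (Fin.cons t z : Fin (L + 1) → ℝ))
      (ContinuousLinearMap.pi (Fin.cases (0 : (Fin L → ℝ) →L[ℝ] ℝ)
        fun j => ContinuousLinearMap.proj (R := ℝ) (φ := fun _ : Fin L => ℝ) j)) z := by
  rw [hasFDerivAt_pi]
  intro i
  refine Fin.cases ?_ (fun j => ?_) i
  · simpa using hasFDerivAt_const t z
  · simp only [Fin.cons_succ, Fin.cases_succ]
    exact (ContinuousLinearMap.proj (R := ℝ) (φ := fun _ : Fin L => ℝ) j).hasFDerivAt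

theorem partialDeriv_cons (hγ : ContDiff ℝ ∞ γ) (j : Fin L) (t : ℝ) :
    partialDeriv (fun z => γ (Fin.cons t z)) j = fun z => partialDeriv γ j.succ (Fin.cons t z) := by
  funext z
  have h := (hasFDerivAt_of_contDiff hγ (Fin.cons t z)).comp z (hasFDerivAt_finCons_right t z)
  have h' : fderiv ℝ (fun z => γ (Fin.cons t z)) z = _ := h.fderiv
  unfold partialDeriv
  rw [h']
  simp only [ContinuousLinearMap.comp_apply]
  congr 1
  funext i
  refine Fin.cases ?_ (fun k => ?_) i
  · simp
  · simp [Pi.single_apply, Fin.succ_inj]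

/-- Differentiation under the integral sign. It turns the chain rule for `paramInt γ` into a formula
for the differential of an integral over `t`. -/
theorem partialDeriv_paramInt (hγ : ContDiff ℝ ∞ γ) (j : Fin L) :
    partialDeriv (paramInt γ) j = paramInt (partialDeriv γ j.succ) := by
  have hc := hγ.comp contDiff_finCons
  funext z
  unfold partialDeriv paramInt
  have h : fderiv ℝ (fun z => ∫ t in (0 : ℝ)..1, γ (Fin.cons t z)) z = _ :=
    (hasFDerivAt_intervalIntegral_of_contDiff hc z).fderiv
  rw [h, ContinuousLinearMap.intervalIntegral_apply]
  · refine intervalIntegral.integral_congr fun t _ => ?_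
    have h2 := congrFun (partialDeriv_cons hγ j t) z
    have h1 : fderiv ℝ (fun z => γ (Fin.cons t z)) z = _ :=
      ((hc.differentiable (by simp) (t, z)).hasFDerivAt.comp z
        (hasFDerivAt_prodMk_right t z)).fderiv
    simp only [partialDeriv] at h2
    exact (DFunLike.congr_fun h1 (Pi.single j 1)).symm.trans h2
  · refine Continuous.intervalIntegrable ?_ _ _
    exact ((hc.continuous_fderiv (by simp)).comp
      (by fun_prop : Continuous fun t : ℝ => (t, z))).clm_comp continuous_const

theorem partialDeriv_comp {r : ℕ} {β : (Fin r → ℝ) → ℝ} (hβ : ContDiff ℝ ∞ β)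
    {g : Fin r → (Fin L → ℝ) → ℝ} (hg : ∀ i, ContDiff ℝ ∞ (g i)) (j : Fin L) :
    partialDeriv (fun z => β fun i => g i z) j =
      fun z => ∑ i, partialDeriv β i (fun i => g i z) * partialDeriv (g i) j z := by
  funext z
  have h : fderiv ℝ (fun z => β fun i => g i z) z = _ :=
    ((hasFDerivAt_of_contDiff hβ (fun i => g i z)).comp z
    (hasFDerivAt_pi.mpr fun i => hasFDerivAt_of_contDiff (hg i) z)).fderiv
  conv_lhs => unfold partialDeriv
  rw [h, ContinuousLinearMap.comp_apply, fderiv_apply_eq_sum_partialDeriv]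
  rfl

end Calculus

theorem partialDeriv_proj {L : ℕ} (i j : Fin L) :
    partialDeriv (fun z : Fin L → ℝ => z i) j = fun _ => if i = j then 1 else 0 := by
  funext z
  have h : fderiv ℝ (fun z : Fin L → ℝ => z i) z = _ :=
    (ContinuousLinearMap.proj (R := ℝ) (φ := fun _ : Fin L => ℝ) i).hasFDerivAt.fderiv
  unfold partialDeriv
  rw [h]
  simp [Pi.single_apply]

theorem partialDeriv_mul {L : ℕ} {β δ : (Fin L → ℝ) → ℝ} (hβ : ContDiff ℝ ∞ β)
    (hδ : ContDiff ℝ ∞ δ) (j : Fin L) :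
    partialDeriv (fun z => β z * δ z) j =
      fun z => β z * partialDeriv δ j z + δ z * partialDeriv β j z := by
  funext z
  have h : fderiv ℝ (fun z => β z * δ z) z = _ :=
    ((hasFDerivAt_of_contDiff hβ z).mul (hasFDerivAt_of_contDiff hδ z)).fderiv
  unfold partialDeriv
  rw [h]
  simp

theorem hasDerivAt_cons {L : ℕ} {γ : (Fin (L + 1) → ℝ) → ℝ} (hγ : ContDiff ℝ ∞ γ)
    (z : Fin L → ℝ) (t : ℝ) :
    HasDerivAt (fun t => γ (Fin.cons t z)) (partialDeriv γ 0 (Fin.cons t z)) t := by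
  have h1 : HasDerivAt (fun t : ℝ => (Fin.cons t z : Fin (L + 1) → ℝ)) (Pi.single 0 1) t := by
    rw [hasDerivAt_pi]
    intro i
    refine Fin.cases ?_ (fun j => ?_) i
    · simpa using hasDerivAt_id' t
    · simpa using hasDerivAt_const t (z j)
  exact (hasFDerivAt_of_contDiff hγ (Fin.cons t z)).comp_hasDerivAt t h1

namespace SmoothAlgebra

variable {X : Type*} {A : SmoothAlgebra X}

/-! ### The calculus of forms -/

theorem mkForm_surjective : Function.Surjective A.mkForm := RingQuot.mkAlgHom_surjective ℝ _

/-- The algebra of forms is a quotient of the free algebra on functions and differentials, and real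
constants are themselves functions. -/
theorem forms_induction {P : A.Forms → Prop} (hfn : ∀ a, P (A.fn a)) (hdf : ∀ a, P (A.df a))
    (hmul : ∀ v w, P v → P w → P (v * w)) (hadd : ∀ v w, P v → P w → P (v + w)) (w : A.Forms) :
    P w := by
  obtain ⟨x, rfl⟩ := mkForm_surjective w
  induction x using FreeAlgebra.induction with
  | grade0 r =>
    rw [AlgHom.commutes, ← fn_const]
    exact hfn _
  | grade1 s =>
    cases s with
    | inl a => exact hfn a
    | inr a => exact hdf a
  | mul x y hx hy => rw [map_mul]; exact hmul _ _ hx hy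
  | add x y hx hy => rw [map_add]; exact hadd _ _ hx hy

theorem fn_smul (r : ℝ) (a : A.Fn) : A.fn (r • a) = r • A.fn a := by
  rw [Algebra.smul_def, fn_mul, fn_const, ← Algebra.smul_def]

variable (A) in
/-- Functions as `0`-forms. -/
def fnHom : A.Fn →ₐ[ℝ] A.Forms :=
  AlgHom.ofLinearMap { toFun := A.fn, map_add' := fn_add, map_smul' := fn_smul }
    (by simpa using fn_const (A := A) 1) fn_mul

theorem fn_one : A.fn 1 = 1 := map_one A.fnHom

theorem df_smul (r : ℝ) (a : A.Fn) : A.df (r • a) = r • A.df a := by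
  rw [Algebra.smul_def, df_mul, df_const, fn_const, zero_mul, add_zero, ← Algebra.smul_def]

variable (A) in
/-- The differential of functions as a linear map. -/
def dfHom : A.Fn →ₗ[ℝ] A.Forms where
  toFun := A.df
  map_add' := df_add
  map_smul' := df_smul

theorem df_mul_self (a : A.Fn) : A.df a * A.df a = 0 := by
  have h := df_anticomm a a
  have h2 : (2 : ℝ) • (A.df a * A.df a) = 0 := by
    rw [two_smul]; nth_rewrite 1 [h]; simp
  exact (smul_eq_zero.mp h2).resolve_left two_ne_zero

theorem fn_comm (a : A.Fn) (w : A.Forms) : A.fn a * w = w * A.fn a := by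
  induction w using forms_induction with
  | hfn b => rw [← fn_mul, mul_comm, fn_mul]
  | hdf b => exact fn_df_comm a b
  | hmul v w hv hw => rw [← mul_assoc, hv, mul_assoc, hw, mul_assoc]
  | hadd v w hv hw => rw [mul_add, hv, hw, add_mul]

variable (A) in
/-- The parity automorphism of the algebra of forms. -/
def parity : A.Forms →ₐ[ℝ] A.Forms :=
  RingQuot.liftAlgHom ℝ ⟨FreeAlgebra.lift ℝ (Sum.elim A.fn fun b => -A.df b), fun x y h => by
    induction h with
    | fn_add a b => simp [fn_add]
    | fn_mul a b => simp [fn_mul]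
    | fn_const r => simp only [AlgHom.commutes, FreeAlgebra.lift_ι_apply, Sum.elim_inl, fn_const]
    | fn_comm a b => simpa using fn_df_comm a b
    | anticomm a b => simpa using df_anticomm a b
    | chain β hβ b => simp [df_comp]⟩

@[simp] theorem parity_fn (a : A.Fn) : A.parity (A.fn a) = A.fn a := by
  simp only [fn, mkForm]
  refine (RingQuot.liftAlgHom_mkAlgHom_apply ℝ _ _ _).trans ?_
  simp [fn, mkForm]

@[simp] theorem parity_df (a : A.Fn) : A.parity (A.df a) = -A.df a := by
  simp only [df, mkForm]
  refine (RingQuot.liftAlgHom_mkAlgHom_apply ℝ _ _ _).trans ?_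
  simp [df, mkForm]

theorem mul_df (w : A.Forms) (a : A.Fn) : w * A.df a = A.df a * A.parity w := by
  induction w using forms_induction with
  | hfn b => rw [parity_fn, fn_df_comm]
  | hdf b => rw [parity_df, df_anticomm, mul_neg]
  | hmul v w hv hw => rw [mul_assoc, hw, ← mul_assoc, hv, mul_assoc, map_mul]
  | hadd v w hv hw => rw [add_mul, hv, hw, map_add, mul_add]

/-- All entries of the matrix are identified, so that multiplicativity of `dHom`, read off in the
upper right corner, becomes the graded Leibniz rule. -/
theorem dHom_eq (w : A.Forms) : A.dHom w = !![A.parity w, A.d w; 0, w] := by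
  have h : A.dHom w 0 0 = A.parity w ∧ A.dHom w 1 0 = 0 ∧ A.dHom w 1 1 = w := by
    induction w using forms_induction with
    | hfn a => simp [dHom_fn]
    | hdf a => simp [dHom_df]
    | hmul v w hv hw => simp [Matrix.mul_apply, Fin.sum_univ_two, hv, hw]
    | hadd v w hv hw => simp [hv, hw]
  ext i j
  fin_cases i <;> fin_cases j
  · exact h.1
  · rfl
  · exact h.2.1
  · exact h.2.2

theorem d_mul (v w : A.Forms) : A.d (v * w) = A.parity v * A.d w + A.d v * w := by
  have h := congrFun (congrFun (map_mul A.dHom v w) 0) 1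
  simp only [Matrix.mul_apply, Fin.sum_univ_two, dHom_eq] at h
  simpa using h

/-- The two identities need a joint induction: in `d(d(vw))` the mixed terms are `d(εv) dw` and
`ε(dv) dw`, which cancel exactly when `d` anticommutes with the parity `ε`. -/
theorem d_d_and_d_parity (w : A.Forms) :
    A.d (A.d w) = 0 ∧ A.d (A.parity w) = -A.parity (A.d w) := by
  induction w using forms_induction with
  | hfn a => simp
  | hdf a => simp
  | hmul v w hv hw =>
    simp only [d_mul, map_add, map_mul, hv, hw]
    constructor
    · simp
    · simp only [neg_mul, mul_neg]; abel
  | hadd v w hv hw =>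
    simp only [map_add, hv, hw]
    constructor
    · simp
    · abel

theorem d_d (w : A.Forms) : A.d (A.d w) = 0 := (d_d_and_d_parity w).1

/-! ### Smooth functions on the cylinder -/

variable (A) in
/-- The functions on `X × ℝ` of the form `γ(t, a₁, …, a_L)`. -/
def IsCylFn (c : X × ℝ → ℝ) : Prop :=
  ∃ (L : ℕ) (a : Fin L → A.Fn) (γ : (Fin (L + 1) → ℝ) → ℝ), ContDiff ℝ ∞ γ ∧
    ∀ ρ t, c (ρ, t) = γ (Fin.cons t fun i => (a i : X → ℝ) ρ)

/-- A function of `(t, z)` as a function of `(t, z')` through `z_j = z'_{σ j}`. -/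
def reindex {L L' : ℕ} (σ : Fin L → Fin L') (γ : (Fin (L + 1) → ℝ) → ℝ) :
    (Fin (L' + 1) → ℝ) → ℝ :=
  fun w => γ fun i => w (Fin.cases 0 (fun j => (σ j).succ) i)

theorem reindex_contDiff {L L' : ℕ} (σ : Fin L → Fin L') {γ : (Fin (L + 1) → ℝ) → ℝ}
    (hγ : ContDiff ℝ ∞ γ) : ContDiff ℝ ∞ (reindex σ γ) :=
  hγ.comp (contDiff_pi.mpr fun _ => contDiff_apply ℝ ℝ _)

theorem reindex_cons {L L' : ℕ} (σ : Fin L → Fin L') (γ : (Fin (L + 1) → ℝ) → ℝ) (t : ℝ)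
    (z : Fin L' → ℝ) : reindex σ γ (Fin.cons t z) = γ (Fin.cons t fun j => z (σ j)) := by
  unfold reindex
  congr 1
  funext i
  refine Fin.cases ?_ (fun j => ?_) i <;> simp

/-- The lists of base functions are concatenated along a sigma type, and each `γ i` is made to
ignore the arguments that belong to the others. -/
theorem exists_common_cyl {r : ℕ} {c : Fin r → X × ℝ → ℝ} (hc : ∀ i, A.IsCylFn (c i)) :
    ∃ (L : ℕ) (a : Fin L → A.Fn) (γ : Fin r → (Fin (L + 1) → ℝ) → ℝ),
      (∀ i, ContDiff ℝ ∞ (γ i)) ∧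
      ∀ i ρ t, c i (ρ, t) = γ i (Fin.cons t fun i => (a i : X → ℝ) ρ) := by
  choose L a γ hγ h using hc
  refine ⟨∑ i, L i, fun k => a (finSigmaFinEquiv.symm k).1 (finSigmaFinEquiv.symm k).2,
    fun i => reindex (fun j => finSigmaFinEquiv ⟨i, j⟩) (γ i),
    fun i => reindex_contDiff _ (hγ i), fun i ρ t => ?_⟩
  refine (h i ρ t).trans (Eq.trans ?_ (reindex_cons _ _ _ _).symm)
  have : ∀ j, (finSigmaFinEquiv.symm (finSigmaFinEquiv (⟨i, j⟩ : Σ i, Fin (L i)))) = ⟨i, j⟩ :=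
    fun j => Equiv.symm_apply_apply _ _
  congr 2
  funext j
  change _ = ((fun k => a k.1 k.2 : (Σ i, Fin (L i)) → A.Fn) (finSigmaFinEquiv.symm
    (finSigmaFinEquiv ⟨i, j⟩)) : X → ℝ) ρ
  rw [this]

theorem IsCylFn.comp {L : ℕ} (β : (Fin L → ℝ) → ℝ) (hβ : ContDiff ℝ ∞ β)
    (b : Fin L → X × ℝ → ℝ) (hb : ∀ i, A.IsCylFn (b i)) :
    A.IsCylFn fun x => β fun i => b i x := by
  obtain ⟨L, a, γ, hγ, h⟩ := exists_common_cyl hb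
  exact ⟨L, a, fun w => β fun i => γ i w, hβ.comp (contDiff_pi.mpr hγ), fun ρ t => by simp only [h]⟩

variable (A) in
/-- The smooth functions on the cylinder `X × ℝ`. -/
def cyl : SmoothAlgebra (X × ℝ) where
  carrier := {c | A.IsCylFn c}
  mul_mem' {a b} ha hb := by
    have := IsCylFn.comp (A := A) (fun z : Fin 2 → ℝ => z 0 * z 1) (by fun_prop) ![a, b]
      (by intro i; fin_cases i <;> assumption)
    exact this
  add_mem' {a b} ha hb := by
    have := IsCylFn.comp (A := A) (fun z : Fin 2 → ℝ => z 0 + z 1) (by fun_prop) ![a, b]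
      (by intro i; fin_cases i <;> assumption)
    exact this
  algebraMap_mem' r := ⟨0, Fin.elim0, fun _ => r, contDiff_const, fun _ _ => rfl⟩
  comp_mem := IsCylFn.comp

/-- The function `γ(t, a₁, …, a_L)` on the cylinder. -/
def cylMk {L : ℕ} (a : Fin L → A.Fn) {γ : (Fin (L + 1) → ℝ) → ℝ} (hγ : ContDiff ℝ ∞ γ) :
    A.cyl.Fn :=
  ⟨fun x => γ (Fin.cons x.2 fun i => (a i : X → ℝ) x.1), L, a, γ, hγ, fun _ _ => rfl⟩

theorem exists_eq_cylMk (c : A.cyl.Fn) :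
    ∃ (L : ℕ) (a : Fin L → A.Fn) (γ : (Fin (L + 1) → ℝ) → ℝ) (hγ : ContDiff ℝ ∞ γ),
      c = cylMk a hγ := by
  obtain ⟨c, L, a, γ, hγ, h⟩ := c
  exact ⟨L, a, γ, hγ, Subtype.ext (funext fun x => h x.1 x.2)⟩

theorem exists_common_cylMk {r : ℕ} (c : Fin r → A.cyl.Fn) :
    ∃ (L : ℕ) (a : Fin L → A.Fn) (γ : Fin r → (Fin (L + 1) → ℝ) → ℝ)
      (hγ : ∀ i, ContDiff ℝ ∞ (γ i)), ∀ i, c i = cylMk a (hγ i) := by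
  obtain ⟨L, a, γ, hγ, h⟩ := exists_common_cyl fun i => (c i).2
  exact ⟨L, a, γ, hγ, fun i => Subtype.ext (funext fun x => h i x.1 x.2)⟩

theorem cylMk_reindex {L L' : ℕ} (b : Fin L' → A.Fn) (σ : Fin L → Fin L')
    {γ : (Fin (L + 1) → ℝ) → ℝ} (hγ : ContDiff ℝ ∞ γ) :
    cylMk b (reindex_contDiff σ hγ) = cylMk (fun j => b (σ j)) hγ :=
  Subtype.ext (funext fun _ => reindex_cons _ _ _ _)

theorem partialDeriv_reindex {L L' : ℕ} (σ : Fin L → Fin L') {γ : (Fin (L + 1) → ℝ) → ℝ}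
    (hγ : ContDiff ℝ ∞ γ) (k : Fin L') (w : Fin (L' + 1) → ℝ) :
    partialDeriv (reindex σ γ) k.succ w =
      ∑ j, if σ j = k then reindex σ (partialDeriv γ j.succ) w else 0 := by
  have h : partialDeriv (fun w => γ fun i => w (Fin.cases 0 (fun j => (σ j).succ) i)) k.succ = _ :=
    partialDeriv_comp hγ (g := fun i (w : Fin (L' + 1) → ℝ) => w (Fin.cases 0 (fun j => (σ j).succ) i))
      (fun i => contDiff_apply ℝ ℝ _) k.succ
  refine (congrFun h w).trans ?_
  simp only [partialDeriv_proj, Fin.sum_univ_succ]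
  have h0 : ¬ (0 : Fin (L' + 1)) = k.succ := (Fin.succ_ne_zero k).symm
  simp only [Fin.cases_zero, Fin.cases_succ, Fin.succ_inj, h0, if_false, mul_zero, zero_add, mul_ite,
    mul_one]
  rfl

theorem coe_sum_apply {ι : Type*} (s : Finset ι) (a : ι → A.Fn) (x : X) :
    ((∑ i ∈ s, a i : A.Fn) : X → ℝ) x = ∑ i ∈ s, (a i : X → ℝ) x := by
  simp

theorem cylMk_partialDeriv_reindex {L L' : ℕ} (b : Fin L' → A.Fn) (σ : Fin L → Fin L')
    {γ : (Fin (L + 1) → ℝ) → ℝ} (hγ : ContDiff ℝ ∞ γ) (k : Fin L') :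
    cylMk b (partialDeriv_contDiff (reindex_contDiff σ hγ) k.succ) =
      ∑ j, if σ j = k then cylMk (fun j => b (σ j)) (partialDeriv_contDiff hγ j.succ) else 0 := by
  apply Subtype.ext
  funext x
  rw [coe_sum_apply]
  refine (partialDeriv_reindex σ hγ k _).trans (Finset.sum_congr rfl fun j _ => ?_)
  split_ifs
  · exact reindex_cons σ (partialDeriv γ j.succ) _ _
  · rfl

/-- A sum over the partial derivatives is independent of dummy variables. -/
theorem sum_reindex {L L' : ℕ} {G : Type*} [AddCommGroup G] [Module ℝ G]
    (B : A.cyl.Fn →ₗ[ℝ] A.Forms →ₗ[ℝ] G) (b : Fin L' → A.Fn) (σ : Fin L → Fin L')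
    {γ : (Fin (L + 1) → ℝ) → ℝ} (hγ : ContDiff ℝ ∞ γ) :
    ∑ k, B (cylMk b (partialDeriv_contDiff (reindex_contDiff σ hγ) k.succ)) (A.df (b k)) =
      ∑ j, B (cylMk (fun j => b (σ j)) (partialDeriv_contDiff hγ j.succ)) (A.df (b (σ j))) := by
  have h : ∀ k, B (cylMk b (partialDeriv_contDiff (reindex_contDiff σ hγ) k.succ)) (A.df (b k)) =
      ∑ j, B (if σ j = k then cylMk (fun j => b (σ j)) (partialDeriv_contDiff hγ j.succ) else 0)
        (A.df (b k)) := fun k => by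
    rw [cylMk_partialDeriv_reindex b σ hγ, map_sum, LinearMap.sum_apply]
  rw [Finset.sum_congr rfl fun k _ => h k, Finset.sum_comm]
  refine Finset.sum_congr rfl fun j _ => ?_
  rw [Finset.sum_eq_single (σ j)]
  · rw [if_pos rfl]
  · intro k _ hk
    rw [if_neg hk.symm, map_zero, LinearMap.zero_apply]
  · intro h
    exact absurd (Finset.mem_univ _) h

variable (A) in
/-- The projection of the cylinder is smooth. -/
theorem isSmoothMap_fst : IsSmoothMap A.cyl A (Prod.fst : X × ℝ → X) := fun b =>
  ⟨1, fun _ => b, fun w => w 1, contDiff_apply ℝ ℝ _, fun _ _ => rfl⟩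

variable (A) in
/-- The inclusions of the slices of the cylinder are smooth. -/
theorem isSmoothMap_slice (t : ℝ) : IsSmoothMap A A.cyl (fun ρ : X => (ρ, t)) := by
  rintro ⟨c, L, a, γ, hγ, h⟩
  have := A.comp_mem (fun z => γ (Fin.cons t z))
    (hγ.comp (contDiff_finCons.comp (contDiff_prodMk_right t))) (fun i => a i) fun i => (a i).2
  convert this using 1
  funext ρ
  exact h ρ t

variable (A) in
/-- The coordinate `t` of the cylinder. -/
def time : A.cyl.Fn := ⟨Prod.snd, 0, Fin.elim0, fun w => w 0, contDiff_apply ℝ ℝ _, fun _ _ => rfl⟩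

/-- Functions on the base as functions on the cylinder. -/
abbrev const (a : A.Fn) : A.cyl.Fn := A.isSmoothMap_fst.pullFn a

theorem cylMk_eq_comp {L : ℕ} (a : Fin L → A.Fn) {γ : (Fin (L + 1) → ℝ) → ℝ}
    (hγ : ContDiff ℝ ∞ γ) :
    cylMk a hγ = A.cyl.comp γ hγ (Fin.cons A.time fun i => const (a i)) := by
  apply Subtype.ext
  funext x
  change γ _ = γ _
  congr 1
  funext i
  refine Fin.cases ?_ (fun j => ?_) i <;> rfl

theorem df_cylMk {L : ℕ} (a : Fin L → A.Fn) {γ : (Fin (L + 1) → ℝ) → ℝ}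
    (hγ : ContDiff ℝ ∞ γ) :
    A.cyl.df (cylMk a hγ) = A.cyl.fn (cylMk a (partialDeriv_contDiff hγ 0)) * A.cyl.df A.time +
      ∑ j, A.cyl.fn (cylMk a (partialDeriv_contDiff hγ j.succ)) * A.cyl.df (const (a j)) := by
  rw [cylMk_eq_comp, df_comp, Fin.sum_univ_succ]
  simp only [Fin.cons_zero, Fin.cons_succ, ← cylMk_eq_comp]

theorem continuous_cyl (c : A.cyl.Fn) (ρ : X) :
    Continuous fun t => (c : X × ℝ → ℝ) (ρ, t) := by
  obtain ⟨L, a, γ, hγ, rfl⟩ := exists_eq_cylMk c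
  exact (hγ.comp (contDiff_finCons.comp (contDiff_prodMk_left fun i => (a i : X → ℝ) ρ))).continuous

/-! ### Integration along the cylinder and the derivative in its direction -/

theorem integral_mem (c : A.cyl.Fn) :
    (fun ρ => ∫ t in (0 : ℝ)..1, (c : X × ℝ → ℝ) (ρ, t)) ∈ A.toSubalgebra := by
  obtain ⟨L, a, γ, hγ, rfl⟩ := exists_eq_cylMk c
  exact A.comp_mem (paramInt γ) (paramInt_contDiff hγ) (fun i => a i) fun i => (a i).2

variable (A) in
/-- The integral `∫₀¹ c dt` of a function on the cylinder. -/
def integral : A.cyl.Fn →ₗ[ℝ] A.Fn where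
  toFun c := ⟨fun ρ => ∫ t in (0 : ℝ)..1, (c : X × ℝ → ℝ) (ρ, t), integral_mem c⟩
  map_add' c c' := by
    apply Subtype.ext
    funext ρ
    exact intervalIntegral.integral_add ((continuous_cyl c ρ).intervalIntegrable _ _)
      ((continuous_cyl c' ρ).intervalIntegrable _ _)
  map_smul' r c := by
    apply Subtype.ext
    funext ρ
    exact intervalIntegral.integral_smul r fun t => (c : X × ℝ → ℝ) (ρ, t)

theorem integral_apply (c : A.cyl.Fn) (ρ : X) :
    (A.integral c : X → ℝ) ρ = ∫ t in (0 : ℝ)..1, (c : X × ℝ → ℝ) (ρ, t) := rfl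

theorem integral_mul_const (c : A.cyl.Fn) (a : A.Fn) :
    A.integral (c * const a) = A.integral c * a := by
  apply Subtype.ext
  funext ρ
  exact intervalIntegral.integral_mul_const ((a : X → ℝ) ρ) fun t => (c : X × ℝ → ℝ) (ρ, t)

theorem df_integral {L : ℕ} (a : Fin L → A.Fn) {γ : (Fin (L + 1) → ℝ) → ℝ}
    (hγ : ContDiff ℝ ∞ γ) :
    A.df (A.integral (cylMk a hγ)) =
      ∑ j, A.fn (A.integral (cylMk a (partialDeriv_contDiff hγ j.succ))) * A.df (a j) := by
  have h : ∀ {γ : (Fin (L + 1) → ℝ) → ℝ} (hγ : ContDiff ℝ ∞ γ),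
      A.integral (cylMk a hγ) = A.comp (paramInt γ) (paramInt_contDiff hγ) a := fun _ => rfl
  rw [h, df_comp]
  refine Finset.sum_congr rfl fun j _ => ?_
  rw [h]
  congr 2
  apply Subtype.ext
  funext ρ
  simp only [comp, partialDeriv_paramInt hγ]

variable (A) in
/-- The derivative `∂c/∂t`. -/
def timeDeriv (c : A.cyl.Fn) : A.cyl.Fn :=
  ⟨fun x => deriv (fun t => (c : X × ℝ → ℝ) (x.1, t)) x.2, by
    obtain ⟨L, a, γ, hγ, rfl⟩ := exists_eq_cylMk c
    exact ⟨L, a, _, partialDeriv_contDiff hγ 0, fun ρ t =>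
      (hasDerivAt_cons hγ (fun i => (a i : X → ℝ) ρ) t).deriv⟩⟩

theorem timeDeriv_cylMk {L : ℕ} (a : Fin L → A.Fn) {γ : (Fin (L + 1) → ℝ) → ℝ}
    (hγ : ContDiff ℝ ∞ γ) :
    A.timeDeriv (cylMk a hγ) = cylMk a (partialDeriv_contDiff hγ 0) :=
  Subtype.ext (funext fun x => (hasDerivAt_cons hγ (fun i => (a i : X → ℝ) x.1) x.2).deriv)

theorem timeDeriv_const (a : A.Fn) : A.timeDeriv (const a) = 0 :=
  Subtype.ext (funext fun x => deriv_const x.2 ((a : X → ℝ) x.1))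

theorem timeDeriv_time : A.timeDeriv A.time = 1 :=
  Subtype.ext (funext fun x => deriv_id x.2)

theorem integral_timeDeriv (c : A.cyl.Fn) :
    A.integral (A.timeDeriv c) =
      (A.isSmoothMap_slice 1).pullFn c - (A.isSmoothMap_slice 0).pullFn c := by
  obtain ⟨L, a, γ, hγ, rfl⟩ := exists_eq_cylMk c
  apply Subtype.ext
  funext ρ
  rw [timeDeriv_cylMk, integral_apply]
  exact intervalIntegral.integral_eq_sub_of_hasDerivAt
    (fun t _ => hasDerivAt_cons hγ (fun i => (a i : X → ℝ) ρ) t)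
    ((continuous_cyl (cylMk a (partialDeriv_contDiff hγ 0)) ρ).intervalIntegrable _ _)

end SmoothAlgebra

namespace SmoothAlgebra

open scoped TensorProduct

variable {X : Type*} {A : SmoothAlgebra X}

/-! ### Families of forms depending on the coordinate `t` -/

variable (A) in
/-- The families `∑ c_s(t) w_s` of forms on `X`. -/
def PreFamilies : Type _ := A.cyl.Fn ⊗[ℝ] A.Forms

instance : Ring A.PreFamilies := inferInstanceAs (Ring (A.cyl.Fn ⊗[ℝ] A.Forms))
instance : Algebra ℝ A.PreFamilies := inferInstanceAs (Algebra ℝ (A.cyl.Fn ⊗[ℝ] A.Forms))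

variable (A) in
/-- The family `c(t) w`. -/
def preFam : A.cyl.Fn →ₗ[ℝ] A.Forms →ₗ[ℝ] A.PreFamilies := TensorProduct.mk ℝ A.cyl.Fn A.Forms

theorem preFam_mul (c c' : A.cyl.Fn) (w w' : A.Forms) :
    A.preFam c w * A.preFam c' w' = A.preFam (c * c') (w * w') :=
  Algebra.TensorProduct.tmul_mul_tmul c c' w w'

theorem preFamilies_induction {P : A.PreFamilies → Prop} (hz : P 0) (h : ∀ c w, P (A.preFam c w))
    (hadd : ∀ v w, P v → P w → P (v + w)) (v : A.PreFamilies) : P v :=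
  TensorProduct.induction_on v hz h hadd

variable (A) in
/-- The map `∑ c_s(t) w_s ↦ ∑ (∫₀¹ c_s dt) w_s`. -/
def pairing : A.PreFamilies →ₗ[ℝ] A.Forms :=
  TensorProduct.lift ((LinearMap.mul ℝ A.Forms).comp (A.fnHom.toLinearMap.comp A.integral))

theorem pairing_preFam (c : A.cyl.Fn) (w : A.Forms) :
    A.pairing (A.preFam c w) = A.fn (A.integral c) * w := rfl

variable (A) in
/-- The largest two-sided ideal contained in the kernel of the pairing. -/
def pairingIdeal : Ideal A.PreFamilies where
  carrier := {w | ∀ v v', A.pairing (v * w * v') = 0}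
  zero_mem' v v' := by simp
  add_mem' {w w'} hw hw' v v' := by rw [mul_add, add_mul, map_add, hw, hw', add_zero]
  smul_mem' u w hw v v' := by rw [smul_eq_mul, ← mul_assoc]; exact hw _ _

instance : (A.pairingIdeal).IsTwoSided where
  mul_mem_of_left {w} u hw v v' := by
    rw [← mul_assoc, mul_assoc]; exact hw _ _

theorem mem_pairingIdeal {w : A.PreFamilies}
    (h : ∀ c η c' η', A.pairing (A.preFam c η * w * A.preFam c' η') = 0) : w ∈ A.pairingIdeal := by
  intro v v'
  induction v using preFamilies_induction with
  | hz => simp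
  | hadd x y hx hy => rw [add_mul, add_mul, map_add, hx, hy, add_zero]
  | h c η =>
    induction v' using preFamilies_induction with
    | hz => simp
    | hadd x y hx hy => rw [mul_add, map_add, hx, hy, add_zero]
    | h c' η' => exact h c η c' η'

variable (A) in
/-- The algebra of the families `∑ c_s(t) w_s` of forms on `X`, modulo those that cannot be
distinguished from zero by multiplying and integrating. -/
def Families : Type _ := A.PreFamilies ⧸ A.pairingIdeal

instance : Ring A.Families := inferInstanceAs (Ring (A.PreFamilies ⧸ A.pairingIdeal))
instance : Algebra ℝ A.Families := inferInstanceAs (Algebra ℝ (A.PreFamilies ⧸ A.pairingIdeal))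

variable (A) in
/-- The quotient map onto the algebra of families. -/
def mkFam : A.PreFamilies →ₐ[ℝ] A.Families := Ideal.Quotient.mkₐ ℝ A.pairingIdeal

theorem mkFam_surjective : Function.Surjective A.mkFam :=
  Ideal.Quotient.mk_surjective (I := A.pairingIdeal)

theorem mkFam_eq {x y : A.PreFamilies} : A.mkFam x = A.mkFam y ↔ x - y ∈ A.pairingIdeal :=
  Ideal.Quotient.eq

/-- Testing with both outer factors equal to `1` shows that the ideal lies in the kernel of the
pairing; integration thus descends to the quotient. -/
theorem pairing_eq_of_mkFam_eq {x y : A.PreFamilies} (h : A.mkFam x = A.mkFam y) :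
    A.pairing x = A.pairing y := by
  have := mkFam_eq.mp h 1 1
  rwa [one_mul, mul_one, map_sub, sub_eq_zero] at this

variable (A) in
/-- The integral of a family of forms. -/
def famIntegral : A.Families →ₗ[ℝ] A.Forms where
  toFun v := A.pairing (mkFam_surjective v).choose
  map_add' v w := by
    rw [← map_add]
    apply pairing_eq_of_mkFam_eq
    rw [map_add, (mkFam_surjective (v + w)).choose_spec, (mkFam_surjective v).choose_spec,
      (mkFam_surjective w).choose_spec]
  map_smul' r v := by
    rw [RingHom.id_apply, ← map_smul]
    apply pairing_eq_of_mkFam_eq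
    rw [map_smul, (mkFam_surjective (r • v)).choose_spec, (mkFam_surjective v).choose_spec]

variable (A) in
/-- The family `c(t) w` as a bilinear map. -/
def famHom : A.cyl.Fn →ₗ[ℝ] A.Forms →ₗ[ℝ] A.Families := A.preFam.compr₂ A.mkFam.toLinearMap

/-- The family `c(t) w`. -/
def fam (c : A.cyl.Fn) (w : A.Forms) : A.Families := A.famHom c w

theorem famHom_apply (c : A.cyl.Fn) (w : A.Forms) : A.famHom c w = fam c w := rfl

theorem fam_eq (c : A.cyl.Fn) (w : A.Forms) : fam c w = A.mkFam (A.preFam c w) := rfl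

theorem famIntegral_fam (c : A.cyl.Fn) (w : A.Forms) :
    A.famIntegral (fam c w) = A.fn (A.integral c) * w := by
  rw [← pairing_preFam]
  exact pairing_eq_of_mkFam_eq (mkFam_surjective (fam c w)).choose_spec

theorem fam_mul (c c' : A.cyl.Fn) (w w' : A.Forms) : fam c w * fam c' w' = fam (c * c') (w * w') := by
  rw [fam_eq, fam_eq, ← map_mul, preFam_mul, fam_eq]

theorem fam_one_one : fam (1 : A.cyl.Fn) (1 : A.Forms) = 1 := map_one A.mkFam

theorem families_induction {P : A.Families → Prop} (hz : P 0) (h : ∀ c w, P (fam c w))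
    (hadd : ∀ v w, P v → P w → P (v + w)) (v : A.Families) : P v := by
  obtain ⟨x, rfl⟩ := mkFam_surjective v
  induction x using preFamilies_induction with
  | hz => rw [map_zero]; exact hz
  | h c w => exact h c w
  | hadd x y hx hy => rw [map_add]; exact hadd _ _ hx hy

theorem fam_one_comm (c : A.cyl.Fn) (v : A.Families) : fam c 1 * v = v * fam c 1 := by
  induction v using families_induction with
  | hz => simp
  | h c' w => rw [fam_mul, fam_mul, mul_comm, one_mul, mul_one]
  | hadd v w hv hw => rw [mul_add, hv, hw, add_mul]

/-- Integration over `t` is linear over functions on `X`, and these are central among forms, so no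
test separates the two sides. The quotient thereby acts as a tensor product over the functions on
`X`. -/
theorem fam_fn_mul (c : A.cyl.Fn) (a : A.Fn) (w : A.Forms) :
    fam c (A.fn a * w) = fam (c * const a) w := by
  refine mkFam_eq.mpr (mem_pairingIdeal fun c₁ η₁ c₂ η₂ => ?_)
  rw [mul_sub, sub_mul, map_sub, sub_eq_zero]
  simp only [preFam_mul, pairing_preFam]
  have h : c₁ * (c * const a) * c₂ = c₁ * c * c₂ * const a := by ring
  rw [h, integral_mul_const, fn_mul, mul_assoc (A.fn _) (A.fn a), ← mul_assoc η₁, ← fn_comm a η₁]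
  simp only [mul_assoc]

/-- Integration by parts. -/
theorem sum_integral_partialDeriv {L : ℕ} (a : Fin L → A.Fn) {γ : (Fin (L + 1) → ℝ) → ℝ}
    (hγ : ContDiff ℝ ∞ γ) {L' : ℕ} (a' : Fin L' → A.Fn) {δ : (Fin (L' + 1) → ℝ) → ℝ}
    (hδ : ContDiff ℝ ∞ δ) :
    ∑ j, A.fn (A.integral (cylMk a' hδ * cylMk a (partialDeriv_contDiff hγ j.succ))) * A.df (a j) =
      A.df (A.integral (cylMk a hγ * cylMk a' hδ)) -
        ∑ j, A.fn (A.integral (cylMk a hγ * cylMk a' (partialDeriv_contDiff hδ j.succ))) *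
          A.df (a' j) := by
  let B (c : A.cyl.Fn) : A.cyl.Fn →ₗ[ℝ] A.Forms →ₗ[ℝ] A.Forms :=
    (LinearMap.mul ℝ A.Forms).comp
      (A.fnHom.toLinearMap.comp (A.integral.comp (LinearMap.mulLeft ℝ c)))
  have hB : ∀ c c' w, B c c' w = A.fn (A.integral (c * c')) * w := fun _ _ _ => rfl
  rw [eq_sub_iff_add_eq]
  have e : Fin.append a a' ∘ Fin.castAdd L' = a := funext fun i => Fin.append_left a a' i
  have e' : Fin.append a a' ∘ Fin.natAdd L = a' := funext fun i => Fin.append_right a a' i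
  -- Both functions are regarded as functions of the concatenated list of arguments. Their product
  -- is then a single such function, and the ordinary product rule applies under the integral.
  have h := sum_reindex (B (cylMk a' hδ)) (Fin.append a a') (Fin.castAdd L') hγ
  have h' := sum_reindex (B (cylMk a hγ)) (Fin.append a a') (Fin.natAdd L) hδ
  simp only [Fin.append_left, Fin.append_right, hB] at h h'
  rw [← h, ← h']
  have hc : cylMk a hγ = cylMk (Fin.append a a') (reindex_contDiff (Fin.castAdd L') hγ) := by
    rw [cylMk_reindex _ _ hγ]; simp only [Fin.append_left]
  have hc' : cylMk a' hδ = cylMk (Fin.append a a') (reindex_contDiff (Fin.natAdd L) hδ) := by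
    rw [cylMk_reindex _ _ hδ]; simp only [Fin.append_right]
  rw [hc, hc']
  have hm : cylMk (Fin.append a a') (reindex_contDiff (Fin.castAdd L') hγ) *
      cylMk (Fin.append a a') (reindex_contDiff (Fin.natAdd L) hδ) =
      cylMk (Fin.append a a') ((reindex_contDiff (Fin.castAdd L') hγ).mul
        (reindex_contDiff (Fin.natAdd L) hδ)) := rfl
  rw [hm, df_integral, ← Finset.sum_add_distrib]
  refine Finset.sum_congr rfl fun j _ => ?_
  rw [← add_mul, ← fn_add, ← map_add]
  congr 3
  apply Subtype.ext
  funext x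
  have hp := congrFun (partialDeriv_mul (reindex_contDiff (Fin.castAdd L') hγ)
    (reindex_contDiff (Fin.natAdd L) hδ) j.succ)
    (Fin.cons x.2 fun i => ((Fin.append a a' i : A.Fn) : X → ℝ) x.1)
  exact (add_comm _ _).trans hp.symm

/-- The differential along `X` of a function `γ(t, a₁, …, a_L)`. -/
def baseDiffRep {L : ℕ} (a : Fin L → A.Fn) {γ : (Fin (L + 1) → ℝ) → ℝ} (hγ : ContDiff ℝ ∞ γ) :
    A.Families :=
  ∑ j, fam (cylMk a (partialDeriv_contDiff hγ j.succ)) (A.df (a j))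

/-- Moving `da_j` to the left past `η` costs the parity automorphism. All test data collect into one
function `c * c'` and one right factor, leaving the sum to which integration by parts applies. -/
theorem pairing_mul_mul {L : ℕ} (a : Fin L → A.Fn) {γ : (Fin (L + 1) → ℝ) → ℝ}
    (hγ : ContDiff ℝ ∞ γ) (c c' : A.cyl.Fn) (η η' : A.Forms) :
    A.pairing (A.preFam c η * (∑ j, A.preFam (cylMk a (partialDeriv_contDiff hγ j.succ))
      (A.df (a j))) * A.preFam c' η') =
    (∑ j, A.fn (A.integral ((c * c') * cylMk a (partialDeriv_contDiff hγ j.succ))) * A.df (a j)) *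
      (A.parity η * η') := by
  simp only [Finset.mul_sum, Finset.sum_mul, map_sum]
  refine Finset.sum_congr rfl fun j _ => ?_
  rw [preFam_mul, preFam_mul, pairing_preFam, mul_df]
  have : c * cylMk a (partialDeriv_contDiff hγ j.succ) * c' =
    c * c' * cylMk a (partialDeriv_contDiff hγ j.succ) := by ring
  rw [this]
  simp only [mul_assoc]

/-- It suffices to compare integrals against test functions. Integration by parts moves the
differential onto the test function, and the resulting expression sees `γ(t, a)` only as a function
on the cylinder, not through its presentation. -/
theorem baseDiffRep_eq {L L' : ℕ} (a : Fin L → A.Fn) {γ : (Fin (L + 1) → ℝ) → ℝ}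
    (hγ : ContDiff ℝ ∞ γ) (a' : Fin L' → A.Fn) {γ' : (Fin (L' + 1) → ℝ) → ℝ}
    (hγ' : ContDiff ℝ ∞ γ') (h : cylMk a hγ = cylMk a' hγ') :
    baseDiffRep a hγ = baseDiffRep a' hγ' := by
  simp only [baseDiffRep, fam_eq, ← map_sum]
  refine mkFam_eq.mpr (mem_pairingIdeal fun c η c' η' => ?_)
  rw [mul_sub, sub_mul, map_sub, pairing_mul_mul a hγ, pairing_mul_mul a' hγ']
  obtain ⟨M, b, δ, hδ, hc⟩ := exists_eq_cylMk (c * c')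
  rw [hc, sum_integral_partialDeriv a hγ, sum_integral_partialDeriv a' hγ', h, sub_self]

/-- The differential along `X` of a function on the cylinder. -/
def baseDiff (c : A.cyl.Fn) : A.Families :=
  baseDiffRep (exists_eq_cylMk c).choose_spec.choose
    (exists_eq_cylMk c).choose_spec.choose_spec.choose_spec.choose

theorem baseDiff_cylMk {L : ℕ} (a : Fin L → A.Fn) {γ : (Fin (L + 1) → ℝ) → ℝ}
    (hγ : ContDiff ℝ ∞ γ) :
    baseDiff (cylMk a hγ) = ∑ j, fam (cylMk a (partialDeriv_contDiff hγ j.succ)) (A.df (a j)) :=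
  baseDiffRep_eq _ _ _ _
    (exists_eq_cylMk (cylMk a hγ)).choose_spec.choose_spec.choose_spec.choose_spec.symm

/-- The differential along `X` commutes with integration over `t`; this accounts for the `dt` part
of the homotopy formula. -/
theorem famIntegral_baseDiff_mul (c : A.cyl.Fn) (w : A.Forms) :
    A.famIntegral (baseDiff c * fam 1 w) = A.df (A.integral c) * w := by
  obtain ⟨L, a, γ, hγ, rfl⟩ := exists_eq_cylMk c
  rw [baseDiff_cylMk, df_integral, Finset.sum_mul, Finset.sum_mul, map_sum]
  refine Finset.sum_congr rfl fun j _ => ?_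
  rw [fam_mul, mul_one, famIntegral_fam, mul_assoc]

theorem baseDiff_comp {r : ℕ} (β : (Fin r → ℝ) → ℝ) (hβ : ContDiff ℝ ∞ β) (c : Fin r → A.cyl.Fn) :
    baseDiff (A.cyl.comp β hβ c) =
      ∑ i, fam (A.cyl.comp (partialDeriv β i) (partialDeriv_contDiff hβ i) c) 1 * baseDiff (c i) := by
  obtain ⟨L, a, γ, hγ, hc⟩ := exists_common_cylMk c
  obtain rfl : c = fun i => cylMk a (hγ i) := funext hc
  have hβγ : ContDiff ℝ ∞ fun w => β fun i => γ i w := hβ.comp (contDiff_pi.mpr hγ)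
  have h : A.cyl.comp β hβ (fun i => cylMk a (hγ i)) = cylMk a hβγ := rfl
  rw [h, baseDiff_cylMk]
  simp only [baseDiff_cylMk, Finset.mul_sum, fam_mul, one_mul]
  rw [Finset.sum_comm]
  refine Finset.sum_congr rfl fun j _ => ?_
  simp only [← famHom_apply]
  rw [← LinearMap.sum_apply, ← map_sum]
  congr 2
  apply Subtype.ext
  funext x
  rw [coe_sum_apply]
  exact congrFun (partialDeriv_comp hβ hγ j.succ) _

theorem baseDiff_const (a : A.Fn) : baseDiff (const a) = fam 1 (A.df a) := by
  have hγ : ContDiff ℝ ∞ fun w : Fin 2 → ℝ => w 1 := contDiff_apply ℝ ℝ _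
  have h : const a = cylMk (fun _ : Fin 1 => a) hγ := rfl
  rw [h, baseDiff_cylMk, Fin.sum_univ_one]
  congr 1
  apply Subtype.ext
  funext x
  exact (congrFun (partialDeriv_proj 1 1) _).trans (by simp)

theorem baseDiff_time : baseDiff A.time = 0 := by
  have hγ : ContDiff ℝ ∞ fun w : Fin 1 → ℝ => w 0 := contDiff_apply ℝ ℝ _
  have h : A.time = cylMk Fin.elim0 hγ := rfl
  rw [h, baseDiff_cylMk]
  simp

theorem timeDeriv_comp {r : ℕ} (β : (Fin r → ℝ) → ℝ) (hβ : ContDiff ℝ ∞ β) (c : Fin r → A.cyl.Fn) :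
    A.timeDeriv (A.cyl.comp β hβ c) =
      ∑ i, A.cyl.comp (partialDeriv β i) (partialDeriv_contDiff hβ i) c * A.timeDeriv (c i) := by
  obtain ⟨L, a, γ, hγ, hc⟩ := exists_common_cylMk c
  obtain rfl : c = fun i => cylMk a (hγ i) := funext hc
  have hβγ : ContDiff ℝ ∞ fun w => β fun i => γ i w := hβ.comp (contDiff_pi.mpr hγ)
  have h : A.cyl.comp β hβ (fun i => cylMk a (hγ i)) = cylMk a hβγ := rfl
  rw [h, timeDeriv_cylMk]
  simp only [timeDeriv_cylMk]
  apply Subtype.ext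
  funext x
  rw [coe_sum_apply]
  exact congrFun (partialDeriv_comp hβ hγ 0) _

theorem baseDiff_anticomm (c c' : A.cyl.Fn) :
    baseDiff c * baseDiff c' = -(baseDiff c' * baseDiff c) := by
  obtain ⟨L, a, γ, hγ, rfl⟩ := exists_eq_cylMk c
  obtain ⟨L', a', γ', hγ', rfl⟩ := exists_eq_cylMk c'
  simp only [baseDiff_cylMk, Finset.sum_mul_sum]
  rw [Finset.sum_comm, ← Finset.sum_neg_distrib]
  refine Finset.sum_congr rfl fun j _ => ?_
  rw [← Finset.sum_neg_distrib]
  refine Finset.sum_congr rfl fun k _ => ?_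
  rw [fam_mul, fam_mul, df_anticomm, mul_comm, ← famHom_apply, map_neg, famHom_apply]

/-! ### The homotopy operator -/

/-- The values on generators of the homomorphism `v + dt w ↦ ((ε v, w), (0, v))`, with `v` and `w`
families of forms on `X` and `ε` the parity automorphism. -/
def splitGen : A.cyl.Fn ⊕ A.cyl.Fn → Matrix (Fin 2) (Fin 2) A.Families :=
  Sum.elim (fun c => !![fam c 1, 0; 0, fam c 1])
    (fun c => !![-baseDiff c, fam (A.timeDeriv c) 1; 0, baseDiff c])

/-- The matrix product encodes `(v + dt w)(v' + dt w') = vv' + dt (ε(v) w' + w v')`. The relations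
reduce to centrality of functions, anticommutativity of `baseDiff`, and the chain rules for
`baseDiff` and `timeDeriv`. -/
theorem splitGen_rel {x y : A.cyl.PreForms} (h : A.cyl.FormRel x y) :
    FreeAlgebra.lift ℝ (splitGen (A := A)) x = FreeAlgebra.lift ℝ (splitGen (A := A)) y := by
  induction h with
  | fn_add a b =>
    simp only [map_add, FreeAlgebra.lift_ι_apply, splitGen, Sum.elim_inl, ← famHom_apply,
      LinearMap.add_apply]
    ext i j; fin_cases i <;> fin_cases j <;> simp
  | fn_mul a b =>
    have h : fam (a * b) (1 : A.Forms) = fam a 1 * fam b 1 := by rw [fam_mul, one_mul]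
    simp only [map_mul, FreeAlgebra.lift_ι_apply, splitGen, Sum.elim_inl, h]
    ext i j; fin_cases i <;> fin_cases j <;> simp [Matrix.mul_apply, Fin.sum_univ_two]
  | fn_const r =>
    have h : fam (algebraMap ℝ A.cyl.Fn r) (1 : A.Forms) = algebraMap ℝ A.Families r := by
      rw [Algebra.algebraMap_eq_smul_one, Algebra.algebraMap_eq_smul_one, ← famHom_apply, map_smul,
        LinearMap.smul_apply, famHom_apply, fam_one_one]
    simp only [AlgHom.commutes, FreeAlgebra.lift_ι_apply, splitGen, Sum.elim_inl, h]
    ext i j; fin_cases i <;> fin_cases j <;> simp [Matrix.algebraMap_matrix_apply]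
  | fn_comm a b =>
    simp only [map_mul, FreeAlgebra.lift_ι_apply, splitGen, Sum.elim_inl, Sum.elim_inr]
    ext i j; fin_cases i <;> fin_cases j <;>
      simp [Matrix.mul_apply, Fin.sum_univ_two, fam_one_comm a]
  | anticomm a b =>
    simp only [map_mul, map_neg, FreeAlgebra.lift_ι_apply, splitGen, Sum.elim_inr]
    ext i j; fin_cases i <;> fin_cases j <;>
      simp [Matrix.mul_apply, Fin.sum_univ_two, baseDiff_anticomm a b, fam_one_comm]
  | chain β hβ b =>
    have ht : fam (A.timeDeriv (A.cyl.comp β hβ b)) (1 : A.Forms) =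
        ∑ i, fam (A.cyl.comp (partialDeriv β i) (partialDeriv_contDiff hβ i) b) 1 *
          fam (A.timeDeriv (b i)) 1 := by
      simp only [fam_mul, one_mul]
      rw [timeDeriv_comp, ← famHom_apply, map_sum, LinearMap.sum_apply]
      rfl
    simp only [map_mul, map_sum, FreeAlgebra.lift_ι_apply, splitGen, Sum.elim_inl, Sum.elim_inr,
      baseDiff_comp, ht]
    ext i j; fin_cases i <;> fin_cases j <;> simp [Matrix.sum_apply]

variable (A) in
/-- The homomorphism `v + dt w ↦ ((ε v, w), (0, v))`. -/
def split : A.cyl.Forms →ₐ[ℝ] Matrix (Fin 2) (Fin 2) A.Families :=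
  RingQuot.liftAlgHom ℝ ⟨FreeAlgebra.lift ℝ splitGen, fun _ _ h => splitGen_rel h⟩

theorem split_mkForm (x : A.cyl.PreForms) : A.split (A.cyl.mkForm x) = FreeAlgebra.lift ℝ splitGen x :=
  RingQuot.liftAlgHom_mkAlgHom_apply _ _ _ _

theorem split_fn (c : A.cyl.Fn) : A.split (A.cyl.fn c) = !![fam c 1, 0; 0, fam c 1] := by
  simp only [fn, split_mkForm, FreeAlgebra.lift_ι_apply, splitGen, Sum.elim_inl]

theorem split_df (c : A.cyl.Fn) :
    A.split (A.cyl.df c) = !![-baseDiff c, fam (A.timeDeriv c) 1; 0, baseDiff c] := by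
  simp only [df, split_mkForm, FreeAlgebra.lift_ι_apply, splitGen, Sum.elim_inr]

theorem split_one_zero (w : A.cyl.Forms) : A.split w 1 0 = 0 := by
  induction w using forms_induction with
  | hfn a => simp [split_fn]
  | hdf a => simp [split_df]
  | hmul v w hv hw => simp [Matrix.mul_apply, Fin.sum_univ_two, hv, hw]
  | hadd v w hv hw => simp [hv, hw]

variable (A) in
/-- The homotopy operator: the integral over `t` of the contraction with `∂/∂t`. -/
def homotopyOp : A.cyl.Forms →ₗ[ℝ] A.Forms where
  toFun w := A.famIntegral (A.split w 0 1)
  map_add' v w := by simp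
  map_smul' r w := by simp

theorem homotopyOp_apply (w : A.cyl.Forms) : A.homotopyOp w = A.famIntegral (A.split w 0 1) := rfl

/-- The pullback of forms from the base to the cylinder. -/
abbrev constForm : A.Forms →ₐ[ℝ] A.cyl.Forms := A.isSmoothMap_fst.pull

theorem fam_one_fn (a : A.Fn) : fam (const a) (1 : A.Forms) = fam 1 (A.fn a) := by
  rw [← mul_one (A.fn a), fam_fn_mul, one_mul]

theorem split_constForm (w : A.Forms) :
    A.split (constForm w) = !![fam 1 (A.parity w), 0; 0, fam 1 w] := by
  have h1 : ∀ v w : A.Forms, fam (1 : A.cyl.Fn) (v * w) = fam 1 v * fam 1 w := fun v w => by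
    rw [fam_mul, one_mul]
  have h2 : ∀ v w : A.Forms, fam (1 : A.cyl.Fn) (v + w) = fam 1 v + fam 1 w := fun v w =>
    map_add (A.famHom 1) v w
  induction w using forms_induction with
  | hfn a => rw [IsSmoothMap.pull_fn, split_fn, parity_fn, fam_one_fn]
  | hdf a =>
    have h3 : fam (0 : A.cyl.Fn) (1 : A.Forms) = 0 := by rw [← famHom_apply]; simp
    have h4 : fam (1 : A.cyl.Fn) (-A.df a) = -fam 1 (A.df a) := map_neg (A.famHom 1) _
    rw [IsSmoothMap.pull_df, split_df, parity_df, baseDiff_const, timeDeriv_const, h3, h4]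
  | hmul v w hv hw =>
    rw [map_mul, map_mul, hv, hw]
    ext i j; fin_cases i <;> fin_cases j <;> simp [Matrix.mul_apply, Fin.sum_univ_two, h1]
  | hadd v w hv hw =>
    rw [map_add, map_add, hv, hw]
    ext i j; fin_cases i <;> fin_cases j <;> simp [h2]

/-- Sums of the two kinds of terms contain `1` and are stable under left multiplication by
generators: functions are absorbed in `c`, `dt` squares to zero, differentials of base functions
enter `w` up to a sign, and `df_cylMk` expresses every other differential through these. -/
theorem cyl_forms_induction {P : A.cyl.Forms → Prop}
    (h : ∀ c w, P (A.cyl.fn c * constForm w))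
    (ht : ∀ c w, P (A.cyl.fn c * A.cyl.df A.time * constForm w))
    (hadd : ∀ v w, P v → P w → P (v + w)) (w : A.cyl.Forms) : P w := by
  let S : Set A.cyl.Forms := {w | (∃ c η, w = A.cyl.fn c * constForm η) ∨
    ∃ c η, w = A.cyl.fn c * A.cyl.df A.time * constForm η}
  have hz : P 0 := by simpa using h 0 0
  suffices hS : w ∈ AddSubmonoid.closure S by
    induction hS using AddSubmonoid.closure_induction with
    | mem x hx =>
      obtain ⟨c, η, rfl⟩ | ⟨c, η, rfl⟩ := hx
      · exact h c η
      · exact ht c η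
    | zero => exact hz
    | add x y _ _ hx hy => exact hadd x y hx hy
  have hfn : ∀ c, ∀ v ∈ AddSubmonoid.closure S, A.cyl.fn c * v ∈ AddSubmonoid.closure S := by
    intro c v hv
    induction hv using AddSubmonoid.closure_induction with
    | mem x hx =>
      refine AddSubmonoid.subset_closure ?_
      obtain ⟨c', η, rfl⟩ | ⟨c', η, rfl⟩ := hx
      · exact Or.inl ⟨c * c', η, by rw [fn_mul, mul_assoc]⟩
      · exact Or.inr ⟨c * c', η, by rw [fn_mul]; simp only [mul_assoc]⟩
    | zero => rw [mul_zero]; exact zero_mem _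
    | add x y _ _ hx hy => rw [mul_add]; exact add_mem hx hy
  have hdt : ∀ v ∈ AddSubmonoid.closure S, A.cyl.df A.time * v ∈ AddSubmonoid.closure S := by
    intro v hv
    induction hv using AddSubmonoid.closure_induction with
    | mem x hx =>
      obtain ⟨c', η, rfl⟩ | ⟨c', η, rfl⟩ := hx
      · exact AddSubmonoid.subset_closure (Or.inr ⟨c', η, by rw [← mul_assoc, ← fn_df_comm]⟩)
      · have : A.cyl.df A.time * (A.cyl.fn c' * A.cyl.df A.time * constForm η) = 0 := by
          rw [fn_df_comm, ← mul_assoc, ← mul_assoc, df_mul_self, zero_mul, zero_mul]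
        rw [this]; exact zero_mem _
    | zero => rw [mul_zero]; exact zero_mem _
    | add x y _ _ hx hy => rw [mul_add]; exact add_mem hx hy
  have hda : ∀ a, ∀ v ∈ AddSubmonoid.closure S,
      A.cyl.df (const a) * v ∈ AddSubmonoid.closure S := by
    intro a v hv
    induction hv using AddSubmonoid.closure_induction with
    | mem x hx =>
      obtain ⟨c', η, rfl⟩ | ⟨c', η, rfl⟩ := hx
      · refine AddSubmonoid.subset_closure (Or.inl ⟨c', A.df a * η, ?_⟩)
        rw [map_mul, IsSmoothMap.pull_df, ← mul_assoc, ← fn_df_comm, mul_assoc]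
      · refine AddSubmonoid.subset_closure (Or.inr ⟨-c', A.df a * η, ?_⟩)
        have hn : A.cyl.fn (-c') = -A.cyl.fn c' := map_neg A.cyl.fnHom c'
        rw [map_mul, IsSmoothMap.pull_df, hn, ← mul_assoc, ← mul_assoc, ← fn_df_comm, mul_assoc _ _ (A.cyl.df A.time),
          df_anticomm]
        simp only [mul_neg, neg_mul, mul_assoc]
    | zero => rw [mul_zero]; exact zero_mem _
    | add x y _ _ hx hy => rw [mul_add]; exact add_mem hx hy
  have key : ∀ u : A.cyl.Forms, ∀ v ∈ AddSubmonoid.closure S, u * v ∈ AddSubmonoid.closure S := by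
    intro u
    induction u using forms_induction with
    | hfn c => exact hfn c
    | hdf c =>
      intro v hv
      obtain ⟨L, a, γ, hγ, rfl⟩ := exists_eq_cylMk c
      rw [df_cylMk, add_mul, Finset.sum_mul]
      refine add_mem ?_ (sum_mem fun j _ => ?_)
      · rw [mul_assoc]; exact hfn _ _ (hdt _ hv)
      · rw [mul_assoc]; exact hfn _ _ (hda _ _ hv)
    | hmul x y hx hy => intro v hv; rw [mul_assoc]; exact hx _ (hy _ hv)
    | hadd x y hx hy => intro v hv; rw [add_mul]; exact add_mem (hx _ hv) (hy _ hv)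
  have h1 : (1 : A.cyl.Forms) ∈ AddSubmonoid.closure S :=
    AddSubmonoid.subset_closure (Or.inl ⟨1, 1, by rw [fn_one, map_one, mul_one]⟩)
  simpa using key w 1 h1

theorem pull_slice_constForm (t : ℝ) (w : A.Forms) :
    (A.isSmoothMap_slice t).pull (constForm w) = w := by
  induction w using forms_induction with
  | hfn a => simp only [IsSmoothMap.pull_fn]; rfl
  | hdf a => simp only [IsSmoothMap.pull_df]; rfl
  | hmul v w hv hw => rw [map_mul, map_mul, hv, hw]
  | hadd v w hv hw => rw [map_add, map_add, hv, hw]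

theorem pull_slice_df_time (t : ℝ) : (A.isSmoothMap_slice t).pull (A.cyl.df A.time) = 0 := by
  rw [IsSmoothMap.pull_df]
  exact df_const t

/-- The homotopy formula. -/
theorem homotopy_formula (w : A.cyl.Forms) :
    A.d (A.homotopyOp w) + A.homotopyOp (A.cyl.d w) =
      (A.isSmoothMap_slice 1).pull w - (A.isSmoothMap_slice 0).pull w := by
  have hz : fam (1 : A.cyl.Fn) (0 : A.Forms) = 0 := map_zero (A.famHom 1)
  induction w using cyl_forms_induction with
  | h c w =>
    -- Without a `dt` component the operator gives zero. In the differential only `(∂c/∂t) dt`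
    -- contributes, and the fundamental theorem of calculus produces the difference of the two
    -- slices.
    have h1 : A.homotopyOp (A.cyl.fn c * constForm w) = 0 := by
      rw [homotopyOp_apply, map_mul, split_fn, split_constForm]
      simp [Matrix.mul_apply, Fin.sum_univ_two]
    have h2 : A.homotopyOp (A.cyl.d (A.cyl.fn c * constForm w)) =
        A.fn (A.integral (A.timeDeriv c)) * w := by
      rw [homotopyOp_apply, d_mul, d_fn, ← IsSmoothMap.pull_d, parity_fn, map_add, map_mul, map_mul,
        split_fn, split_constForm, split_constForm, split_df]
      simp [fam_mul, famIntegral_fam]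
    rw [h1, h2, map_zero, zero_add, map_mul, map_mul, pull_slice_constForm, pull_slice_constForm,
      IsSmoothMap.pull_fn, IsSmoothMap.pull_fn, integral_timeDeriv, ← sub_mul]
    exact congrArg (· * w) (map_sub A.fnHom _ _)
  | ht c w =>
    -- With a factor `dt` both slices vanish. The differential of `(∫ c) w` cancels against the
    -- other term, whose signs come from moving differentials past `dt`.
    have h1 : A.homotopyOp (A.cyl.fn c * A.cyl.df A.time * constForm w) =
        A.fn (A.integral c) * w := by
      rw [homotopyOp_apply, map_mul, map_mul, split_fn, split_constForm, split_df, baseDiff_time,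
        timeDeriv_time, fam_one_one]
      simp [fam_mul, famIntegral_fam]
    have h2 : A.homotopyOp (A.cyl.d (A.cyl.fn c * A.cyl.df A.time * constForm w)) =
        -(A.df (A.integral c) * w) - A.fn (A.integral c) * A.d w := by
      rw [homotopyOp_apply, d_mul, d_mul, d_fn, d_df, mul_zero, zero_add, ← IsSmoothMap.pull_d,
        map_mul A.cyl.parity, parity_fn, parity_df, map_add, map_mul, map_mul, map_mul, map_mul,
        map_neg, split_fn, split_constForm, split_constForm, split_df, split_df, baseDiff_time,
        timeDeriv_time, fam_one_one]
      simp [fam_mul, famIntegral_fam,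
        famIntegral_baseDiff_mul]
      abel
    rw [h1, h2]
    simp only [map_mul, pull_slice_df_time, d_mul, d_fn, parity_fn]
    simp only [mul_zero, zero_mul, sub_zero]
    abel
  | hadd v w hv hw =>
    simp only [map_add]
    rw [add_add_add_comm, hv, hw]
    abel

end SmoothAlgebra

namespace SmoothAlgebra

variable {X : Type*} {A : SmoothAlgebra X}

/-! ### Families of forms in a subspace -/

/-- The families `∑ c_s(t) w_s` with all `w_s` in a given subspace. -/
def famSpan (S : Submodule ℝ A.Forms) : Submodule ℝ A.Families :=
  Submodule.span ℝ {v | ∃ c, ∃ w ∈ S, v = fam c w}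

theorem fam_mem_famSpan {S : Submodule ℝ A.Forms} (c : A.cyl.Fn) {w : A.Forms} (hw : w ∈ S) :
    fam c w ∈ famSpan S := Submodule.subset_span ⟨c, w, hw, rfl⟩

theorem famSpan_mono {S T : Submodule ℝ A.Forms} (h : S ≤ T) : famSpan S ≤ famSpan T :=
  Submodule.span_mono fun _ ⟨c, w, hw, hv⟩ => ⟨c, w, h hw, hv⟩

theorem mem_famSpan_top (v : A.Families) : v ∈ famSpan (⊤ : Submodule ℝ A.Forms) := by
  induction v using families_induction with
  | hz => exact zero_mem _
  | h c w => exact fam_mem_famSpan c trivial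
  | hadd v w hv hw => exact add_mem hv hw

theorem famSpan_mul_le (S T : Submodule ℝ A.Forms) :
    famSpan S * famSpan T ≤ famSpan (S * T) := by
  rw [famSpan, famSpan, Submodule.span_mul_span, Submodule.span_le]
  rintro _ ⟨_, ⟨c, w, hw, rfl⟩, _, ⟨c', w', hw', rfl⟩, rfl⟩
  change fam c w * fam c' w' ∈ _
  rw [fam_mul]
  exact fam_mem_famSpan _ (Submodule.mul_mem_mul hw hw')

theorem mul_mem_famSpan {S T R : Submodule ℝ A.Forms} (h : S * T ≤ R) {v w : A.Families}
    (hv : v ∈ famSpan S) (hw : w ∈ famSpan T) : v * w ∈ famSpan R :=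
  famSpan_mono h (famSpan_mul_le S T (Submodule.mul_mem_mul hv hw))

theorem famIntegral_mem {S : Submodule ℝ A.Forms} (hS : ∀ a, ∀ w ∈ S, A.fn a * w ∈ S)
    {v : A.Families} (hv : v ∈ famSpan S) : A.famIntegral v ∈ S := by
  have h : (famSpan S).map A.famIntegral ≤ S := by
    rw [famSpan, Submodule.map_span, Submodule.span_le]
    rintro _ ⟨_, ⟨c, w, hw, rfl⟩, rfl⟩
    rw [famIntegral_fam]
    exact hS _ _ hw
  exact h ⟨v, hv, rfl⟩

/-! ### The homotopy operator and degrees -/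

theorem fn_mul_prod_mem_degree (a : A.Fn) (l : List A.Fn) :
    A.fn a * (l.map A.df).prod ∈ A.degree l.length :=
  Submodule.subset_span ⟨l.length, a, l.get, rfl, by
    rw [monomial]
    congr 2
    conv_lhs => rw [← List.ofFn_get l, List.map_ofFn]
    rfl⟩

theorem degree_mul_le (j k : ℤ) : A.degree j * A.degree k ≤ A.degree (j + k) := by
  conv_lhs => rw [degree, degree]
  rw [Submodule.span_mul_span, Submodule.span_le]
  rintro _ ⟨_, ⟨j, a, b, rfl, rfl⟩, _, ⟨k, a', b', rfl, rfl⟩, rfl⟩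
  change A.monomial a b * A.monomial a' b' ∈ _
  have h : A.monomial a b * A.monomial a' b' =
      A.fn (a * a') * ((List.ofFn b ++ List.ofFn b').map A.df).prod := by
    simp only [monomial, List.map_append, List.prod_append, List.map_ofFn, fn_mul, Function.comp_def]
    rw [mul_assoc, mul_assoc (A.fn a), ← mul_assoc _ (A.fn a'), ← fn_comm]
    simp only [mul_assoc]
  rw [h]
  have := fn_mul_prod_mem_degree (a * a') (List.ofFn b ++ List.ofFn b')
  simpa using this

theorem one_mem_degree : (1 : A.Forms) ∈ A.degree 0 := by
  simpa [fn_one] using fn_mul_prod_mem_degree (A := A) 1 []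

theorem fn_mem_degree (a : A.Fn) : A.fn a ∈ A.degree 0 := by
  simpa using fn_mul_prod_mem_degree (A := A) a []

theorem df_mem_degree (a : A.Fn) : A.df a ∈ A.degree 1 := by
  simpa [fn_one] using fn_mul_prod_mem_degree (A := A) 1 [a]

theorem fn_mul_mem_degree (k : ℤ) (a : A.Fn) {w : A.Forms} (hw : w ∈ A.degree k) :
    A.fn a * w ∈ A.degree k := by
  simpa using degree_mul_le 0 k (Submodule.mul_mem_mul (fn_mem_degree a) hw)

theorem baseDiff_mem_famSpan (c : A.cyl.Fn) : baseDiff c ∈ famSpan (A.degree 1) := by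
  obtain ⟨L, a, γ, hγ, rfl⟩ := exists_eq_cylMk c
  rw [baseDiff_cylMk]
  exact sum_mem fun j _ => fam_mem_famSpan _ (df_mem_degree _)

/-- Contraction with `∂/∂t` lowers the degree by one. The subtraction takes place in the integers:
for the empty list the degree is `-1`, and the corner entry is zero. -/
theorem split_prod_df_mem (l : List A.cyl.Fn) :
    A.split (l.map A.cyl.df).prod 0 1 ∈ famSpan (A.degree (l.length - 1)) ∧
      A.split (l.map A.cyl.df).prod 1 1 ∈ famSpan (A.degree l.length) := by
  induction l with
  | nil =>
    have h : (1 : A.Families) ∈ famSpan (A.degree 0) := by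
      rw [← fam_one_one]; exact fam_mem_famSpan _ one_mem_degree
    simp [h]
  | cons c l ih =>
    rw [List.map_cons, List.prod_cons, map_mul, split_df]
    have h1 : -baseDiff c ∈ famSpan (A.degree 1) := neg_mem (baseDiff_mem_famSpan c)
    have h0 : fam (A.timeDeriv c) 1 ∈ famSpan (A.degree 0) := fam_mem_famSpan _ one_mem_degree
    simp only [Matrix.mul_apply, Fin.sum_univ_two]
    refine ⟨add_mem ?_ ?_, add_mem ?_ ?_⟩
    · exact mul_mem_famSpan ((degree_mul_le _ _).trans_eq (by congr 1; simp)) h1 ih.1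
    · exact mul_mem_famSpan ((degree_mul_le _ _).trans_eq (by congr 1; simp)) h0 ih.2
    · simp
    · exact mul_mem_famSpan ((degree_mul_le _ _).trans_eq (by congr 1; simp [add_comm]))
        (baseDiff_mem_famSpan c) ih.2

theorem homotopyOp_mem_degree {k : ℤ} {w : A.cyl.Forms} (hw : w ∈ A.cyl.degree k) :
    A.homotopyOp w ∈ A.degree (k - 1) := by
  have h : (A.cyl.degree k).map A.homotopyOp ≤ A.degree (k - 1) := by
    rw [degree, Submodule.map_span, Submodule.span_le]
    rintro _ ⟨_, ⟨k, c, b, rfl, rfl⟩, rfl⟩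
    rw [homotopyOp_apply]
    refine famIntegral_mem (fun a w hw => fn_mul_mem_degree _ a hw) ?_
    have hl := (split_prod_df_mem (List.ofFn b)).1
    rw [List.length_ofFn, List.map_ofFn] at hl
    rw [monomial, map_mul, split_fn]
    simp only [Matrix.mul_apply, Fin.sum_univ_two]
    refine add_mem ?_ (by simp)
    exact mul_mem_famSpan ((degree_mul_le 0 _).trans_eq (by simp))
      (fam_mem_famSpan c one_mem_degree) hl
  exact h ⟨w, hw, rfl⟩

/-! ### Products of differentials -/

variable (A) in
/-- The product `db₁ ∧ … ∧ db_k` as an alternating map. -/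
def dfProd (k : ℕ) : A.Fn [⋀^Fin k]→ₗ[ℝ] A.Forms :=
  (ExteriorAlgebra.lift ℝ ⟨A.dfHom, df_mul_self⟩).toLinearMap.compAlternatingMap
    (ExteriorAlgebra.ιMulti ℝ k)

theorem dfProd_apply {k : ℕ} (b : Fin k → A.Fn) :
    A.dfProd k b = (List.ofFn fun i => A.df (b i)).prod := by
  simp only [dfProd, LinearMap.compAlternatingMap_apply, ExteriorAlgebra.ιMulti_apply,
    AlgHom.toLinearMap_apply, map_list_prod, List.map_ofFn]
  congr 2
  funext i
  exact ExteriorAlgebra.lift_ι_apply ℝ _ _ _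

theorem prod_ofFn_fam {k : ℕ} (c : Fin k → A.cyl.Fn) (w : Fin k → A.Forms) :
    (List.ofFn fun i => fam (c i) (w i)).prod = fam (∏ i, c i) (List.ofFn w).prod := by
  induction k with
  | zero => simp [fam_one_one]
  | succ k ih =>
    rw [List.ofFn_succ, List.prod_cons, ih (fun i => c i.succ) fun i => w i.succ, fam_mul,
      Fin.prod_univ_succ, List.ofFn_succ, List.prod_cons]

theorem prod_ofFn_sum_fam {k N : ℕ} (h : Fin k → Fin N → A.cyl.Fn) (y : Fin N → A.Fn) :
    (List.ofFn fun i => ∑ j, fam (h i j) (A.df (y j))).prod =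
      ∑ J : Fin k → Fin N, fam (∏ i, h i (J i)) (A.dfProd k fun i => y (J i)) := by
  have := MultilinearMap.map_sum (MultilinearMap.mkPiAlgebraFin ℝ k A.Families)
    (fun i (j : Fin N) => fam (h i j) (A.df (y j)))
  simp only [MultilinearMap.mkPiAlgebraFin_apply] at this
  rw [this]
  refine Finset.sum_congr rfl fun J _ => ?_
  rw [prod_ofFn_fam, dfProd_apply]

/-- For each permutation `σ`, substituting `J ∘ σ` and using antisymmetry of the product rewrites
the sum with coefficients `sign σ • H (J ∘ σ)`. Adding over all `σ` gives `k!` times the sum on one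
side and zero on the other. -/
theorem sum_fam_dfProd_eq_zero {k N : ℕ} (H : (Fin k → Fin N) → A.cyl.Fn) (y : Fin N → A.Fn)
    (hH : ∀ J : Fin k → Fin N, ∑ σ : Equiv.Perm (Fin k), Equiv.Perm.sign σ • H (fun i => J (σ i)) = 0) :
    ∑ J, fam (H J) (A.dfProd k fun i => y (J i)) = 0 := by
  set S := ∑ J, fam (H J) (A.dfProd k fun i => y (J i)) with hS
  have h1 : ∀ σ : Equiv.Perm (Fin k), S = ∑ J : Fin k → Fin N,
      fam (Equiv.Perm.sign σ • H fun i => J (σ i)) (A.dfProd k fun i => y (J i)) := by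
    intro σ
    rw [hS, ← Equiv.sum_comp (Equiv.arrowCongr σ.symm (Equiv.refl (Fin N)))]
    refine Finset.sum_congr rfl fun J _ => ?_
    have h2 : (Equiv.arrowCongr σ.symm (Equiv.refl (Fin N))) J = fun i => J (σ i) := by
      funext i; simp [Equiv.arrowCongr]
    have h3 : A.dfProd k (fun i => y (J (σ i))) =
        Equiv.Perm.sign σ • A.dfProd k fun i => y (J i) :=
      AlternatingMap.map_perm (A.dfProd k) (fun i => y (J i)) σ
    simp only [h2, h3, ← famHom_apply, Units.smul_def, map_zsmul, LinearMap.smul_apply]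
  have h4 : (Fintype.card (Equiv.Perm (Fin k)) : ℝ) • S = 0 := by
    have : ∑ σ : Equiv.Perm (Fin k), S = 0 := by
      rw [Finset.sum_congr rfl fun σ _ => h1 σ, Finset.sum_comm]
      refine Finset.sum_eq_zero fun J _ => ?_
      simp only [← famHom_apply]
      rw [← LinearMap.sum_apply, ← map_sum, hH, map_zero, LinearMap.zero_apply]
    rwa [Finset.sum_const, Finset.card_univ, ← Nat.cast_smul_eq_nsmul ℝ] at this
  exact (smul_eq_zero.mp h4).resolve_left (by exact_mod_cast Fintype.card_ne_zero)

theorem split_prod_df {k : ℕ} (b : Fin k → A.cyl.Fn) :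
    A.split (List.ofFn fun i => A.cyl.df (b i)).prod 1 1 = (List.ofFn fun i => baseDiff (b i)).prod ∧
    A.split (List.ofFn fun i => A.cyl.df (b i)).prod 0 0 =
      (-1 : ℝ) ^ k • (List.ofFn fun i => baseDiff (b i)).prod := by
  induction k with
  | zero => simp
  | succ k ih =>
    rw [List.ofFn_succ, List.prod_cons, map_mul, split_df, List.ofFn_succ, List.prod_cons]
    simp only [Matrix.mul_apply, Fin.sum_univ_two, split_one_zero, (ih fun i => b i.succ).1,
      (ih fun i => b i.succ).2, pow_succ]
    constructor
    · simp
    · simp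

end SmoothAlgebra

namespace CartanSpace

open SmoothAlgebra

variable {X Y : Type*} {𝒳 : CartanSpace X} {𝒴 : CartanSpace Y}

/-! ### The filtration by the powers of the Cartan ideal -/

variable (𝒳) in
/-- `𝒞^nΛ^*` for a natural number `n`. -/
def filt (n : ℕ) : Submodule ℝ 𝒳.fns.Forms := 𝒳.cartanIdeal ^ n * ⊤

theorem top_mul_top' : (⊤ : Submodule ℝ 𝒳.fns.Forms) * ⊤ = ⊤ :=
  le_antisymm le_top fun w _ => by
    simpa using Submodule.mul_mem_mul (M := (⊤ : Submodule ℝ 𝒳.fns.Forms)) (N := ⊤)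
      (m := w) (n := 1) trivial trivial

theorem top_mul_cartanIdeal : ⊤ * 𝒳.cartanIdeal = 𝒳.cartanIdeal := by
  rw [cartanIdeal, ← mul_assoc, ← mul_assoc, top_mul_top']

theorem cartanIdeal_mul_top : 𝒳.cartanIdeal * ⊤ = 𝒳.cartanIdeal := by
  rw [cartanIdeal, mul_assoc, top_mul_top']

theorem filt_zero : 𝒳.filt 0 = ⊤ := by rw [filt, pow_zero, one_mul]

theorem filt_one : 𝒳.filt 1 = 𝒳.cartanIdeal := by rw [filt, pow_one, cartanIdeal_mul_top]

theorem top_mul_filt (n : ℕ) : ⊤ * 𝒳.filt n = 𝒳.filt n := by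
  cases n with
  | zero => rw [filt_zero, top_mul_top']
  | succ n => rw [filt, pow_succ', ← mul_assoc, ← mul_assoc, top_mul_cartanIdeal]

theorem filt_mul_filt (m n : ℕ) : 𝒳.filt m * 𝒳.filt n = 𝒳.filt (m + n) := by
  conv_lhs => rw [filt, mul_assoc, top_mul_filt]
  rw [filt, filt, pow_add, mul_assoc]

theorem filt_succ_le (n : ℕ) : 𝒳.filt (n + 1) ≤ 𝒳.filt n := by
  rw [← filt_mul_filt, filt, mul_assoc, filt]
  exact mul_le_mul' le_rfl le_top

theorem filt_antitone : Antitone 𝒳.filt := antitone_nat_of_succ_le filt_succ_le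

theorem filtration_eq (p : ℤ) : 𝒳.filtration p = 𝒳.filt p.toNat := rfl

theorem fn_mul_mem_filt (n : ℕ) (a : 𝒳.fns.Fn) {w : 𝒳.fns.Forms} (hw : w ∈ 𝒳.filt n) :
    𝒳.fns.fn a * w ∈ 𝒳.filt n := by
  rw [← top_mul_filt]
  exact Submodule.mul_mem_mul trivial hw

variable (𝒳) in
/-- The pairs of families `v + dt w` with `v` in the `n`-th and `w` in the `(n-1)`-st term of the
filtration. -/
def splitFilt (n : ℕ) : Submodule ℝ (Matrix (Fin 2) (Fin 2) 𝒳.fns.Families) where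
  carrier := {M | M 0 0 ∈ famSpan (𝒳.filt n) ∧ M 1 1 ∈ famSpan (𝒳.filt n) ∧
    M 0 1 ∈ famSpan (𝒳.filt (n - 1)) ∧ M 1 0 = 0}
  zero_mem' := ⟨zero_mem _, zero_mem _, zero_mem _, rfl⟩
  add_mem' h h' := ⟨add_mem h.1 h'.1, add_mem h.2.1 h'.2.1, add_mem h.2.2.1 h'.2.2.1, by
    rw [Matrix.add_apply, h.2.2.2, h'.2.2.2, add_zero]⟩
  smul_mem' r _ h := ⟨Submodule.smul_mem _ r h.1, Submodule.smul_mem _ r h.2.1,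
    Submodule.smul_mem _ r h.2.2.1, by rw [Matrix.smul_apply, h.2.2.2, smul_zero]⟩

/-- The `dt` part of a product is a sum of two terms, each with only one contracted factor.
Truncated subtraction does no harm: `m + (n - 1)` and `(m - 1) + n` are both at least `m + n - 1`.
-/
theorem splitFilt_mul_le (m n : ℕ) : 𝒳.splitFilt m * 𝒳.splitFilt n ≤ 𝒳.splitFilt (m + n) := by
  rw [Submodule.mul_le]
  rintro M ⟨h00, h11, h01, h10⟩ N ⟨k00, k11, k01, k10⟩
  simp only [splitFilt, Submodule.mem_mk, AddSubmonoid.mem_mk, AddSubsemigroup.mem_mk,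
    Set.mem_ofPred_eq, Matrix.mul_apply, Fin.sum_univ_two, h10, k10, mul_zero, zero_mul, add_zero,
    zero_add, and_true]
  refine ⟨mul_mem_famSpan (filt_mul_filt m n).le h00 k00,
    mul_mem_famSpan (filt_mul_filt m n).le h11 k11, add_mem ?_ ?_⟩
  · exact mul_mem_famSpan ((filt_mul_filt m (n - 1)).le.trans (filt_antitone (by omega))) h00 k01
  · exact mul_mem_famSpan ((filt_mul_filt (m - 1) n).le.trans (filt_antitone (by omega))) h01 k11

theorem split_mem_splitFilt_zero (w : 𝒳.fns.cyl.Forms) : 𝒳.fns.split w ∈ 𝒳.splitFilt 0 := by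
  have h : ∀ v, v ∈ famSpan (𝒳.filt 0) := fun v => by rw [filt_zero]; exact mem_famSpan_top v
  exact ⟨h _, h _, h _, split_one_zero w⟩

/-- A finite family of vector fields `D_j` in the distribution and of functions `y_j` such that every
vector `v` of the distribution is `∑ v(y_j) D_j`. -/
structure Frame (𝒳 : CartanSpace X) (N : ℕ) where
  y : Fin N → 𝒳.fns.Fn
  D : Fin N → 𝒳.fns.Fn → 𝒳.fns.Fn
  mem_plane : ∀ j ρ, ∃ v ∈ 𝒳.plane ρ, ∀ a, v a = (D j a : X → ℝ) ρ
  eq_sum : ∀ ρ, ∀ v ∈ 𝒳.plane ρ, ∀ a, v a = ∑ j, (D j a : X → ℝ) ρ * v (y j)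

variable (𝒳) in
/-- The vectors of the distribution are derivations of smooth functions. -/
def IsDerivative : Prop :=
  ∀ ρ, ∀ v ∈ 𝒳.plane ρ, ∀ {L : ℕ} (β : (Fin L → ℝ) → ℝ) (hβ : ContDiff ℝ ∞ β) (b : Fin L → 𝒳.fns.Fn),
    v (𝒳.fns.comp β hβ b) = ∑ i, partialDeriv β i (fun i => (b i : X → ℝ) ρ) * v (b i)

namespace Frame

variable {N : ℕ}

/-- For fixed `t` the slice is a smooth composite of the `a i`, to which the derivation property
applies. The right side is visibly a function on the cylinder, so `D_j` applied slice by slice stays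
among the admissible functions. -/
theorem D_slice_cylMk (Φ : Frame 𝒳 N) (hd : 𝒳.IsDerivative) (j : Fin N) {L : ℕ} (a : Fin L → 𝒳.fns.Fn)
    {γ : (Fin (L + 1) → ℝ) → ℝ} (hγ : ContDiff ℝ ∞ γ) (ρ : X) (t : ℝ) :
    (Φ.D j ((𝒳.fns.isSmoothMap_slice t).pullFn (cylMk a hγ)) : X → ℝ) ρ =
      ((∑ i, cylMk a (partialDeriv_contDiff hγ i.succ) * const (Φ.D j (a i)) : 𝒳.fns.cyl.Fn) :
        X × ℝ → ℝ) (ρ, t) := by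
  obtain ⟨v, hv, h⟩ := Φ.mem_plane j ρ
  have hγt : ContDiff ℝ ∞ fun z => γ (Fin.cons t z) :=
    hγ.comp (contDiff_finCons.comp (contDiff_prodMk_right t))
  have hs : (𝒳.fns.isSmoothMap_slice t).pullFn (cylMk a hγ) = 𝒳.fns.comp _ hγt a := rfl
  rw [← h, hs, hd ρ v hv, coe_sum_apply]
  refine Finset.sum_congr rfl fun i _ => ?_
  rw [partialDeriv_cons hγ, h]
  rfl

/-- The vector field `D_j` acting on functions on the cylinder. -/
def cylD (Φ : Frame 𝒳 N) (hd : 𝒳.IsDerivative) (j : Fin N) (c : 𝒳.fns.cyl.Fn) : 𝒳.fns.cyl.Fn :=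
  ⟨fun x => (Φ.D j ((𝒳.fns.isSmoothMap_slice x.2).pullFn c) : X → ℝ) x.1, by
    obtain ⟨L, a, γ, hγ, rfl⟩ := exists_eq_cylMk c
    have : (fun x : X × ℝ => (Φ.D j ((𝒳.fns.isSmoothMap_slice x.2).pullFn (cylMk a hγ)) : X → ℝ) x.1)
        = ((∑ i, cylMk a (partialDeriv_contDiff hγ i.succ) * const (Φ.D j (a i)) : 𝒳.fns.cyl.Fn) :
        X × ℝ → ℝ) := funext fun x => Φ.D_slice_cylMk hd j a hγ x.1 x.2
    rw [this]
    exact Subtype.property _⟩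

theorem cylD_cylMk (Φ : Frame 𝒳 N) (hd : 𝒳.IsDerivative) (j : Fin N) {L : ℕ} (a : Fin L → 𝒳.fns.Fn)
    {γ : (Fin (L + 1) → ℝ) → ℝ} (hγ : ContDiff ℝ ∞ γ) :
    Φ.cylD hd j (cylMk a hγ) =
      ∑ i, cylMk a (partialDeriv_contDiff hγ i.succ) * const (Φ.D j (a i)) :=
  Subtype.ext (funext fun x => Φ.D_slice_cylMk hd j a hγ x.1 x.2)

/-- By the frame property `eq_sum` this 1-form vanishes on every plane, hence is itself a Cartan
form. -/
theorem df_sub_mem (Φ : Frame 𝒳 N) (a : 𝒳.fns.Fn) :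
    𝒳.fns.df a - ∑ j, 𝒳.fns.fn (Φ.D j a) * 𝒳.fns.df (Φ.y j) ∈ 𝒳.filt 1 := by
  rw [filt_one, cartanIdeal]
  have h : 𝒳.fns.df a - ∑ j, 𝒳.fns.fn (Φ.D j a) * 𝒳.fns.df (Φ.y j) ∈ 𝒳.cartanForms := by
    refine ⟨1, N + 1, Fin.cons 1 fun j => -Φ.D j a, Fin.cons (fun _ => a) fun j _ => Φ.y j, ?_, ?_⟩
    · rw [Fin.sum_univ_succ]
      have hn : ∀ b, 𝒳.fns.fn (-b) = -𝒳.fns.fn b := fun b => map_neg 𝒳.fns.fnHom b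
      simp [monomial, fn_one, hn, sub_eq_add_neg]
    · intro ρ v hv
      rw [Fin.sum_univ_succ]
      simp only [Fin.cons_zero, Fin.cons_succ, Matrix.det_unique, Matrix.of_apply]
      rw [Φ.eq_sum ρ (v default) (hv default) a]
      simp
  have := Submodule.mul_mem_mul (Submodule.mul_mem_mul
    (Submodule.mem_top (x := (1 : 𝒳.fns.Forms)) (R := ℝ)) (Submodule.subset_span (R := ℝ) h))
    (Submodule.mem_top (x := (1 : 𝒳.fns.Forms)) (R := ℝ))
  simpa using this

/-- In a presentation `γ(t, a)` the statement reduces to `df_sub_mem` for each `a i`; `fam_fn_mul`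
moves the coefficients `D_j(a i)` into the function factor. -/
theorem baseDiff_sub_mem (Φ : Frame 𝒳 N) (hd : 𝒳.IsDerivative) (c : 𝒳.fns.cyl.Fn) :
    baseDiff c - ∑ j, fam (Φ.cylD hd j c) (𝒳.fns.df (Φ.y j)) ∈ famSpan (𝒳.filt 1) := by
  obtain ⟨L, a, γ, hγ, rfl⟩ := exists_eq_cylMk c
  have h : ∑ j, fam (Φ.cylD hd j (cylMk a hγ)) (𝒳.fns.df (Φ.y j)) =
      ∑ i, fam (cylMk a (partialDeriv_contDiff hγ i.succ))
        (∑ j, 𝒳.fns.fn (Φ.D j (a i)) * 𝒳.fns.df (Φ.y j)) := by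
    simp only [cylD_cylMk, ← famHom_apply, map_sum, LinearMap.sum_apply]
    rw [Finset.sum_comm]
    simp only [famHom_apply, fam_fn_mul]
  rw [h, baseDiff_cylMk, ← Finset.sum_sub_distrib]
  refine sum_mem fun i _ => ?_
  simp only [← famHom_apply]
  rw [← map_sub]
  exact fam_mem_famSpan _ (Φ.df_sub_mem (a i))

theorem mul_mem_famSpan_filt_left {v w : 𝒳.fns.Families} {n : ℕ} (hv : v ∈ famSpan (𝒳.filt n)) :
    w * v ∈ famSpan (𝒳.filt n) :=
  mul_mem_famSpan (top_mul_filt n).le (mem_famSpan_top w) hv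

theorem mul_mem_famSpan_filt_right {v w : 𝒳.fns.Families} {n : ℕ} (hv : v ∈ famSpan (𝒳.filt n)) :
    v * w ∈ famSpan (𝒳.filt n) := by
  refine mul_mem_famSpan ?_ hv (mem_famSpan_top w)
  rw [← filt_zero, filt_mul_filt, add_zero]

theorem prod_sub_prod_mem {k n : ℕ} (f g : Fin k → 𝒳.fns.Families)
    (h : ∀ i, f i - g i ∈ famSpan (𝒳.filt n)) :
    (List.ofFn f).prod - (List.ofFn g).prod ∈ famSpan (𝒳.filt n) := by
  induction k with
  | zero => simp
  | succ k ih =>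
    rw [List.ofFn_succ, List.ofFn_succ, List.prod_cons, List.prod_cons]
    have e : f 0 * (List.ofFn fun i => f i.succ).prod - g 0 * (List.ofFn fun i => g i.succ).prod =
        f 0 * ((List.ofFn fun i => f i.succ).prod - (List.ofFn fun i => g i.succ).prod) +
        (f 0 - g 0) * (List.ofFn fun i => g i.succ).prod := by
      rw [mul_sub, sub_mul]; abel
    rw [e]
    exact add_mem (mul_mem_famSpan_filt_left (ih _ _ fun i => h i.succ))
      (mul_mem_famSpan_filt_right (h 0))

/-- A family of forms that vanish on the distribution for all `t` is a family of Cartan forms. -/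
theorem sum_mem_famSpan (Φ : Frame 𝒳 N) (hd : 𝒳.IsDerivative) {k N' : ℕ} (c : Fin N' → 𝒳.fns.cyl.Fn)
    (b : Fin N' → Fin k → 𝒳.fns.cyl.Fn)
    (h : ∀ (ρ : X) (t : ℝ) (v : Fin k → (𝒳.fns.Fn →ₗ[ℝ] ℝ)), (∀ i, v i ∈ 𝒳.plane ρ) →
      ∑ s, (c s : X × ℝ → ℝ) (ρ, t) *
        (Matrix.of fun i j => v i ((𝒳.fns.isSmoothMap_slice t).pullFn (b s j))).det = 0) :
    ∑ s, fam (c s) 1 * (List.ofFn fun i => baseDiff (b s i)).prod ∈ famSpan (𝒳.filt 1) := by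
  set g : Fin N' → Fin k → 𝒳.fns.Families := fun s i =>
    ∑ j, fam (Φ.cylD hd j (b s i)) (𝒳.fns.df (Φ.y j)) with hg
  -- Modulo Cartan families each differential is replaced by its expansion in the `dy_j`. The
  -- replaced sum turns out to be exactly zero.
  have h1 : ∑ s, fam (c s) 1 * (List.ofFn fun i => baseDiff (b s i)).prod -
      ∑ s, fam (c s) 1 * (List.ofFn fun i => g s i).prod ∈ famSpan (𝒳.filt 1) := by
    rw [← Finset.sum_sub_distrib]
    refine sum_mem fun s _ => ?_
    rw [← mul_sub]
    exact mul_mem_famSpan_filt_left (prod_sub_prod_mem _ _ fun i => Φ.baseDiff_sub_mem hd _)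
  suffices h2 : ∑ s, fam (c s) 1 * (List.ofFn fun i => g s i).prod = 0 by
    rwa [h2, sub_zero] at h1
  simp only [hg, prod_ofFn_sum_fam, Finset.mul_sum, fam_mul, one_mul]
  rw [Finset.sum_comm]
  simp only [← famHom_apply]
  simp only [← LinearMap.sum_apply, ← map_sum]
  simp only [famHom_apply]
  -- The antisymmetrized coefficient of `dy_J` at `(ρ, t)` is the value of the form on the vectors
  -- `D_{J 1}, …, D_{J k}` of the plane at `ρ`, which vanishes by hypothesis.
  refine sum_fam_dfProd_eq_zero
    (fun J => ∑ s, c s * ∏ i, Φ.cylD hd (J i) (b s i)) Φ.y fun J => ?_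
  apply Subtype.ext
  funext ⟨ρ, t⟩
  choose v hv hD using fun i => Φ.mem_plane (J i) ρ
  rw [coe_sum_apply]
  refine Eq.trans ?_ (h ρ t v hv)
  simp only [Matrix.det_apply, Finset.mul_sum]
  rw [Finset.sum_comm]
  refine Finset.sum_congr rfl fun σ _ => ?_
  have e : ((Equiv.Perm.sign σ • ∑ s, c s * ∏ i, Φ.cylD hd (J (σ i)) (b s i) : 𝒳.fns.cyl.Fn) :
      X × ℝ → ℝ) (ρ, t) = Equiv.Perm.sign σ • ((∑ s, c s * ∏ i, Φ.cylD hd (J (σ i)) (b s i) :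
      𝒳.fns.cyl.Fn) : X × ℝ → ℝ) (ρ, t) := by
    simp [Units.smul_def]
  rw [e, coe_sum_apply, Finset.smul_sum]
  refine Finset.sum_congr rfl fun s _ => ?_
  have e2 : ((c s * ∏ i, Φ.cylD hd (J (σ i)) (b s i) : 𝒳.fns.cyl.Fn) : X × ℝ → ℝ) (ρ, t) =
      (c s : X × ℝ → ℝ) (ρ, t) * ∏ i, (Φ.cylD hd (J (σ i)) (b s i) : X × ℝ → ℝ) (ρ, t) := by
    simp
  rw [e2, ← mul_smul_comm]
  congr 2
  exact Finset.prod_congr rfl fun i _ => (hD (σ i) _).symm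

end Frame

/-! ### Homotopic morphisms -/

section Homotopy

variable {N : ℕ} {F : X × ℝ → Y}

/-- The diagonal entries represent, up to sign, the family of pullbacks along the slices of `F`.
Each slice is a morphism, so this family vanishes on the planes for every `t`, and the frame makes
it a family of Cartan forms. -/
theorem split_pull_cartanForms (hF : IsSmoothMap 𝒳.fns.cyl 𝒴.fns F) (Φ : Frame 𝒳 N) (hd : 𝒳.IsDerivative)
    (hm : ∀ t, IsDEMorphism 𝒳 𝒴 fun ρ => F (ρ, t)) {w : 𝒴.fns.Forms} (hw : w ∈ 𝒴.cartanForms) :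
    𝒳.fns.split (hF.pull w) ∈ 𝒳.splitFilt 1 := by
  obtain ⟨k, N', a, b, rfl, h⟩ := hw
  have key := Φ.sum_mem_famSpan hd (fun s => hF.pullFn (a s)) (fun s i => hF.pullFn (b s i))
    fun ρ t v hv => h (F (ρ, t)) (fun i => v i ∘ₗ (hm t).smooth.pullFn.toLinearMap)
      fun i => (hm t).map_plane ρ (v i) (hv i)
  have e : 𝒳.fns.split (hF.pull (∑ s, 𝒴.fns.monomial (a s) (b s))) =
      ∑ s, 𝒳.fns.split (𝒳.fns.cyl.fn (hF.pullFn (a s))) *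
        𝒳.fns.split (List.ofFn fun i => 𝒳.fns.cyl.df (hF.pullFn (b s i))).prod := by
    rw [map_sum, map_sum]
    refine Finset.sum_congr rfl fun s _ => ?_
    rw [hF.pull_monomial, monomial, map_mul]
  refine ⟨?_, ?_, ?_, split_one_zero _⟩
  · rw [e, Matrix.sum_apply]
    simp only [Matrix.mul_apply, Fin.sum_univ_two, split_fn, split_prod_df]
    have := Submodule.smul_mem _ ((-1 : ℝ) ^ k) key
    rw [Finset.smul_sum] at this
    simpa using this
  · rw [e, Matrix.sum_apply]
    simp only [Matrix.mul_apply, Fin.sum_univ_two, split_fn, split_prod_df]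
    simpa using key
  · have h0 : 𝒳.filt (1 - 1) = ⊤ := filt_zero
    rw [h0]
    exact mem_famSpan_top _

/-- Pullback followed by `split` is an algebra homomorphism and `splitFilt` is multiplicative, so it
is enough to treat the generators of the Cartan ideal. -/
theorem split_pull_mem_splitFilt (hF : IsSmoothMap 𝒳.fns.cyl 𝒴.fns F) (Φ : Frame 𝒳 N)
    (hd : 𝒳.IsDerivative) (hm : ∀ t, IsDEMorphism 𝒳 𝒴 fun ρ => F (ρ, t)) (n : ℕ)
    {w : 𝒴.fns.Forms} (hw : w ∈ 𝒴.filt n) : 𝒳.fns.split (hF.pull w) ∈ 𝒳.splitFilt n := by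
  set g : 𝒴.fns.Forms →ₐ[ℝ] Matrix (Fin 2) (Fin 2) 𝒳.fns.Families := 𝒳.fns.split.comp hF.pull
  have htop : ∀ S : Submodule ℝ 𝒴.fns.Forms, S.map g.toLinearMap ≤ 𝒳.splitFilt 0 := by
    rintro S _ ⟨w, _, rfl⟩
    exact split_mem_splitFilt_zero _
  have hI : 𝒴.cartanIdeal.map g.toLinearMap ≤ 𝒳.splitFilt 1 := by
    have h1 : (Submodule.span ℝ 𝒴.cartanForms).map g.toLinearMap ≤ 𝒳.splitFilt 1 := by
      rw [Submodule.map_span, Submodule.span_le]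
      rintro _ ⟨w, hw, rfl⟩
      exact split_pull_cartanForms hF Φ hd hm hw
    rw [cartanIdeal, Submodule.map_mul, Submodule.map_mul]
    calc _ ≤ 𝒳.splitFilt 0 * 𝒳.splitFilt 1 * 𝒳.splitFilt 0 :=
          mul_le_mul' (mul_le_mul' (htop _) h1) (htop _)
      _ ≤ 𝒳.splitFilt (0 + 1) * 𝒳.splitFilt 0 := mul_le_mul' (splitFilt_mul_le 0 1) le_rfl
      _ ≤ _ := splitFilt_mul_le 1 0
  have hpow : (𝒴.filt n).map g.toLinearMap ≤ 𝒳.splitFilt n := by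
    have h2 : ∀ k, (𝒴.cartanIdeal ^ (k + 1)).map g.toLinearMap ≤ 𝒳.splitFilt (k + 1) := by
      intro k
      induction k with
      | zero => rwa [zero_add, pow_one]
      | succ k ih =>
        rw [pow_succ, Submodule.map_mul]
        exact (mul_le_mul' ih hI).trans (splitFilt_mul_le _ _)
    cases n with
    | zero => exact htop _
    | succ n =>
      rw [filt, Submodule.map_mul]
      exact (mul_le_mul' (h2 n) (htop _)).trans (splitFilt_mul_le _ _)
  exact hpow ⟨w, hw, rfl⟩

/-- Integration over `t` keeps a family inside a subspace stable under functions. The identity `(p -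
1).toNat = p.toNat - 1` also covers `p ≤ 0`, where both sides are zero. -/
theorem homotopyOp_pull_mem_filtration (hF : IsSmoothMap 𝒳.fns.cyl 𝒴.fns F) (Φ : Frame 𝒳 N)
    (hd : 𝒳.IsDerivative) (hm : ∀ t, IsDEMorphism 𝒳 𝒴 fun ρ => F (ρ, t)) (p : ℤ)
    {w : 𝒴.fns.Forms} (hw : w ∈ 𝒴.filtration p) :
    𝒳.fns.homotopyOp (hF.pull w) ∈ 𝒳.filtration (p - 1) := by
  have h := (split_pull_mem_splitFilt hF Φ hd hm p.toNat hw).2.2.1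
  have e : (p - 1).toNat = p.toNat - 1 := by omega
  rw [filtration_eq, e, homotopyOp_apply]
  exact famIntegral_mem (fun a w hw => fn_mul_mem_filt _ a hw) h

theorem homotopyOp_pull_mem_filtDegree (hF : IsSmoothMap 𝒳.fns.cyl 𝒴.fns F) (Φ : Frame 𝒳 N)
    (hd : 𝒳.IsDerivative) (hm : ∀ t, IsDEMorphism 𝒳 𝒴 fun ρ => F (ρ, t)) {p k p' k' : ℤ}
    (hp : p' = p - 1) (hk : k' = k - 1) {w : 𝒴.fns.Forms} (hw : w ∈ 𝒴.filtDegree p k) :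
    𝒳.fns.homotopyOp (hF.pull w) ∈ 𝒳.filtDegree p' k' := by
  subst hp hk
  exact ⟨homotopyOp_pull_mem_filtration hF Φ hd hm p hw.1,
    homotopyOp_mem_degree (hF.pull_degree hw.2)⟩

theorem pull_slice_pull (hF : IsSmoothMap 𝒳.fns.cyl 𝒴.fns F) (t : ℝ)
    (hm : IsDEMorphism 𝒳 𝒴 fun ρ => F (ρ, t)) (w : 𝒴.fns.Forms) :
    (𝒳.fns.isSmoothMap_slice t).pull (hF.pull w) = hm.pull w := by
  rw [IsDEMorphism.pull]
  induction w using forms_induction with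
  | hfn a => simp only [IsSmoothMap.pull_fn]; rfl
  | hdf a => simp only [IsSmoothMap.pull_df]; rfl
  | hmul v w hv hw => simp only [map_mul, hv, hw]
  | hadd v w hv hw => simp only [map_add, hv, hw]

theorem filtDegree_mono {p p' k : ℤ} (h : p' ≤ p) : 𝒳.filtDegree p k ≤ 𝒳.filtDegree p' k :=
  inf_le_inf_right _ (filt_antitone (Int.toNat_le_toNat h))

/-- Morphisms related by a homotopy induce the same maps of the second terms of the spectral
sequences. -/
theorem pageMap_two_eq_of_homotopy (hF : IsSmoothMap 𝒳.fns.cyl 𝒴.fns F) (Φ : Frame 𝒳 N)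
    (hd : 𝒳.IsDerivative) (hm : ∀ t, IsDEMorphism 𝒳 𝒴 fun ρ => F (ρ, t)) (p q : ℤ) :
    (hm 0).pageMap 2 p q = (hm 1).pageMap 2 p q := by
  refine LinearMap.ext fun x => ?_
  obtain ⟨⟨w, hw⟩, rfl⟩ := Submodule.Quotient.mk_surjective _ x
  refine ((Submodule.Quotient.eq _).mpr ?_).symm
  change (hm 1).pull w - (hm 0).pull w ∈ 𝒳.boundaries 2 p q
  have hdw : 𝒴.fns.d w ∈ 𝒴.filtDegree (p + 2) (p + q + 1) := hw.2
  have hform : ∀ w, 𝒳.fns.d (𝒳.fns.homotopyOp (hF.pull w)) + 𝒳.fns.homotopyOp (hF.pull (𝒴.fns.d w)) =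
      (hm 1).pull w - (hm 0).pull w := fun w => by
    rw [hF.pull_d, homotopy_formula, pull_slice_pull hF 1 (hm 1), pull_slice_pull hF 0 (hm 0)]
  -- The homotopy formula applied to `dw`, together with `d² = 0`. The filtrations of both
  -- differentials are read off this formula, so it is not needed that `d` preserves powers of the
  -- Cartan ideal.
  have hd0 : 𝒳.fns.d (𝒳.fns.homotopyOp (hF.pull (𝒴.fns.d w))) =
      (hm 1).pull (𝒴.fns.d w) - (hm 0).pull (𝒴.fns.d w) := by
    rw [← hform, d_d, map_zero, map_zero, add_zero]
  have h1 : 𝒳.fns.homotopyOp (hF.pull w) ∈ 𝒳.filtDegree (p - 1) (p + q - 1) :=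
    homotopyOp_pull_mem_filtDegree hF Φ hd hm rfl rfl hw.1
  have h2 : 𝒳.fns.homotopyOp (hF.pull (𝒴.fns.d w)) ∈ 𝒳.filtDegree (p + 1) (p + q) :=
    homotopyOp_pull_mem_filtDegree hF Φ hd hm (by ring) (by ring) hdw
  have h3 : 𝒳.fns.d (𝒳.fns.homotopyOp (hF.pull w)) ∈ 𝒳.filtDegree p (p + q) := by
    rw [eq_sub_of_add_eq (hform w)]
    exact sub_mem (sub_mem ((hm 1).pull_filtDegree hw.1) ((hm 0).pull_filtDegree hw.1))
      (filtDegree_mono (by omega) h2)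
  have h4 : 𝒳.fns.d (𝒳.fns.homotopyOp (hF.pull (𝒴.fns.d w))) ∈ 𝒳.filtDegree (p + 2) (p + q + 1) := by
    rw [hd0]
    exact sub_mem ((hm 1).pull_filtDegree hdw) ((hm 0).pull_filtDegree hdw)
  -- With `K` the operator `homotopyOp ∘ F^*`, the form `K(dw)` goes to `Z_1^{p+1,q-1}` and `Kw` to
  -- `Z_1^{p-1,q}`.
  rw [← hform w, add_comm, boundaries]
  refine Submodule.add_mem_sup ⟨?_, ?_⟩ (Submodule.mem_map_of_mem ⟨?_, ?_⟩)
  · rwa [show p + 1 + (q - 1) = p + q by ring]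
  · change _ ∈ 𝒳.filtDegree _ _
    rwa [show p + 1 + (2 - 1) = p + 2 by ring, show p + 1 + (q - 1) + 1 = p + q + 1 by ring]
  · rwa [show p - 2 + 1 = p - 1 by ring, show p - 1 + (q + 2 - 2) = p + q - 1 by ring]
  · change _ ∈ 𝒳.filtDegree _ _
    rwa [show p - 2 + 1 + (2 - 1) = p by ring, show p - 2 + 1 + (q + 2 - 2) + 1 = p + q by ring]

end Homotopy

end CartanSpace

/-! ### Coverings of bounded multiplicity -/

section Painting

open Set Topology

variable {X : Type*} [TopologicalSpace X]

/-- For every choice of open neighbourhoods of points, the set is covered by finitely many coloured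
open sets, each with a compact closure inside one of the neighbourhoods, such that sets of the same
colour have disjoint closures. -/
def Paintable (κ : Type) (K : Set X) : Prop :=
  ∀ U : X → Set X, (∀ x, IsOpen (U x)) → (∀ x, x ∈ U x) → ∃ (ι : Type) (_ : Finite ι)
    (W : κ → ι → Set X) (p : κ → ι → X), (∀ c i, IsOpen (W c i)) ∧
    (∀ c i, closure (W c i) ⊆ U (p c i)) ∧ (∀ c i, IsCompact (closure (W c i))) ∧
    (∀ c i j, i ≠ j → Disjoint (closure (W c i)) (closure (W c j))) ∧ K ⊆ ⋃ c, ⋃ i, W c i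

theorem Paintable.mono {κ : Type} {s t : Set X} (h : s ⊆ t) (ht : Paintable κ t) :
    Paintable κ s := fun U hU hU' => by
  obtain ⟨ι, hι, W, p, h1, h2, h3, h4, h5⟩ := ht U hU hU'
  exact ⟨ι, hι, W, p, h1, h2, h3, h4, h.trans h5⟩

theorem Paintable.empty (κ : Type) : Paintable κ (∅ : Set X) := fun _ _ _ =>
  ⟨Empty, inferInstance, fun _ => Empty.elim, fun _ => Empty.elim, fun _ i => i.elim,
    fun _ i => i.elim, fun _ i => i.elim, fun _ i => i.elim, empty_subset _⟩

/-- The second covering is chosen after the first and finer than it. A set of the second covering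
touching a set of the first of the same colour is absorbed into the latter; the others keep their
own index. Absorption stays inside one prescribed neighbourhood by the choice of `U'`, and no new
colours are needed. -/
theorem Paintable.union {κ : Type} [Finite κ] {s t : Set X} (hs : Paintable κ s)
    (ht : Paintable κ t) : Paintable κ (s ∪ t) := by
  classical
  intro U hUo hU
  obtain ⟨ι, hι, W, p, hWo, hWU, hWc, hWd, hWs⟩ := hs U hUo hU
  -- A set inside `U' x` either lies in the neighbourhood belonging to `W c i` or misses the closure
  -- of `W c i`, according to the position of `x`.
  let U' : X → Set X := fun x => U x ∩ ⋂ c, ⋂ i,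
    if x ∈ closure (W c i) then U (p c i) else (closure (W c i))ᶜ
  obtain ⟨ι', hι', V, q, hVo, hVU, hVc, hVd, hVt⟩ := ht U'
    (fun x => by
      refine (hUo x).inter (isOpen_iInter_of_finite fun c => isOpen_iInter_of_finite fun i => ?_)
      split_ifs with h
      · exact hUo _
      · exact isClosed_closure.isOpen_compl)
    (fun x => by
      refine ⟨hU x, mem_iInter.mpr fun c => mem_iInter.mpr fun i => ?_⟩
      split_ifs with h
      · exact hWU c i h
      · exact h)
  -- The absorption relation. The index `i` is determined by `c` and `j`, because `q c j` lies in
  -- the closure of `W c i` and such closures are disjoint.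
  let R : κ → ι → ι' → Prop := fun c i j => ¬ Disjoint (closure (W c i)) (closure (V c j))
  have hV' : ∀ c i j, closure (V c j) ⊆
      if q c j ∈ closure (W c i) then U (p c i) else (closure (W c i))ᶜ := fun c i j z hz =>
    mem_iInter.mp (mem_iInter.mp (hVU c j hz).2 c) i
  have hR : ∀ {c i j}, R c i j → q c j ∈ closure (W c i) := by
    intro c i j h
    by_contra h'
    have := hV' c i j
    rw [if_neg h'] at this
    exact h (disjoint_compl_right.mono_right this)
  have hRu : ∀ {c i i' j}, R c i j → R c i' j → i = i' := by
    intro c i i' j h h'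
    by_contra hne
    exact (hWd c i i' hne).le_bot ⟨hR h, hR h'⟩
  have hRU : ∀ {c i j}, R c i j → closure (V c j) ⊆ U (p c i) := by
    intro c i j h
    have := hV' c i j
    rwa [if_pos (hR h)] at this
  have hcl : ∀ c i, closure (W c i ∪ ⋃ j, ⋃ (_ : R c i j), V c j) =
      closure (W c i) ∪ ⋃ j, ⋃ (_ : R c i j), closure (V c j) := by
    intro c i
    rw [closure_union, closure_iUnion_of_finite]
    congr 1
    exact iUnion_congr fun j => closure_iUnion_of_finite _
  have hcl' : ∀ c j, closure (⋃ (_ : ∀ i, ¬ R c i j), V c j) =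
      ⋃ (_ : ∀ i, ¬ R c i j), closure (V c j) := fun c j => closure_iUnion_of_finite _
  have hWV : ∀ c i j, (∀ i, ¬ R c i j) → Disjoint (closure (W c i)) (closure (V c j)) :=
    fun c i j h => not_not.mp (h i)
  refine ⟨ι ⊕ ι', inferInstance,
    fun c => Sum.elim (fun i => W c i ∪ ⋃ j, ⋃ (_ : R c i j), V c j)
      (fun j => ⋃ (_ : ∀ i, ¬ R c i j), V c j),
    fun c => Sum.elim (p c) (q c), ?_, ?_, ?_, ?_, ?_⟩
  · rintro c (i | j)
    · exact (hWo c i).union (isOpen_iUnion fun j => isOpen_iUnion fun _ => hVo c j)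
    · exact isOpen_iUnion fun _ => hVo c j
  · rintro c (i | j)
    · simp only [Sum.elim_inl, hcl]
      exact union_subset (hWU c i) (iUnion_subset fun j => iUnion_subset fun h => hRU h)
    · simp only [Sum.elim_inr, hcl']
      exact iUnion_subset fun _ => (hVU c j).trans inter_subset_left
  · rintro c (i | j)
    · simp only [Sum.elim_inl, hcl]
      exact (hWc c i).union (isCompact_iUnion fun j => isCompact_iUnion fun _ => hVc c j)
    · simp only [Sum.elim_inr, hcl']
      exact isCompact_iUnion fun _ => hVc c j
  · have key1 : ∀ c i i', i ≠ i' → Disjoint (closure (W c i ∪ ⋃ j, ⋃ (_ : R c i j), V c j))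
        (closure (W c i' ∪ ⋃ j, ⋃ (_ : R c i' j), V c j)) := by
      intro c i i' hne
      simp only [hcl, disjoint_union_left, disjoint_union_right, disjoint_iUnion_left,
        disjoint_iUnion_right]
      refine ⟨⟨hWd c i i' hne, fun j h => ?_⟩, fun j h => ⟨?_, fun j' h' => ?_⟩⟩
      · by_contra h'
        exact hne (hRu h fun h3 => h' h3.symm)
      · by_contra h'
        exact hne (hRu h' h)
      · refine hVd c _ _ ?_
        rintro rfl
        exact hne (hRu h' h)
    have key2 : ∀ c i j, Disjoint (closure (W c i ∪ ⋃ j, ⋃ (_ : R c i j), V c j))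
        (closure (⋃ (_ : ∀ i, ¬ R c i j), V c j)) := by
      intro c i j
      simp only [hcl, hcl', disjoint_union_left, disjoint_iUnion_left, disjoint_iUnion_right]
      refine fun h => ⟨hWV c i j h, fun j' h' => hVd c _ _ ?_⟩
      rintro rfl
      exact h i h'
    rintro c (i | j) (i' | j') hne
    · exact key1 c i i' fun h => hne (congrArg _ h)
    · exact key2 c i j'
    · exact (key2 c i' j).symm
    · simp only [Sum.elim_inr, hcl']
      refine disjoint_iUnion_left.mpr fun _ => disjoint_iUnion_right.mpr fun _ => ?_
      exact hVd c j j' fun h => hne (congrArg _ h)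
  · rintro x (hx | hx)
    · obtain ⟨c, hx⟩ := mem_iUnion.mp (hWs hx)
      obtain ⟨i, hx⟩ := mem_iUnion.mp hx
      exact mem_iUnion.mpr ⟨c, mem_iUnion.mpr ⟨Sum.inl i, Or.inl hx⟩⟩
    · obtain ⟨c, hx⟩ := mem_iUnion.mp (hVt hx)
      obtain ⟨j, hx⟩ := mem_iUnion.mp hx
      by_cases h : ∀ i, ¬ R c i j
      · exact mem_iUnion.mpr ⟨c, mem_iUnion.mpr ⟨Sum.inr j, mem_iUnion.mpr ⟨h, hx⟩⟩⟩
      · push Not at h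
        obtain ⟨i, hi⟩ := h
        exact mem_iUnion.mpr ⟨c, mem_iUnion.mpr ⟨Sum.inl i, Or.inr
          (mem_iUnion.mpr ⟨j, mem_iUnion.mpr ⟨hi, hx⟩⟩)⟩⟩

/-- In the sup norm balls are cubes. Cubes of radius `3ε/4` around the points of the lattice `ε ℤⁿ`
cover, since every point is within `ε/2` of the lattice. Colouring lattice points by the parities of
their coordinates puts distinct centres of one colour at distance at least `2ε > 3ε/2`, so their
closed cubes are disjoint. -/
theorem OpenPartialHomeomorph.exists_nhds_paintable [T2Space X] {n : ℕ}
    (e : OpenPartialHomeomorph X (Fin n → ℝ)) {x : X} (hx : x ∈ e.source) :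
    ∃ t ∈ 𝓝 x, Paintable (Fin n → Fin 2) t := by
  classical
  obtain ⟨r, hr, hrt⟩ := Metric.nhds_basis_closedBall.mem_iff.mp
    (e.open_target.mem_nhds (e.map_source hx))
  refine ⟨e.source ∩ e ⁻¹' Metric.closedBall (e x) (r / 2), Filter.inter_mem
    (e.open_source.mem_nhds hx) ((e.continuousAt hx).preimage_mem_nhds
      (Metric.closedBall_mem_nhds _ (by positivity))), fun U hUo hU => ?_⟩
  have hB : IsCompact (Metric.closedBall (e x) r) := isCompact_closedBall _ _
  have hnh : ∀ y ∈ Metric.closedBall (e x) r, e.symm ⁻¹' U (e.symm y) ∈ 𝓝 y := fun y hy =>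
    (e.continuousAt_symm (hrt hy)).preimage_mem_nhds ((hUo _).mem_nhds (hU _))
  obtain ⟨δ, hδ, hδU⟩ := Metric.uniformity_basis_dist.lebesgue_number_lemma_nhds hB hnh
  -- A cube has diameter `3ε/2`. The first bound keeps it within the Lebesgue number `δ`; the second
  -- keeps every cube meeting the half-size ball inside the ball of radius `r`.
  obtain ⟨ε, hε, hεδ, hεr⟩ : ∃ ε > 0, ε * 2 < δ ∧ ε * 4 ≤ r := by
    refine ⟨min δ r / 4, by positivity, ?_, ?_⟩
    · have := min_le_left δ r
      linarith
    · have := min_le_right δ r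
      linarith
  let cen : (Fin n → Fin 2) → (Fin n → ℤ) → Fin n → ℝ := fun c i k => ε * (2 * i k + (c k : ℕ))
  -- The bound `L` makes the index set of cubes finite.
  obtain ⟨L, hL⟩ : ∃ L : ℕ, ∀ (z : Fin n → ℝ), z ∈ Metric.closedBall (e x) (r / 2) →
      ∀ (k : Fin n) (a : ℤ), |z k - ε * a| ≤ ε → |a / 2| ≤ L := by
    obtain ⟨L, hL⟩ := exists_nat_gt ((‖e x‖ + r) / ε + 1)
    refine ⟨L, fun z hz k a ha => ?_⟩
    have h1 : |z k| ≤ ‖e x‖ + r := by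
      have := norm_le_pi_norm z k
      rw [Real.norm_eq_abs] at this
      have h2 : ‖z‖ ≤ ‖e x‖ + ‖z - e x‖ := by simpa using norm_add_le (e x) (z - e x)
      rw [Metric.mem_closedBall, dist_eq_norm] at hz
      linarith
    have h3 : |ε * (a : ℝ)| ≤ ‖e x‖ + r + ε := by
      have := abs_sub_abs_le_abs_sub (ε * (a : ℝ)) (z k)
      rw [abs_sub_comm] at this
      linarith
    have h4 : |(a : ℝ)| ≤ (‖e x‖ + r) / ε + 1 := by
      rw [abs_mul, abs_of_pos hε] at h3
      rw [← sub_le_iff_le_add, le_div_iff₀ hε]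
      linarith
    have h5 : |a| ≤ (L : ℤ) := by
      have : (|a| : ℝ) ≤ (L : ℝ) := (h4.trans_lt hL).le
      exact_mod_cast this
    rw [abs_le] at h5 ⊢
    omega
  -- Only cubes that meet the half-size ball are used; the others are replaced by the empty set.
  let good : (Fin n → Fin 2) → (Fin n → ℤ) → Prop := fun c i =>
    ∃ y, y ∈ Metric.closedBall (e x) (r / 2) ∧ y ∈ Metric.closedBall (cen c i) (3 / 4 * ε)
  have hgt : ∀ c i, good c i → Metric.closedBall (cen c i) (3 / 4 * ε) ⊆
      Metric.closedBall (e x) r := by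
    rintro c i ⟨y, hy, hy'⟩ z hz
    rw [Metric.mem_closedBall] at *
    have h1 := dist_triangle z (cen c i) y
    have h2 := dist_triangle z y (e x)
    rw [dist_comm] at hy'
    linarith
  have hgp : ∀ c i, ∃ p : X, good c i → Metric.closedBall (cen c i) (3 / 4 * ε) ⊆
      e.symm ⁻¹' U p := by
    intro c i
    by_cases h : good c i
    · obtain ⟨y, hy, hy'⟩ := h
      obtain ⟨y', hy2⟩ := hδU y (Metric.closedBall_subset_closedBall (by linarith) hy)
      refine ⟨e.symm y', fun _ z hz => hy2 ?_⟩
      rw [Metric.mem_closedBall] at *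
      have h1 := dist_triangle y (cen c i) z
      rw [dist_comm (cen c i) z] at h1
      change dist y z < δ
      linarith
    · exact ⟨x, fun h' => absurd h' h⟩
  choose p hp using hgp
  let ι := Fin n → ↥(Set.Icc (-(L : ℤ)) L)
  let D : (Fin n → Fin 2) → ι → Set X := fun c i =>
    ⋃ (_ : good c fun k => i k), e.symm '' Metric.closedBall (cen c fun k => i k) (3 / 4 * ε)
  let W : (Fin n → Fin 2) → ι → Set X := fun c i =>
    ⋃ (_ : good c fun k => i k), e.symm '' Metric.ball (cen c fun k => i k) (3 / 4 * ε)
  have hDc : ∀ c i, IsCompact (D c i) := fun c i => isCompact_iUnion fun h =>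
    (isCompact_closedBall _ _).image_of_continuousOn
      (e.continuousOn_symm.mono ((hgt c _ h).trans hrt))
  have hWD : ∀ c i, closure (W c i) ⊆ D c i := fun c i =>
    closure_minimal (iUnion_mono fun h => image_mono Metric.ball_subset_closedBall)
      (hDc c i).isClosed
  refine ⟨ι, inferInstance, W, fun c i => p c fun k => i k, fun c i => isOpen_iUnion fun h => ?_,
    fun c i => (hWD c i).trans (iUnion_subset fun h => ?_),
    fun c i => (hDc c i).of_isClosed_subset isClosed_closure (hWD c i),
    fun c i j hij => Disjoint.mono (hWD c i) (hWD c j) ?_, ?_⟩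
  · exact e.isOpen_image_symm_of_subset_target Metric.isOpen_ball
      (Metric.ball_subset_closedBall.trans ((hgt c _ h).trans hrt))
  · rw [image_subset_iff]
    exact hp c _ h
  · refine disjoint_iUnion_left.mpr fun h => disjoint_iUnion_right.mpr fun h' => ?_
    rw [disjoint_left]
    rintro _ ⟨y, hy, rfl⟩ ⟨y', hy', he⟩
    obtain rfl := e.symm.injOn ((hgt c _ h').trans hrt hy') ((hgt c _ h).trans hrt hy) he
    obtain ⟨k, hk⟩ := Function.ne_iff.mp hij
    have hk' : ((i k : ℤ)) ≠ j k := fun h => hk (Subtype.ext h)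
    have h1 := (dist_le_pi_dist _ _ k).trans (Metric.mem_closedBall.mp hy)
    have h2 := (dist_le_pi_dist _ _ k).trans (Metric.mem_closedBall.mp hy')
    rw [Real.dist_eq, abs_le] at h1 h2
    simp only [cen] at h1 h2
    rcases lt_or_gt_of_ne hk' with hlt | hlt
    · have : ((i k : ℤ) : ℝ) + 1 ≤ (j k : ℤ) := by exact_mod_cast hlt
      nlinarith
    · have : ((j k : ℤ) : ℝ) + 1 ≤ (i k : ℤ) := by exact_mod_cast hlt
      nlinarith
  · rintro y ⟨hy, hy'⟩
    let a : Fin n → ℤ := fun k => round (e y k / ε)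
    have ha : ∀ k, |e y k - ε * a k| ≤ ε / 2 := by
      intro k
      have h := abs_sub_round (e y k / ε)
      have e1 : e y k - ε * a k = ε * (e y k / ε - a k) := by field_simp
      rw [e1, abs_mul, abs_of_pos hε]
      nlinarith
    -- The nearest lattice point `a` determines the colour by its parities and the cube by its
    -- halves.
    let c : Fin n → Fin 2 := fun k => ⟨(a k % 2).toNat, by omega⟩
    let i : ι := fun k => ⟨a k / 2, abs_le.mp (hL (e y) hy' k (a k) ((ha k).trans (by linarith)))⟩
    have hcen : ∀ k, cen c (fun k => i k) k = ε * a k := by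
      intro k
      have h1 : ((((a k % 2).toNat : ℕ) : ℤ) : ℝ) = ((a k % 2 : ℤ) : ℝ) := by
        rw [Int.toNat_of_nonneg (Int.emod_nonneg _ (by norm_num))]
      have h2 : ((2 * (a k / 2) + a k % 2 : ℤ) : ℝ) = a k := by
        rw [Int.mul_ediv_add_emod]
      simp only [cen, c, i]
      rw [← h2]
      push_cast at h1 ⊢
      rw [h1]
    have hball : e y ∈ Metric.ball (cen c fun k => i k) (3 / 4 * ε) := by
      rw [Metric.mem_ball]
      refine (dist_pi_lt_iff (by positivity)).mpr fun k => ?_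
      rw [Real.dist_eq, hcen]
      exact (ha k).trans_lt (by linarith)
    exact mem_iUnion.mpr ⟨c, mem_iUnion.mpr ⟨i, mem_iUnion.mpr
      ⟨⟨e y, hy', Metric.ball_subset_closedBall hball⟩, e y, hball, e.left_inv hy⟩⟩⟩

theorem IsCompact.paintable {n : ℕ} [T2Space X] [ChartedSpace (Euc n) X] {K : Set X}
    (hK : IsCompact K) : Paintable (Fin n → Fin 2) K := by
  refine hK.induction_on (Paintable.empty _) (fun s t h ht => ht.mono h)
    (fun s t hs ht => hs.union ht) fun x _ => ?_
  obtain ⟨t, ht, h⟩ := ((chartAt (Euc n) x).transHomeomorph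
    (EuclideanSpace.equiv (Fin n) ℝ).toHomeomorph).exists_nhds_paintable (x := x)
    (mem_chart_source (Euc n) x)
  exact ⟨t, mem_nhdsWithin_of_mem_nhds ht, h⟩

end Painting

/-! ### Paintings of a manifold and finite partitions of unity -/

section Painting

open Set Topology

variable {n : ℕ} {M : Type*} [TopologicalSpace M] [ChartedSpace (Euc n) M]

/-- An exhaustion cuts the manifold into compact layers `L j` with open neighbourhoods `N j`, and `N
j`, `N j'` are disjoint once the indices differ by at least three. Painting each layer with `2ⁿ`
colours and recording `j` modulo three uses `3 · 2ⁿ` colours in all. -/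
theorem exists_painting (n : ℕ) {M : Type*} [TopologicalSpace M] [ChartedSpace (Euc n) M] [T2Space M] [SecondCountableTopology M] (U : M → Set M)
    (hUo : ∀ x, IsOpen (U x)) (hU : ∀ x, x ∈ U x) :
    ∃ (κ : Type) (_ : Fintype κ) (ι : Type) (_ : Countable ι) (W : κ → ι → Set M) (p : κ → ι → M),
      (∀ c i, IsOpen (W c i)) ∧ (∀ c i, closure (W c i) ⊆ U (p c i)) ∧
      (∀ c i, IsCompact (closure (W c i))) ∧ (∀ c i j, i ≠ j → Disjoint (W c i) (W c j)) ∧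
      ⋃ c, ⋃ i, W c i = univ := by
  classical
  have : LocallyCompactSpace M := ChartedSpace.locallyCompactSpace (Euc n) M
  let K : CompactExhaustion M := default
  -- The shift makes `S 0` empty, so the truncated index `j - 1` in `N 0` removes nothing.
  let S := K.shiftr
  have hS0 : S 0 = ∅ := rfl
  let L : ℕ → Set M := fun j => S (j + 1) \ interior (S j)
  let N : ℕ → Set M := fun j => interior (S (j + 2)) \ S (j - 1)
  have hL : ∀ j, IsCompact (L j) := fun j => (S.isCompact _).diff isOpen_interior
  have hN : ∀ j, IsOpen (N j) := fun j => isOpen_interior.sdiff (S.isCompact _).isClosed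
  have hLN : ∀ j, L j ⊆ N j := by
    rintro j x ⟨hx, hx'⟩
    refine ⟨S.subset_interior_succ _ hx, fun h => hx' ?_⟩
    rcases j with _ | j
    · exact absurd h (by simp [hS0])
    · exact S.subset_interior_succ _ h
  have hNN : ∀ {j j'}, j + 3 ≤ j' → Disjoint (N j) (N j') := by
    intro j j' h
    rw [disjoint_left]
    rintro x ⟨hx, -⟩ ⟨-, hx'⟩
    exact hx' (S.subset (by omega : j + 2 ≤ j' - 1) (interior_subset hx))
  have hcov : ∀ x, ∃ j, x ∈ L j := fun x =>
    ⟨K.find x, (K.mem_sdiff_shiftr_find x).1,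
      fun h => (K.mem_sdiff_shiftr_find x).2 (interior_subset h)⟩
  -- Sets assigned to points outside `N j` avoid the layer `L j` and can be discarded without losing
  -- the covering.
  let U' : ℕ → M → Set M := fun j x => if x ∈ N j then U x ∩ N j else (L j)ᶜ
  have hp := fun j => (hL j).paintable (n := n) (U' j)
    (fun x => by
      simp only [U']
      split_ifs
      · exact (hUo x).inter (hN j)
      · exact (hL j).isClosed.isOpen_compl)
    (fun x => by
      simp only [U']
      split_ifs with h
      · exact ⟨hU x, h⟩
      · exact fun h' => h (hLN j h'))
  choose ι hι W p hWo hWU hWc hWd hWL using hp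
  let W' : (Fin n → Fin 2) × Fin 3 → (Σ j, ι j) → Set M := fun c i =>
    ⋃ (_ : i.1 % 3 = c.2 ∧ p i.1 c.1 i.2 ∈ N i.1), W i.1 c.1 i.2
  have hW' : ∀ c i, W' c i ⊆ W i.1 c.1 i.2 := fun c i => iUnion_subset fun _ => le_rfl
  have hWN : ∀ c i, closure (W' c i) ⊆ U (p i.1 c.1 i.2) ∩ N i.1 := by
    intro c i
    simp only [W', closure_iUnion_of_finite]
    refine iUnion_subset fun h => ?_
    have := hWU i.1 c.1 i.2
    simp only [U', if_pos h.2] at this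
    exact this
  refine ⟨_, inferInstance, Σ j, ι j, inferInstance, W', fun c i => p i.1 c.1 i.2, ?_, ?_, ?_, ?_, ?_⟩
  · exact fun c i => isOpen_iUnion fun _ => hWo _ _ _
  · exact fun c i => (hWN c i).trans inter_subset_left
  · exact fun c i => (hWc i.1 c.1 i.2).of_isClosed_subset isClosed_closure (closure_mono (hW' c i))
  · rintro c ⟨j, i⟩ ⟨j', i'⟩ hne
    have key : ∀ (j j' : ℕ) (i : ι j) (i' : ι j'), j < j' →
        Disjoint (W' c ⟨j, i⟩) (W' c ⟨j', i'⟩) := by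
      intro j j' i i' hlt
      rw [disjoint_left]
      intro x hx hx'
      have h1 := (hWN _ _ (subset_closure hx)).2
      have h2 := (hWN _ _ (subset_closure hx')).2
      obtain ⟨⟨h3, -⟩, -⟩ := mem_iUnion.mp hx
      obtain ⟨⟨h4, -⟩, -⟩ := mem_iUnion.mp hx'
      simp only at h1 h2 h3 h4
      exact (hNN (by omega)).le_bot ⟨h1, h2⟩
    rcases lt_trichotomy j j' with h | rfl | h
    · exact key _ _ _ _ h
    · refine Disjoint.mono ((hW' _ _).trans subset_closure) ((hW' _ _).trans subset_closure)
        (hWd j c.1 i i' fun h => hne (by rw [h]))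
    · exact (key _ _ _ _ h).symm
  · refine eq_univ_of_forall fun x => ?_
    obtain ⟨j, hx⟩ := hcov x
    obtain ⟨c, hc⟩ := mem_iUnion.mp (hWL j hx)
    obtain ⟨i, hi⟩ := mem_iUnion.mp hc
    refine mem_iUnion.mpr ⟨(c, ⟨j % 3, by omega⟩), mem_iUnion.mpr ⟨⟨j, i⟩, mem_iUnion.mpr
      ⟨⟨rfl, ?_⟩, hi⟩⟩⟩
    by_contra h
    have := hWU j c i (subset_closure hi)
    simp only [U', if_neg h] at this
    exact this hx

/-- A finite smooth partition of unity `χ`, each member of which is supported in a disjoint union of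
sets with compact closures inside the given sets `U (p c i)`; `idx` tells the set to which a point
belongs, and `b c` is a cutoff function equal to one near the support of `χ c`. -/
structure PaintedPartition (n : ℕ) {M : Type*} [TopologicalSpace M] [ChartedSpace (Euc n) M]
    (U : M → Set M) where
  κ : Type
  [fintype : Fintype κ]
  ι : Type
  enc : ι → ℕ
  enc_injective : Function.Injective enc
  p : κ → ι → M
  idx : κ → M → ι
  χ : κ → M → ℝ
  b : κ → M → ℝ
  contMDiff_χ : ∀ c, ContMDiff (𝓡 n) 𝓘(ℝ, ℝ) ∞ (χ c)
  contMDiff_b : ∀ c, ContMDiff (𝓡 n) 𝓘(ℝ, ℝ) ∞ (b c)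
  mem_U : ∀ c, ∀ x ∈ tsupport (b c), x ∈ U (p c (idx c x))
  idx_eventuallyEq : ∀ c, ∀ x ∈ tsupport (b c), ∀ᶠ y in 𝓝 x, idx c y = idx c x
  sum_χ : ∀ x, ∑ c, χ c x = 1
  b_eventuallyEq_one : ∀ c, ∀ x ∈ tsupport (χ c), ∀ᶠ y in 𝓝 x, b c y = 1
  isCompact : ∀ c i, IsCompact {x | x ∈ tsupport (b c) ∧ idx c x = i}

/-- A partition of unity is taken subordinate to the finite covering by the unions of the sets of
one colour. Disjointness within a colour makes the index of the piece locally constant on the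
support. -/
theorem exists_paintedPartition [T2Space M] [SecondCountableTopology M] [IsManifold (𝓡 n) ∞ M]
    (U : M → Set M) (hUo : ∀ x, IsOpen (U x)) (hU : ∀ x, x ∈ U x) :
    Nonempty (PaintedPartition n U) := by
  classical
  have : LocallyCompactSpace M := ChartedSpace.locallyCompactSpace (Euc n) M
  obtain ⟨κ, hκ, ι, hι, W, p, hWo, hWU, hWc, hWd, hWu⟩   := exists_painting n U hUo hU
  obtain ⟨enc, henc⟩ := Countable.exists_injective_nat ι
  obtain ⟨χ, hχ⟩ := SmoothPartitionOfUnity.exists_isSubordinate (𝓡 n) isClosed_univ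
    (fun c => ⋃ i, W c i) (fun c => isOpen_iUnion fun i => hWo c i) hWu.ge
  have hb : ∀ c, ∃ b : C^∞⟮𝓡 n, M; 𝓘(ℝ, ℝ), ℝ⟯, (∀ x ∈ tsupport (χ c), ∀ᶠ y in 𝓝 x, b y = 1) ∧
      tsupport b ⊆ ⋃ i, W c i := by
    intro c
    obtain ⟨u, hu, hsu, huW⟩ := normal_exists_closure_subset (isClosed_tsupport (χ c))
      (isOpen_iUnion fun i => hWo c i) (hχ c)
    obtain ⟨b, hb1, hb0, -⟩ := exists_contMDiffMap_one_nhds_of_subset_interior (𝓡 n)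
      (isClosed_tsupport (χ c)) (hsu.trans (interior_maximal subset_closure hu)) (n := ⊤)
    refine ⟨b, fun x hx => ?_, (closure_minimal (fun x hx => ?_) isClosed_closure).trans huW⟩
    · exact (Filter.eventually_iff_exists_mem.mp hb1).elim fun s hs =>
        Filter.mem_of_superset (mem_nhdsSet_iff_forall.mp hs.1 x hx) hs.2
    · by_contra h
      exact hx (hb0 x h)
  choose b hb1 hbW using hb
  have hidx : ∀ c x, ∃ i, (∃ j, x ∈ W c j) → x ∈ W c i := by
    intro c x
    by_cases h : ∃ j, x ∈ W c j
    · exact h.imp fun i hi _ => hi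
    · have hx := hWu.ge (mem_univ x)
      obtain ⟨c', hx⟩ := mem_iUnion.mp hx
      obtain ⟨i, hx⟩ := mem_iUnion.mp hx
      exact ⟨i, fun h' => absurd h' h⟩
  choose idx hidx using hidx
  have hidx' : ∀ {c x i}, x ∈ W c i → idx c x = i := by
    intro c x i h
    by_contra hne
    exact (hWd c _ _ hne).le_bot ⟨hidx c x ⟨i, h⟩, h⟩
  have hmem : ∀ c, ∀ x ∈ tsupport (b c), x ∈ W c (idx c x) := fun c x hx =>
    hidx c x (mem_iUnion.mp (hbW c hx))
  refine ⟨{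
    κ := κ
    ι := ι
    enc := enc
    enc_injective := henc
    p := p
    idx := idx
    χ := fun c => χ c
    b := fun c => b c
    contMDiff_χ := fun c => (χ c).contMDiff
    contMDiff_b := fun c => (b c).contMDiff
    mem_U := fun c x hx => hWU c _ (subset_closure (hmem c x hx))
    idx_eventuallyEq := fun c x hx =>
      Filter.mem_of_superset ((hWo c _).mem_nhds (hmem c x hx)) fun y hy => hidx' hy
    sum_χ := fun x => ?_
    b_eventuallyEq_one := hb1
    isCompact := fun c i => ?_ }⟩
  · rw [← finsum_eq_sum_of_fintype]
    exact χ.sum_eq_one (mem_univ x)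
  · refine (hWc c i).of_isClosed_subset ?_ fun x hx => ?_
    · have : {x | x ∈ tsupport (b c) ∧ idx c x = i} = tsupport (b c) \ ⋃ j, ⋃ (_ : j ≠ i), W c j := by
        ext x
        simp only [mem_ofPred_eq, mem_sdiff, mem_iUnion, not_exists]
        refine ⟨fun h => ⟨h.1, fun j hj hx => hj ((hidx' hx).symm.trans h.2)⟩, fun h => ⟨h.1, ?_⟩⟩
        by_contra hne
        exact h.2 _ hne (hmem c x h.1)
      rw [this]
      exact (isClosed_tsupport _).sdiff (isOpen_iUnion fun j => isOpen_iUnion fun _ => hWo c j)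
    · exact subset_closure (hx.2 ▸ hmem c x hx.1)

end Painting

/-! ### Local coordinates -/

section Coordinates

open Set Topology

variable {n : ℕ} {M : Type*} [TopologicalSpace M] [ChartedSpace (Euc n) M]

/-- The components of tangent vectors at `x` in the chart at `p`. -/
def chartDeriv (p x : M) : TangentSpace (𝓡 n) x →L[ℝ] Euc n :=
  mfderiv (𝓡 n) 𝓘(ℝ, Euc n) (chartAt (Euc n) p) x

theorem eventuallyEq_comp_chart {F : Type*} {p x : M} (hx : x ∈ (chartAt (Euc n) p).source)
    (h : M → F) : h =ᶠ[𝓝 x] (h ∘ (chartAt (Euc n) p).symm) ∘ chartAt (Euc n) p := by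
  filter_upwards [(chartAt (Euc n) p).open_source.mem_nhds hx] with y hy
  simp [(chartAt (Euc n) p).left_inv hy]

theorem ContMDiffOn.comp_chart_symm [IsManifold (𝓡 n) ∞ M] {F : Type*} [NormedAddCommGroup F]
    [NormedSpace ℝ F] {h : M → F} {s : Set M} (hh : ContMDiffOn (𝓡 n) 𝓘(ℝ, F) ∞ h s) (p : M) :
    ContDiffOn ℝ ∞ (h ∘ (chartAt (Euc n) p).symm)
      ((chartAt (Euc n) p).target ∩ (chartAt (Euc n) p).symm ⁻¹' s) := by
  rw [← contMDiffOn_iff_contDiffOn]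
  exact hh.comp (contMDiffOn_chart_symm.mono inter_subset_left) fun z hz => hz.2

theorem mfderiv_eq_fderiv_chart [IsManifold (𝓡 n) ∞ M] {F : Type*} [NormedAddCommGroup F]
    [NormedSpace ℝ F] {p x : M} (hx : x ∈ (chartAt (Euc n) p).source) {h : M → F}
    (hh : DifferentiableAt ℝ (h ∘ (chartAt (Euc n) p).symm) (chartAt (Euc n) p x))
    (ξ : TangentSpace (𝓡 n) x) :
    mfderiv (𝓡 n) 𝓘(ℝ, F) h x ξ =
      fderiv ℝ (h ∘ (chartAt (Euc n) p).symm) (chartAt (Euc n) p x) (chartDeriv p x ξ) := by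
  have hc : MDifferentiableAt (𝓡 n) 𝓘(ℝ, Euc n) (chartAt (Euc n) p) x :=
    (mdifferentiableAt_atlas (chart_mem_atlas _ _) hx)
  rw [(eventuallyEq_comp_chart hx h).mfderiv_eq, mfderiv_comp x hh.mdifferentiableAt hc,
    mfderiv_eq_fderiv]
  rfl

theorem chartDeriv_surjective [IsManifold (𝓡 n) ∞ M] {p x : M}
    (hx : x ∈ (chartAt (Euc n) p).source) : Function.Surjective (chartDeriv (n := n) p x) := by
  obtain ⟨e, he⟩ := isInvertible_mfderiv_extChartAt (I := 𝓡 n) (x := p) (y := x) (by simpa using hx)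
  intro v
  refine ⟨e.symm v, ?_⟩
  have h : mfderiv (𝓡 n) 𝓘(ℝ, Euc n) (extChartAt (𝓡 n) p) x (e.symm v) = v := by
    rw [← he]
    exact e.apply_symm_apply v
  have e1 : (extChartAt (𝓡 n) p : M → Euc n) = chartAt (Euc n) p := by
    ext1 y
    simp
  rw [e1] at h
  exact h

theorem isOpen_image_chart {n : ℕ} {M : Type*} [TopologicalSpace M] [ChartedSpace (Euc n) M] {p : M} {s : Set M} (hs : IsOpen s)
    (h : s ⊆ (chartAt (Euc n) p).source) : IsOpen (chartAt (Euc n) p '' s) :=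
  (chartAt (Euc n) p).isOpen_image_of_subset_source hs h

end Coordinates

set_option linter.unusedSectionVars false

/-! ### Derivatives of sections in local coordinates -/

section JetCoordinates

open Set Topology

variable {n m : ℕ}

/-- The derivatives of order at most `k` of a function. -/
def derivs (k : ℕ) (f : Euc n → Euc m) (z : Euc n) : Derivs n m k := fun j =>
  iteratedFDeriv ℝ j f z

/-- The derivative along `v` of the derivatives of order at most `k`. -/
def Derivs.shift {k : ℕ} (u : Derivs n m (k + 1)) (v : Euc n) : Derivs n m k := fun j =>
  (u j.succ).curryLeft v

theorem Derivs.contDiff_shift {k : ℕ} :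
    ContDiff ℝ ∞ fun w : Derivs n m (k + 1) × Euc n => w.1.shift w.2 := by
  refine contDiff_pi.mpr fun j => ?_
  have h1 : ContDiff ℝ ∞ fun w : Derivs n m (k + 1) × Euc n =>
      continuousMultilinearCurryLeftEquiv ℝ (fun _ : Fin (j + 1) => Euc n) (Euc m) (w.1 j.succ) :=
    (continuousMultilinearCurryLeftEquiv ℝ (fun _ : Fin (j + 1) => Euc n)
      (Euc m)).toContinuousLinearEquiv.contDiff.comp
      ((ContinuousLinearMap.proj (R := ℝ)
        (φ := fun j : Fin (k + 1 + 1) => (Euc n [×(j : ℕ)]→L[ℝ] Euc m)) j.succ).contDiff.comp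
        contDiff_fst)
  exact h1.clm_apply contDiff_snd

theorem hasFDerivAt_derivs {f : Euc n → Euc m} {z : Euc n} (hf : ContDiffAt ℝ ∞ f z) (k : ℕ) :
    ∃ f' : Euc n →L[ℝ] Derivs n m k, HasFDerivAt (derivs k f) f' z ∧
      ∀ v, f' v = (derivs (k + 1) f z).shift v := by
  refine ⟨ContinuousLinearMap.pi fun j => fderiv ℝ (iteratedFDeriv ℝ j f) z,
    hasFDerivAt_pi.mpr fun j => ?_, fun v => funext fun j => ?_⟩
  · exact (hf.differentiableAt_iteratedFDeriv (by exact_mod_cast WithTop.coe_lt_top _)).hasFDerivAt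
  · change fderiv ℝ (iteratedFDeriv ℝ j f) z v = _
    rw [fderiv_iteratedFDeriv]
    rfl

variable {M : Type*} [TopologicalSpace M] [ChartedSpace (Euc n) M]
  {E : M → Type*} [∀ x, AddCommGroup (E x)] [∀ x, Module ℝ (E x)] [∀ x, TopologicalSpace (E x)]
  [TopologicalSpace (Bundle.TotalSpace (Euc m) E)] [FiberBundle (Euc m) E]
  [VectorBundle ℝ (Euc m) E]

theorem derivsAt_eq (k : ℕ) (x₀ x : M) (σ : Sec n m E) :
    derivsAt k x₀ x σ = derivs k (locRep x₀ σ) (chartAt (Euc n) x₀ x) := rfl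

theorem isOpen_domAt (x₀ : M) : IsOpen (domAt n m E x₀) :=
  (chartAt (Euc n) x₀).open_source.inter (trivializationAt (Euc m) E x₀).open_baseSet

theorem mem_domAt (x₀ : M) : x₀ ∈ domAt n m E x₀ :=
  ⟨mem_chart_source _ _, FiberBundle.mem_baseSet_trivializationAt' x₀⟩

theorem domAt_subset (x₀ : M) : domAt n m E x₀ ⊆ (chartAt (Euc n) x₀).source := inter_subset_left

theorem image_domAt (x₀ : M) : chartAt (Euc n) x₀ '' domAt n m E x₀ =
    (chartAt (Euc n) x₀).target ∩ (chartAt (Euc n) x₀).symm ⁻¹' domAt n m E x₀ :=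
  (chartAt (Euc n) x₀).image_eq_target_inter_inv_preimage (domAt_subset x₀)

theorem isOpen_image_domAt (x₀ : M) : IsOpen (chartAt (Euc n) x₀ '' domAt n m E x₀) :=
  isOpen_image_chart (isOpen_domAt x₀) (domAt_subset x₀)

theorem contDiffOn_locRep [IsManifold (𝓡 n) ∞ M] [ContMDiffVectorBundle ∞ (Euc m) E (𝓡 n)]
    (x₀ : M) (σ : Sec n m E) :
    ContDiffOn ℝ ∞ (locRep x₀ σ) (chartAt (Euc n) x₀ '' domAt n m E x₀) := by
  have h : ContMDiffOn (𝓡 n) 𝓘(ℝ, Euc m) ∞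
      (fun x => (trivializationAt (Euc m) E x₀ ⟨x, σ x⟩).2)
      (trivializationAt (Euc m) E x₀).baseSet :=
    (trivializationAt (Euc m) E x₀).contMDiffOn_section_baseSet_iff.mp
      (fun x _ => (σ.contMDiff x).contMDiffWithinAt)
  rw [image_domAt]
  exact (h.comp_chart_symm x₀).mono (inter_subset_inter_right _ fun x hx => hx.2)

end JetCoordinates

/-! ### Total derivatives -/

section TotalDerivative

open Set Topology

variable {n m : ℕ} {M : Type*} [TopologicalSpace M] [ChartedSpace (Euc n) M]
  [IsManifold (𝓡 n) ∞ M]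
  {E : M → Type*} [∀ x, AddCommGroup (E x)] [∀ x, Module ℝ (E x)] [∀ x, TopologicalSpace (E x)]
  [TopologicalSpace (Bundle.TotalSpace (Euc m) E)] [FiberBundle (Euc m) E]
  [VectorBundle ℝ (Euc m) E] [ContMDiffVectorBundle ∞ (Euc m) E (𝓡 n)]

/-- Forgetting the derivative of the highest order. -/
def Derivs.trunc {k : ℕ} (u : Derivs n m (k + 1)) : Derivs n m k := fun j => u j.castSucc

theorem Derivs.contDiff_trunc {k : ℕ} : ContDiff ℝ ∞ (Derivs.trunc : Derivs n m (k + 1) → _) :=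
  contDiff_pi.mpr fun j => (ContinuousLinearMap.proj (R := ℝ)
    (φ := fun j : Fin (k + 1 + 1) => (Euc n [×(j : ℕ)]→L[ℝ] Euc m)) j.castSucc).contDiff

theorem exists_jet_eq (θ : JetSpace n m E) : ∃ x σ, θ = jet x σ :=
  ⟨θ.out.1, θ.out.2, (Quotient.out_eq θ).symm⟩

theorem contDiffAt_locRep {x₀ x : M} (hx : x ∈ domAt n m E x₀) (σ : Sec n m E) :
    ContDiffAt ℝ ∞ (locRep x₀ σ) (chartAt (Euc n) x₀ x) :=
  (contDiffOn_locRep x₀ σ).contDiffAt ((isOpen_image_domAt x₀).mem_nhds (mem_image_of_mem _ hx))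

/-- The chain rule along the jet of a section: differentiating the derivatives of order at most `k`
in the direction `v` produces `shift v` of those of order at most `k + 1`. This is the coordinate
formula for total derivatives. -/
theorem hasFDerivAt_jetFn {F : Type*} [NormedAddCommGroup F] [NormedSpace ℝ F] {k : ℕ} {x₀ x : M}
    (hx : x ∈ domAt n m E x₀) (σ : Sec n m E) {g : Euc n × Derivs n m k → F}
    (hg : DifferentiableAt ℝ g (chartAt (Euc n) x₀ x, derivsAt k x₀ x σ)) {h : M → F}
    (hh : ∀ᶠ y in 𝓝 x, h y = g (chartAt (Euc n) x₀ y, derivsAt k x₀ y σ)) :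
    DifferentiableAt ℝ (h ∘ (chartAt (Euc n) x₀).symm) (chartAt (Euc n) x₀ x) ∧
    ∀ v, fderiv ℝ (h ∘ (chartAt (Euc n) x₀).symm) (chartAt (Euc n) x₀ x) v =
      fderiv ℝ g (chartAt (Euc n) x₀ x, derivsAt k x₀ x σ)
        (v, (derivsAt (k + 1) x₀ x σ).shift v) := by
  obtain ⟨f', hf', hv⟩ := hasFDerivAt_derivs (contDiffAt_locRep hx σ) k
  have hxs := domAt_subset x₀ hx
  have h1 : HasFDerivAt (fun z => g (z, derivs k (locRep x₀ σ) z))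
      ((fderiv ℝ g (chartAt (Euc n) x₀ x, derivsAt k x₀ x σ)).comp
        ((ContinuousLinearMap.id ℝ _).prod f')) (chartAt (Euc n) x₀ x) :=
    hg.hasFDerivAt.comp (chartAt (Euc n) x₀ x) ((hasFDerivAt_id _).prodMk hf')
  have h2 : (h ∘ (chartAt (Euc n) x₀).symm) =ᶠ[𝓝 (chartAt (Euc n) x₀ x)]
      fun z => g (z, derivs k (locRep x₀ σ) z) := by
    have ht := (chartAt (Euc n) x₀).continuousAt_symm ((chartAt (Euc n) x₀).map_source hxs)
    rw [ContinuousAt, (chartAt (Euc n) x₀).left_inv hxs] at ht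
    filter_upwards [ht.eventually hh, (chartAt (Euc n) x₀).open_target.mem_nhds
      ((chartAt (Euc n) x₀).map_source hxs)] with z hz hz'
    simp only [Function.comp_apply, hz, derivsAt_eq, (chartAt (Euc n) x₀).right_inv hz']
  have h3 := h1.congr_of_eventuallyEq h2
  refine ⟨h3.differentiableAt, fun v => ?_⟩
  rw [h3.fderiv]
  simp [hv, derivsAt_eq]

theorem mfderiv_jetFn {F : Type*} [NormedAddCommGroup F] [NormedSpace ℝ F] {k : ℕ} {x₀ x : M}
    (hx : x ∈ domAt n m E x₀) (σ : Sec n m E) {g : Euc n × Derivs n m k → F}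
    (hg : DifferentiableAt ℝ g (chartAt (Euc n) x₀ x, derivsAt k x₀ x σ)) {h : M → F}
    (hh : ∀ᶠ y in 𝓝 x, h y = g (chartAt (Euc n) x₀ y, derivsAt k x₀ y σ))
    (ξ : TangentSpace (𝓡 n) x) :
    mfderiv (𝓡 n) 𝓘(ℝ, F) h x ξ = fderiv ℝ g (chartAt (Euc n) x₀ x, derivsAt k x₀ x σ)
      (chartDeriv x₀ x ξ, (derivsAt (k + 1) x₀ x σ).shift (chartDeriv x₀ x ξ)) := by
  obtain ⟨h1, h2⟩ := hasFDerivAt_jetFn hx σ hg hh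
  rw [mfderiv_eq_fderiv_chart (domAt_subset x₀ hx) h1, h2]

theorem differentiableAt_of_contDiffOn_jetFn {F : Type*} [NormedAddCommGroup F] [NormedSpace ℝ F]
    {k : ℕ} {x₀ x : M} {s : Set M} (hs : IsOpen s) (hs' : s ⊆ (chartAt (Euc n) x₀).source)
    (hx : x ∈ s) {g : Euc n × Derivs n m k → F}
    (hg : ContDiffOn ℝ ∞ g ((chartAt (Euc n) x₀ '' s) ×ˢ univ)) (u : Derivs n m k) :
    DifferentiableAt ℝ g (chartAt (Euc n) x₀ x, u) :=
  (hg.contDiffAt (((isOpen_image_chart hs hs').prod isOpen_univ).mem_nhds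
    ⟨mem_image_of_mem _ hx, trivial⟩)).differentiableAt (by simp)

/-- In coordinates the derivative involves only the derivatives of the section at `x`, hence only
its jet. This makes `totalDeriv` independent of the chosen representative. -/
theorem mfderiv_jet_congr {H : JetSpace n m E → ℝ} (hH : IsSmoothJetFn H) {x : M}
    {σ τ : Sec n m E} (h : jet x σ = jet x τ) (ξ : TangentSpace (𝓡 n) x) :
    mfderiv (𝓡 n) 𝓘(ℝ, ℝ) (fun y => H (jet y σ)) x ξ =
      mfderiv (𝓡 n) 𝓘(ℝ, ℝ) (fun y => H (jet y τ)) x ξ := by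
  obtain ⟨k, hk⟩ := hH
  obtain ⟨g, hg, hgH⟩ := hk x
  have hx : x ∈ domAt n m E x := mem_domAt x
  have key : ∀ σ : Sec n m E, _ := fun σ => mfderiv_jetFn hx σ
    (differentiableAt_of_contDiffOn_jetFn (isOpen_domAt x) (domAt_subset x) hx hg _)
    (h := fun y => H (jet y σ))
    (Filter.mem_of_superset ((isOpen_domAt x).mem_nhds hx) fun y hy => hgH y hy σ) ξ
  have h' : ∀ k, derivsAt k x x σ = derivsAt k x x τ := (Quotient.exact h).2
  rw [key σ, key τ, h', h']

/-- Only the chart at `x₀`, not the trivialization, is assumed to be defined at `x`.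
Differentiability is therefore checked in the coordinates at `x` and then transferred to that chart.
-/
theorem mdifferentiableAt_jetFn {H : JetSpace n m E → ℝ} (hH : IsSmoothJetFn H) {x₀ x : M}
    (hx : x ∈ (chartAt (Euc n) x₀).source) (σ : Sec n m E) :
    DifferentiableAt ℝ ((fun y => H (jet y σ)) ∘ (chartAt (Euc n) x₀).symm)
      (chartAt (Euc n) x₀ x) := by
  obtain ⟨k, hk⟩ := hH
  obtain ⟨g, hg, hgH⟩ := hk x
  have hx' : x ∈ domAt n m E x := mem_domAt x
  obtain ⟨h1, -⟩ := hasFDerivAt_jetFn hx' σ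
    (differentiableAt_of_contDiffOn_jetFn (isOpen_domAt x) (domAt_subset x) hx' hg _)
    (h := fun y => H (jet y σ))
    (Filter.mem_of_superset ((isOpen_domAt x).mem_nhds hx') fun y hy => hgH y hy σ)
  have h2 : MDifferentiableAt (𝓡 n) 𝓘(ℝ, ℝ) (fun y => H (jet y σ)) x := by
    refine MDifferentiableAt.congr_of_eventuallyEq ?_
      (eventuallyEq_comp_chart (mem_chart_source (Euc n) x) _)
    exact h1.mdifferentiableAt.comp x
      (mdifferentiableAt_atlas (chart_mem_atlas _ _) (mem_chart_source (Euc n) x))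
  rw [← mdifferentiableAt_iff_differentiableAt]
  have h3 := (chartAt (Euc n) x₀).left_inv hx
  refine MDifferentiableAt.comp _ (by rwa [h3]) ?_
  exact mdifferentiableAt_atlas_symm (chart_mem_atlas _ _) ((chartAt (Euc n) x₀).map_source hx)

/-- Smooth vector fields. -/
def IsSmoothField (ξ : ∀ x : M, TangentSpace (𝓡 n) x) : Prop :=
  ∀ x₀ : M, ContDiffOn ℝ ∞ (fun z => chartDeriv x₀ ((chartAt (Euc n) x₀).symm z)
    (ξ ((chartAt (Euc n) x₀).symm z))) (chartAt (Euc n) x₀).target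

/-- The total derivative along a vector field. -/
def totalDeriv (ξ : ∀ x : M, TangentSpace (𝓡 n) x) (H : JetSpace n m E → ℝ) :
    JetSpace n m E → ℝ := fun θ =>
  mfderiv (𝓡 n) 𝓘(ℝ, ℝ) (fun y => H (jet y θ.out.2)) θ.out.1 (ξ θ.out.1)

theorem totalDeriv_jet (ξ : ∀ x : M, TangentSpace (𝓡 n) x) {H : JetSpace n m E → ℝ}
    (hH : IsSmoothJetFn H) (x : M) (σ : Sec n m E) :
    totalDeriv ξ H (jet x σ) = mfderiv (𝓡 n) 𝓘(ℝ, ℝ) (fun y => H (jet y σ)) x (ξ x) := by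
  have h1 : jet (jet x σ).out.1 (jet x σ).out.2 = jet x σ := Quotient.out_eq _
  have h2 : (jet x σ).out.1 = x := (Quotient.exact h1).1
  unfold totalDeriv
  generalize (jet x σ).out = a at h1 h2
  obtain ⟨y, τ⟩ := a
  obtain rfl : y = x := h2
  exact mfderiv_jet_congr hH h1 _

/-- A total derivative raises the order by one: its coordinate expression is the derivative of `g`
at the truncated jet in the direction `(V, shift V)`. -/
theorem IsSmoothJetFn.totalDeriv {ξ : ∀ x : M, TangentSpace (𝓡 n) x} (hξ : IsSmoothField ξ)
    {H : JetSpace n m E → ℝ} (hH : IsSmoothJetFn H) : IsSmoothJetFn (totalDeriv ξ H) := by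
  have hH' := hH
  obtain ⟨k, hk⟩ := hH
  refine ⟨k + 1, fun x₀ => ?_⟩
  obtain ⟨g, hg, hgH⟩ := hk x₀
  let V : Euc n → Euc n := fun z => chartDeriv x₀ ((chartAt (Euc n) x₀).symm z)
    (ξ ((chartAt (Euc n) x₀).symm z))
  have hV : ContDiffOn ℝ ∞ V (chartAt (Euc n) x₀ '' domAt n m E x₀) := (hξ x₀).mono (by
    rw [image_domAt]; exact inter_subset_left)
  have hopen := (isOpen_image_domAt (n := n) (m := m) (E := E) x₀).prod
    (isOpen_univ (X := Derivs n m k))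
  refine ⟨fun w => fderiv ℝ g (w.1, w.2.trunc) (V w.1, w.2.shift (V w.1)), ?_, ?_⟩
  · have h1 : ContDiffOn ℝ ∞ (fderiv ℝ g) ((chartAt (Euc n) x₀ '' domAt n m E x₀) ×ˢ univ) :=
      hg.fderiv_of_isOpen hopen (by simp)
    have h2 : ContDiffOn ℝ ∞ (fun w : Euc n × Derivs n m (k + 1) => fderiv ℝ g (w.1, w.2.trunc))
        ((chartAt (Euc n) x₀ '' domAt n m E x₀) ×ˢ univ) :=
      h1.comp (contDiff_fst.prodMk (Derivs.contDiff_trunc.comp contDiff_snd)).contDiffOn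
        fun w hw => ⟨hw.1, trivial⟩
    have h3 : ContDiffOn ℝ ∞ (fun w : Euc n × Derivs n m (k + 1) => V w.1)
        ((chartAt (Euc n) x₀ '' domAt n m E x₀) ×ˢ univ) :=
      hV.comp contDiff_fst.contDiffOn fun w hw => hw.1
    exact h2.clm_apply (h3.prodMk (Derivs.contDiff_shift.comp_contDiffOn
      (contDiff_snd.contDiffOn.prodMk h3)))
  · intro x hx σ
    rw [totalDeriv_jet ξ hH', mfderiv_jetFn hx σ
      (differentiableAt_of_contDiffOn_jetFn (isOpen_domAt x₀) (domAt_subset x₀) hx hg _)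
      (Filter.mem_of_superset ((isOpen_domAt x₀).mem_nhds hx) fun y hy => hgH y hy σ)]
    have hVx : V (chartAt (Euc n) x₀ x) = chartDeriv x₀ x (ξ x) := by
      have : ∀ y, y = x → chartDeriv x₀ y (ξ y) = chartDeriv x₀ x (ξ x) := by
        rintro _ rfl
        rfl
      exact this _ ((chartAt (Euc n) x₀).left_inv (domAt_subset x₀ hx))
    dsimp only
    rw [hVx]
    rfl

end TotalDerivative

/-! ### Tangency of the Cartan planes to the equation -/

section Equation

open Set Topology

variable {n m l : ℕ} {M : Type*} [TopologicalSpace M] [ChartedSpace (Euc n) M]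
  [IsManifold (𝓡 n) ∞ M]
  {E : M → Type*} [∀ x, AddCommGroup (E x)] [∀ x, Module ℝ (E x)] [∀ x, TopologicalSpace (E x)]
  [TopologicalSpace (Bundle.TotalSpace (Euc m) E)] [FiberBundle (Euc m) E]
  [VectorBundle ℝ (Euc m) E] [ContMDiffVectorBundle ∞ (Euc m) E (𝓡 n)]
  {Z : M → Type*} [∀ x, AddCommGroup (Z x)] [∀ x, Module ℝ (Z x)] [∀ x, TopologicalSpace (Z x)]
  [TopologicalSpace (Bundle.TotalSpace (Euc l) Z)] [FiberBundle (Euc l) Z]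
  [VectorBundle ℝ (Euc l) Z] [ContMDiffVectorBundle ∞ (Euc l) Z (𝓡 n)]

/-- By regularity `H = Δ(F)`. In the product rule one term contains the derivatives of `Fτ` at `x`
and the other those of one order higher; all of them vanish on the prolongation. -/
theorem DiffEq.mfderiv_eq_zero (𝓔 : DiffEq n m l E Z) {H : JetSpace n m E → ℝ}
    (hH : IsSmoothJetFn H) (h0 : ∀ θ ∈ prolongation 𝓔.op, H θ = 0) {x : M} {σ : Sec n m E}
    (hσ : jet x σ ∈ prolongation 𝓔.op) (ξ : TangentSpace (𝓡 n) x) :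
    mfderiv (𝓡 n) 𝓘(ℝ, ℝ) (fun y => H (jet y σ)) x ξ = 0 := by
  obtain ⟨y, τ, hτ, hd⟩ := hσ
  obtain rfl : x = y := (Quotient.exact hτ).1
  -- The section `σ` is exchanged for the representative `τ`, for which the derivatives of `F τ` at
  -- the point are known to vanish.
  rw [mfderiv_jet_congr hH hτ]
  obtain ⟨k, hk⟩ := (𝓔.regular H hH).mp h0
  obtain ⟨Δ, hΔ, hΔH⟩ := hk x
  have hxE : x ∈ domAt n m E x := mem_domAt x
  have hxZ : x ∈ domAt n l Z x := mem_domAt x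
  have hopen : IsOpen (domAt n m E x ∩ domAt n l Z x) := (isOpen_domAt x).inter (isOpen_domAt x)
  have hnhds := hopen.mem_nhds ⟨hxE, hxZ⟩
  obtain ⟨h1, -⟩ := hasFDerivAt_jetFn hxE τ (h := fun y => Δ (chartAt (Euc n) x y, derivsAt k x y τ))
    (differentiableAt_of_contDiffOn_jetFn hopen (fun y hy => hy.1.1) ⟨hxE, hxZ⟩ hΔ _)
    (Filter.Eventually.of_forall fun _ => rfl)
  obtain ⟨f', hf', hv⟩ := hasFDerivAt_derivs (contDiffAt_locRep hxZ (𝓔.op τ)) k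
  have hxs := mem_chart_source (Euc n) x
  have h2 : (fun y => H (jet y τ)) ∘ (chartAt (Euc n) x).symm =ᶠ[𝓝 (chartAt (Euc n) x x)]
      fun z => ((fun y => Δ (chartAt (Euc n) x y, derivsAt k x y τ)) ∘ (chartAt (Euc n) x).symm) z
        (derivs k (locRep x (𝓔.op τ)) z) := by
    have ht := (chartAt (Euc n) x).continuousAt_symm ((chartAt (Euc n) x).map_source hxs)
    rw [ContinuousAt, (chartAt (Euc n) x).left_inv hxs] at ht
    filter_upwards [ht.eventually hnhds, (chartAt (Euc n) x).open_target.mem_nhds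
      ((chartAt (Euc n) x).map_source hxs)] with z hz hz'
    simp only [Function.comp_apply, hΔH _ hz, derivsAt_eq, (chartAt (Euc n) x).right_inv hz']
  have h3 := (h1.hasFDerivAt.clm_apply hf').congr_of_eventuallyEq h2
  rw [mfderiv_eq_fderiv_chart hxs h3.differentiableAt, h3.fderiv]
  have h4 : derivs k (locRep x (𝓔.op τ)) (chartAt (Euc n) x x) = 0 := hd k
  have h5 : derivs (k + 1) (locRep x (𝓔.op τ)) (chartAt (Euc n) x x) = 0 := hd (k + 1)
  have h6 : ∀ v : Euc n, (0 : Derivs n l (k + 1)).shift v = 0 := fun v => by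
    funext j
    rfl
  rw [add_apply, ContinuousLinearMap.comp_apply, hv, h4, h5, h6, map_zero, map_zero, zero_apply,
    add_zero]
  rfl

end Equation

/-! ### Frames of the Cartan distribution -/

section Glue

open Set Topology PaintedPartition

variable {n : ℕ} {M : Type*} [TopologicalSpace M] [ChartedSpace (Euc n) M]
  [IsManifold (𝓡 n) ∞ M] {U : M → Set M} (P : PaintedPartition n U)

attribute [instance] PaintedPartition.fintype

namespace PaintedPartition

/-- The base point of the coordinates used at `x` for the colour `c`. -/
def center (c : P.κ) (x : M) : M := P.p c (P.idx c x)

variable {P} in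
theorem tsupport_χ_subset (c : P.κ) : tsupport (P.χ c) ⊆ tsupport (P.b c) := fun x hx =>
  subset_tsupport _ (by
    rw [Function.mem_support, (P.b_eventuallyEq_one c x hx).self_of_nhds]
    exact one_ne_zero)

/-- Near a point of the support of `w` the index is constant, so the product is a multiple of a
single `G i`; away from the support it is zero. -/
theorem contMDiffOn_glue {F : Type*} [NormedAddCommGroup F] [NormedSpace ℝ F] (c : P.κ)
    (hUo : ∀ x, IsOpen (U x)) {w : M → ℝ} (hw : ContMDiff (𝓡 n) 𝓘(ℝ, ℝ) ∞ w)
    (hwb : tsupport w ⊆ tsupport (P.b c)) {s : Set M} (hs : IsOpen s) {G : P.ι → M → F}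
    (hG : ∀ i, ContMDiffOn (𝓡 n) 𝓘(ℝ, F) ∞ (G i) (s ∩ U (P.p c i))) :
    ContMDiffOn (𝓡 n) 𝓘(ℝ, F) ∞ (fun x => w x • G (P.idx c x) x) s := by
  intro x hx
  refine ContMDiffAt.contMDiffWithinAt ?_
  by_cases hxw : x ∈ tsupport w
  · have hxU := P.mem_U c x (hwb hxw)
    have h1 : ContMDiffAt (𝓡 n) 𝓘(ℝ, F) ∞ (fun y => w y • G (P.idx c x) y) x :=
      (hw x).smul (((hG _) x ⟨hx, hxU⟩).contMDiffAt ((hs.inter (hUo _)).mem_nhds ⟨hx, hxU⟩))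
    refine h1.congr_of_eventuallyEq ?_
    filter_upwards [P.idx_eventuallyEq c x (hwb hxw)] with y hy
    rw [hy]
  · refine (contMDiffAt_const (c := (0 : F))).congr_of_eventuallyEq ?_
    filter_upwards [(isClosed_tsupport w).isOpen_compl.mem_nhds hxw] with y hy
    rw [image_eq_zero_of_notMem_tsupport hy, zero_smul]

open Classical in
/-- The vector field that is the multiple `w` of a constant vector field in the coordinates used for
the colour `c`. -/
def field (c : P.κ) (w : M → ℝ) (v : Euc n) (x : M) : TangentSpace (𝓡 n) x :=
  if h : x ∈ (chartAt (Euc n) (P.center c x)).source then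
    w x • (chartDeriv_surjective h v).choose else 0

theorem chartDeriv_field (c : P.κ) (w : M → ℝ) (v : Euc n) {x : M}
    (hx : x ∈ (chartAt (Euc n) (P.center c x)).source) :
    chartDeriv (P.center c x) x (P.field c w v x) = w x • v := by
  rw [field, dif_pos hx, map_smul, (chartDeriv_surjective hx v).choose_spec]

theorem field_eq_zero {c : P.κ} {w : M → ℝ} {v : Euc n} {x : M} (hx : w x = 0) :
    P.field c w v x = 0 := by
  rw [field]
  split_ifs
  · rw [hx, zero_smul]
  · rfl

theorem mem_source_center (hUs : ∀ x, U x ⊆ (chartAt (Euc n) x).source) (c : P.κ) {x : M}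
    (hx : x ∈ tsupport (P.b c)) : x ∈ (chartAt (Euc n) (P.center c x)).source :=
  hUs _ (P.mem_U c x hx)

/-- Seen in the chart at `x₀`, the field is `w` times the derivative of the transition map applied
to `v`, an expression to which gluing applies. -/
theorem isSmoothField_field (hUo : ∀ x, IsOpen (U x)) (hUs : ∀ x, U x ⊆ (chartAt (Euc n) x).source)
    (c : P.κ) {w : M → ℝ} (hw : ContMDiff (𝓡 n) 𝓘(ℝ, ℝ) ∞ w)
    (hwb : tsupport w ⊆ tsupport (P.b c)) (v : Euc n) : IsSmoothField (P.field c w v) := by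
  intro x₀
  let T : P.ι → Euc n → Euc n := fun i =>
    chartAt (Euc n) x₀ ∘ (chartAt (Euc n) (P.p c i)).symm
  have hT : ∀ i, ContDiffOn ℝ ∞ (T i) ((chartAt (Euc n) (P.p c i)).target ∩
      (chartAt (Euc n) (P.p c i)).symm ⁻¹' (chartAt (Euc n) x₀).source) := fun i =>
    (contMDiffOn_chart (I := 𝓡 n)).comp_chart_symm (P.p c i)
  have hopen : ∀ i, IsOpen ((chartAt (Euc n) (P.p c i)).target ∩
      (chartAt (Euc n) (P.p c i)).symm ⁻¹' (chartAt (Euc n) x₀).source) := fun i =>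
    (chartAt (Euc n) (P.p c i)).isOpen_inter_preimage_symm (chartAt (Euc n) x₀).open_source
  have hmem : ∀ i, ∀ y ∈ (chartAt (Euc n) x₀).source ∩ U (P.p c i), chartAt (Euc n) (P.p c i) y ∈
      (chartAt (Euc n) (P.p c i)).target ∩
      (chartAt (Euc n) (P.p c i)).symm ⁻¹' (chartAt (Euc n) x₀).source := fun i y hy => by
    refine ⟨(chartAt (Euc n) (P.p c i)).map_source (hUs _ hy.2), ?_⟩
    rw [mem_preimage, (chartAt (Euc n) (P.p c i)).left_inv (hUs _ hy.2)]
    exact hy.1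
  have key := P.contMDiffOn_glue c hUo hw hwb (chartAt (Euc n) x₀).open_source
    (G := fun i y => fderiv ℝ (T i) (chartAt (Euc n) (P.p c i) y) v) fun i => by
      have h1 : ContDiffOn ℝ ∞ (fun z => fderiv ℝ (T i) z v) _ :=
        ((hT i).fderiv_of_isOpen (hopen i) (m := ∞) (by simp)).clm_apply contDiffOn_const
      exact h1.contMDiffOn.comp ((contMDiffOn_chart (I := 𝓡 n)).mono fun y hy => hUs _ hy.2)
        (hmem i)
  refine ((key.comp_chart_symm x₀).congr fun z hz => ?_).mono fun z hz =>
    ⟨hz, (chartAt (Euc n) x₀).map_target hz⟩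
  simp only [Function.comp_apply]
  have hy : (chartAt (Euc n) x₀).symm z ∈ (chartAt (Euc n) x₀).source := hz.2
  generalize (chartAt (Euc n) x₀).symm z = y at hy
  by_cases hyw : y ∈ tsupport w
  · have hyU := P.mem_U c y (hwb hyw)
    have h2 := mfderiv_eq_fderiv_chart (hUs _ hyU) (h := chartAt (Euc n) x₀)
      (((hT _).contDiffAt ((hopen _).mem_nhds (hmem _ y ⟨hy, hyU⟩))).differentiableAt (by simp))
      (P.field c w v y)
    refine h2.trans ?_
    have h3 := P.chartDeriv_field c w v (hUs _ hyU)
    rw [center] at h3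
    rw [h3, map_smul]
  · have h0 := image_eq_zero_of_notMem_tsupport hyw
    rw [P.field_eq_zero h0, h0, zero_smul, map_zero]

end PaintedPartition

end Glue

/-! ### Total derivatives on an equation and finite frames -/

section Frame

open Set Topology PaintedPartition

variable {n m l : ℕ} {M : Type*} [TopologicalSpace M] [ChartedSpace (Euc n) M]
  [IsManifold (𝓡 n) ∞ M]
  {E : M → Type*} [∀ x, AddCommGroup (E x)] [∀ x, Module ℝ (E x)] [∀ x, TopologicalSpace (E x)]
  [TopologicalSpace (Bundle.TotalSpace (Euc m) E)] [FiberBundle (Euc m) E]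
  [VectorBundle ℝ (Euc m) E] [ContMDiffVectorBundle ∞ (Euc m) E (𝓡 n)]
  {Z : M → Type*} [∀ x, AddCommGroup (Z x)] [∀ x, Module ℝ (Z x)] [∀ x, TopologicalSpace (Z x)]
  [TopologicalSpace (Bundle.TotalSpace (Euc l) Z)] [FiberBundle (Euc l) Z]
  [VectorBundle ℝ (Euc l) Z] [ContMDiffVectorBundle ∞ (Euc l) Z (𝓡 n)]

/-- The projection of the jet space onto the base. -/
def JetSpace.base (θ : JetSpace n m E) : M := θ.out.1

theorem JetSpace.base_jet (x : M) (σ : Sec n m E) : (jet x σ).base = x :=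
  (Quotient.exact (Quotient.out_eq (jet x σ))).1

theorem isSmoothJetFn_base {a : M → ℝ} (ha : ContMDiff (𝓡 n) 𝓘(ℝ, ℝ) ∞ a) :
    IsSmoothJetFn fun θ : JetSpace n m E => a θ.base := by
  refine ⟨0, fun x₀ => ⟨fun w => a ((chartAt (Euc n) x₀).symm w.1), ?_, fun x hx σ => ?_⟩⟩
  · refine ContDiffOn.comp (g := a ∘ (chartAt (Euc n) x₀).symm)
      (ha.contMDiffOn (s := univ).comp_chart_symm x₀) contDiff_fst.contDiffOn fun w hw => ⟨?_, trivial⟩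
    have := hw.1
    rw [image_domAt] at this
    exact this.1
  · simp only [JetSpace.base_jet, (chartAt (Euc n) x₀).left_inv (domAt_subset x₀ hx)]

namespace DiffEq

variable (𝓔 : DiffEq n m l E Z)

theorem exists_eq_restr (a : 𝓔.smoothFns.Fn) : ∃ H hH, a = 𝓔.restr H hH := by
  obtain ⟨a, H, hH, h⟩ := a
  exact ⟨H, hH, Subtype.ext (funext h)⟩

/-- The total derivative of functions on the equation. -/
def fieldDeriv {ξ : ∀ x : M, TangentSpace (𝓡 n) x} (hξ : IsSmoothField ξ) (a : 𝓔.smoothFns.Fn) :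
    𝓔.smoothFns.Fn :=
  𝓔.restr (totalDeriv ξ (𝓔.exists_eq_restr a).choose)
    ((𝓔.exists_eq_restr a).choose_spec.choose.totalDeriv hξ)

/-- The difference vanishes on the equation, so tangency applies. Total derivatives thus act on
restrictions, regardless of the extension chosen. -/
theorem mfderiv_restr_congr {H K : JetSpace n m E → ℝ} (hH : IsSmoothJetFn H)
    (hK : IsSmoothJetFn K) (h : 𝓔.restr H hH = 𝓔.restr K hK) {x : M} {σ : Sec n m E}
    (hσ : jet x σ ∈ prolongation 𝓔.op) (ξ : TangentSpace (𝓡 n) x) :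
    mfderiv (𝓡 n) 𝓘(ℝ, ℝ) (fun y => H (jet y σ)) x ξ =
      mfderiv (𝓡 n) 𝓘(ℝ, ℝ) (fun y => K (jet y σ)) x ξ := by
  have hsub : IsSmoothJetFn fun θ : JetSpace n m E => H θ - K θ := by
    refine IsSmoothJetFn.comp (fun z : Fin 2 → ℝ => z 0 - z 1) (by fun_prop) ![H, K] ?_
    intro i; fin_cases i <;> assumption
  have h0 := 𝓔.mfderiv_eq_zero hsub (fun θ hθ => sub_eq_zero.mpr
    (congrFun (congrArg Subtype.val h) ⟨θ, hθ⟩)) hσ ξ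
  have hx := mem_chart_source (Euc n) x
  have h1 := mdifferentiableAt_jetFn hH hx σ
  have h2 := mdifferentiableAt_jetFn hK hx σ
  have h3 : ((fun y => H (jet y σ) - K (jet y σ)) ∘ (chartAt (Euc n) x).symm) =
      ((fun y => H (jet y σ)) ∘ (chartAt (Euc n) x).symm) -
        ((fun y => K (jet y σ)) ∘ (chartAt (Euc n) x).symm) := rfl
  rw [mfderiv_eq_fderiv_chart hx (by rw [h3]; exact h1.sub h2), h3, fderiv_sub h1 h2] at h0
  rw [mfderiv_eq_fderiv_chart hx h1, mfderiv_eq_fderiv_chart hx h2]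
  exact sub_eq_zero.mp h0

theorem fieldDeriv_apply {ξ : ∀ x : M, TangentSpace (𝓡 n) x} (hξ : IsSmoothField ξ)
    {H : JetSpace n m E → ℝ} (hH : IsSmoothJetFn H) (ρ : 𝓔.Pts) {x : M} {σ : Sec n m E}
    (hρ : (ρ : JetSpace n m E) = jet x σ) :
    (𝓔.fieldDeriv hξ (𝓔.restr H hH) : 𝓔.Pts → ℝ) ρ =
      mfderiv (𝓡 n) 𝓘(ℝ, ℝ) (fun y => H (jet y σ)) x (ξ x) := by
  have hs := (𝓔.exists_eq_restr (𝓔.restr H hH)).choose_spec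
  obtain ⟨hK, hs'⟩ := hs
  change totalDeriv ξ _ (ρ : JetSpace n m E) = _
  rw [hρ, totalDeriv_jet ξ hK]
  exact (𝓔.mfderiv_restr_congr hH hK hs' (hρ ▸ ρ.2) _).symm

theorem exists_mem_plane {ξ : ∀ x : M, TangentSpace (𝓡 n) x} (hξ : IsSmoothField ξ) (ρ : 𝓔.Pts) :
    ∃ v ∈ 𝓔.cartan.plane ρ, ∀ a, v a = (𝓔.fieldDeriv hξ a : 𝓔.Pts → ℝ) ρ := by
  obtain ⟨x, σ, hρ⟩ := exists_jet_eq (ρ : JetSpace n m E)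
  have hx := mem_chart_source (Euc n) x
  refine ⟨{ toFun := fun a => (𝓔.fieldDeriv hξ a : 𝓔.Pts → ℝ) ρ, map_add' := ?_, map_smul' := ?_ },
    ⟨x, σ, ξ x, hρ, fun H hH => 𝓔.fieldDeriv_apply hξ hH ρ hρ⟩, fun a => rfl⟩
  · intro a b
    obtain ⟨H, hH, rfl⟩ := 𝓔.exists_eq_restr a
    obtain ⟨K, hK, rfl⟩ := 𝓔.exists_eq_restr b
    have hadd : IsSmoothJetFn fun θ : JetSpace n m E => H θ + K θ := by
      refine IsSmoothJetFn.comp (fun z : Fin 2 → ℝ => z 0 + z 1) (by fun_prop) ![H, K] ?_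
      intro i; fin_cases i <;> assumption
    have h1 := mdifferentiableAt_jetFn hH hx σ
    have h2 := mdifferentiableAt_jetFn hK hx σ
    have h3 : ((fun y => H (jet y σ) + K (jet y σ)) ∘ (chartAt (Euc n) x).symm) =
        ((fun y => H (jet y σ)) ∘ (chartAt (Euc n) x).symm) +
          ((fun y => K (jet y σ)) ∘ (chartAt (Euc n) x).symm) := rfl
    change (𝓔.fieldDeriv hξ (𝓔.restr _ hadd) : 𝓔.Pts → ℝ) ρ = _
    rw [𝓔.fieldDeriv_apply hξ hadd ρ hρ, 𝓔.fieldDeriv_apply hξ hH ρ hρ,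
      𝓔.fieldDeriv_apply hξ hK ρ hρ,
      mfderiv_eq_fderiv_chart hx (by rw [h3]; exact h1.add h2), h3, fderiv_add h1 h2,
      mfderiv_eq_fderiv_chart hx h1, mfderiv_eq_fderiv_chart hx h2]
    rfl
  · intro r a
    obtain ⟨H, hH, rfl⟩ := 𝓔.exists_eq_restr a
    have hsmul : IsSmoothJetFn fun θ : JetSpace n m E => r * H θ :=
      IsSmoothJetFn.comp (fun z : Fin 1 → ℝ => r * z 0) (by fun_prop) (fun _ => H) fun _ => hH
    have h1 := mdifferentiableAt_jetFn hH hx σ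
    have h3 : ((fun y => r * H (jet y σ)) ∘ (chartAt (Euc n) x).symm) =
        r • ((fun y => H (jet y σ)) ∘ (chartAt (Euc n) x).symm) := rfl
    change (𝓔.fieldDeriv hξ (𝓔.restr _ hsmul) : 𝓔.Pts → ℝ) ρ = _
    rw [𝓔.fieldDeriv_apply hξ hsmul ρ hρ, 𝓔.fieldDeriv_apply hξ hH ρ hρ,
      mfderiv_eq_fderiv_chart hx (by rw [h3]; exact h1.const_smul r), h3, fderiv_const_smul h1,
      mfderiv_eq_fderiv_chart hx h1]
    rfl

theorem isDerivative_cartan : 𝓔.cartan.IsDerivative := by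
  rintro ρ v ⟨x, σ, ξ, hρ, hv⟩ L β hβ b
  choose H hH hb using fun i => 𝓔.exists_eq_restr (b i)
  obtain rfl : b = fun i => 𝓔.restr (H i) (hH i) := funext hb
  have hx := mem_chart_source (Euc n) x
  have h1 := fun i => mdifferentiableAt_jetFn (hH i) hx σ
  have h2 : HasFDerivAt ((fun y => β fun i => H i (jet y σ)) ∘ (chartAt (Euc n) x).symm)
      ((fderiv ℝ β fun i => H i (jet x σ)).comp (ContinuousLinearMap.pi fun i =>
        fderiv ℝ ((fun y => H i (jet y σ)) ∘ (chartAt (Euc n) x).symm) (chartAt (Euc n) x x)))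
      (chartAt (Euc n) x x) := by
    refine HasFDerivAt.comp (chartAt (Euc n) x x) (g := β) ?_
      (hasFDerivAt_pi.mpr fun i => (h1 i).hasFDerivAt)
    simp only [(chartAt (Euc n) x).left_inv hx]
    exact (hβ.differentiable (by simp) _).hasFDerivAt
  refine (hv _ (IsSmoothJetFn.comp β hβ H hH)).trans ?_
  rw [mfderiv_eq_fderiv_chart hx h2.differentiableAt, h2.fderiv]
  rw [ContinuousLinearMap.comp_apply, fderiv_apply_eq_sum_partialDeriv]
  refine Finset.sum_congr rfl fun i _ => ?_
  have e := (hv _ (hH i)).trans (mfderiv_eq_fderiv_chart hx (h1 i) ξ)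
  change _ = partialDeriv β i (fun i => H i (ρ : JetSpace n m E)) * v (𝓔.restr (H i) (hH i))
  rw [hρ]
  exact congrArg _ e.symm

/-- The Cartan distribution is spanned by finitely many total derivatives. -/
theorem exists_frame {U : M → Set M} (P : PaintedPartition n U) (hUo : ∀ x, IsOpen (U x))
    (hUs : ∀ x, U x ⊆ (chartAt (Euc n) x).source) : ∃ N, Nonempty (𝓔.cartan.Frame N) := by
  let e := Fintype.equivFin (P.κ × Fin n)
  -- Cut-off coordinates `b_c x^k`, which will be the functions `y_j` of the frame.
  let f : P.κ × Fin n → M → ℝ := fun j x =>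
    P.b j.1 x • chartAt (Euc n) (P.p j.1 (P.idx j.1 x)) x j.2
  have hf : ∀ j, ContMDiff (𝓡 n) 𝓘(ℝ, ℝ) ∞ (f j) := fun j => by
    rw [← contMDiffOn_univ]
    refine P.contMDiffOn_glue j.1 hUo (P.contMDiff_b j.1) le_rfl isOpen_univ
      (G := fun i x => chartAt (Euc n) (P.p j.1 i) x j.2) fun i => ?_
    have h1 : ContMDiffOn (𝓡 n) 𝓘(ℝ, Euc n) ∞ (chartAt (Euc n) (P.p j.1 i)) (univ ∩ U (P.p j.1 i)) :=
      (contMDiffOn_chart (I := 𝓡 n)).mono fun x hx => hUs _ hx.2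
    exact (EuclideanSpace.proj j.2 : Euc n →L[ℝ] ℝ).contMDiff.comp_contMDiffOn h1
  -- The fields `χ_c ∂_k`, whose total derivatives will be the `D_j`.
  let ξ : P.κ × Fin n → ∀ x : M, TangentSpace (𝓡 n) x := fun j =>
    P.field j.1 (P.χ j.1) (EuclideanSpace.single j.2 1)
  have hξ : ∀ j, IsSmoothField (ξ j) := fun j =>
    P.isSmoothField_field hUo hUs j.1 (P.contMDiff_χ j.1) (P.tsupport_χ_subset j.1) _
  refine ⟨_, ⟨{
    y := fun j => 𝓔.restr _ (isSmoothJetFn_base (hf (e.symm j)))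
    D := fun j => 𝓔.fieldDeriv (hξ (e.symm j))
    mem_plane := fun j ρ => 𝓔.exists_mem_plane (hξ (e.symm j)) ρ
    eq_sum := ?_ }⟩⟩
  rintro ρ v ⟨x, σ, η, hρ, hv⟩ a
  obtain ⟨H, hH, rfl⟩ := 𝓔.exists_eq_restr a
  let dd : (M → ℝ) → TangentSpace (𝓡 n) x → ℝ := fun h ζ => mfderiv (𝓡 n) 𝓘(ℝ, ℝ) h x ζ
  have hdd : ∀ (h : M → ℝ) (p : M), x ∈ (chartAt (Euc n) p).source →
      DifferentiableAt ℝ (h ∘ (chartAt (Euc n) p).symm) (chartAt (Euc n) p x) → ∀ ζ,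
      dd h ζ = fderiv ℝ (h ∘ (chartAt (Euc n) p).symm) (chartAt (Euc n) p x) (chartDeriv p x ζ) :=
    fun h p hp hh ζ => mfderiv_eq_fderiv_chart hp hh ζ
  have hD : ∀ j, (𝓔.fieldDeriv (hξ j) (𝓔.restr H hH) : 𝓔.Pts → ℝ) ρ =
      dd (fun y => H (jet y σ)) (ξ j x) := fun j => 𝓔.fieldDeriv_apply (hξ j) hH ρ hρ
  have hy : ∀ j, v (𝓔.restr _ (isSmoothJetFn_base (hf j))) = dd (f j) η := by
    intro j
    refine (hv _ (isSmoothJetFn_base (hf j))).trans ?_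
    have e : (fun y => f j (jet y σ).base) = f j := funext fun y => by rw [JetSpace.base_jet]
    exact congrArg (fun h => dd h η) e
  refine (hv H hH).trans ?_
  refine Eq.trans ?_ (e.symm.sum_comp fun j => (𝓔.fieldDeriv (hξ j) (𝓔.restr H hH) : 𝓔.Pts → ℝ) ρ *
    v (𝓔.restr _ (isSmoothJetFn_base (hf j)))).symm
  refine Eq.trans ?_ (Finset.sum_congr rfl fun j _ => congrArg₂ _ (hD j) (hy j)).symm
  rw [Fintype.sum_prod_type]
  change dd (fun y => H (jet y σ)) η = _
  -- On the support of `χ_c` the cutoff is locally one, so `f (c, k)` is a genuine coordinate and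
  -- the sum over `k` is the coordinate expression of the derivative along `η`, times `χ_c`. Summing
  -- over colours removes the weights.
  have key : ∀ c, ∑ k, dd (fun y => H (jet y σ)) (ξ (c, k) x) * dd (f (c, k)) η =
      P.χ c x * dd (fun y => H (jet y σ)) η := by
    intro c
    by_cases hx : x ∈ tsupport (P.χ c)
    · have hxb := P.tsupport_χ_subset c hx
      have hxs := P.mem_source_center hUs c hxb
      have h1 := mdifferentiableAt_jetFn hH hxs σ
      have h2 : ∀ k, dd (f (c, k)) η = chartDeriv (P.center c x) x η k := by
        intro k
        have h3 : f (c, k) =ᶠ[𝓝 x] fun y => chartAt (Euc n) (P.center c x) y k := by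
          filter_upwards [P.b_eventuallyEq_one c x hx, P.idx_eventuallyEq c x hxb] with y hy hy'
          simp only [f, hy, hy', one_smul, PaintedPartition.center]
        have h4 : (fun y => chartAt (Euc n) (P.center c x) y k) ∘
            (chartAt (Euc n) (P.center c x)).symm =ᶠ[𝓝 (chartAt (Euc n) (P.center c x) x)]
            (EuclideanSpace.proj k : Euc n →L[ℝ] ℝ) := by
          filter_upwards [(chartAt (Euc n) (P.center c x)).open_target.mem_nhds
            ((chartAt (Euc n) (P.center c x)).map_source hxs)] with z hz
          simp [(chartAt (Euc n) (P.center c x)).right_inv hz]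
        have h5 := (EuclideanSpace.proj k : Euc n →L[ℝ] ℝ).hasFDerivAt
          (x := chartAt (Euc n) (P.center c x) x) |>.congr_of_eventuallyEq h4
        have h6 : dd (f (c, k)) η = dd (fun y => chartAt (Euc n) (P.center c x) y k) η :=
          congrArg (fun L : TangentSpace (𝓡 n) x →L[ℝ] ℝ => L η) h3.mfderiv_eq
        rw [h6, hdd _ _ hxs h5.differentiableAt, h5.fderiv]
        rfl
      have h6 : ∀ k, dd (fun y => H (jet y σ)) (ξ (c, k) x) = P.χ c x *
          fderiv ℝ ((fun y => H (jet y σ)) ∘ (chartAt (Euc n) (P.center c x)).symm)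
            (chartAt (Euc n) (P.center c x) x) (EuclideanSpace.single k 1) := by
        intro k
        rw [hdd _ _ hxs h1, P.chartDeriv_field c _ _ hxs, map_smul, smul_eq_mul]
      have h7 : chartDeriv (P.center c x) x η =
          ∑ k, chartDeriv (P.center c x) x η k • EuclideanSpace.single k (1 : ℝ) := by
        ext i
        simp [Finset.sum_apply, Pi.single_apply]
      simp only [h2, h6]
      rw [hdd _ _ hxs h1]
      conv_rhs => rw [h7, map_sum, Finset.mul_sum]
      refine Finset.sum_congr rfl fun k _ => ?_
      rw [map_smul, smul_eq_mul]
      ring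
    · have h0 := image_eq_zero_of_notMem_tsupport hx
      rw [h0, zero_mul]
      refine Finset.sum_eq_zero fun k _ => ?_
      have h8 : ξ (c, k) x = 0 := P.field_eq_zero h0
      have h9 : dd (fun y => H (jet y σ)) 0 = 0 := map_zero _
      rw [h8, h9, zero_mul]
  simp only [key]
  rw [← Finset.sum_mul, P.sum_χ, one_mul]

end DiffEq

end Frame

/-! ### Global coordinate functions on the jet space -/

section JetComponents

open Set Topology

variable {n m : ℕ} {M : Type*} [TopologicalSpace M] [ChartedSpace (Euc n) M]
  [IsManifold (𝓡 n) ∞ M]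
  {E : M → Type*} [∀ x, AddCommGroup (E x)] [∀ x, Module ℝ (E x)] [∀ x, TopologicalSpace (E x)]
  [TopologicalSpace (Bundle.TotalSpace (Euc m) E)] [FiberBundle (Euc m) E]
  [VectorBundle ℝ (Euc m) E] [ContMDiffVectorBundle ∞ (Euc m) E (𝓡 n)]
  {U : M → Set M} (P : PaintedPartition n U)

theorem locRep_chart {x₀ x : M} (hx : x ∈ (chartAt (Euc n) x₀).source) (σ : Sec n m E) :
    locRep x₀ σ (chartAt (Euc n) x₀ x) = (trivializationAt (Euc m) E x₀ ⟨x, σ x⟩).2 := by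
  rw [locRep, (chartAt (Euc n) x₀).left_inv hx]

theorem eq_of_jet_eq {x : M} {σ τ : Sec n m E} (h : jet x σ = jet x τ) : σ x = τ x := by
  have h1 := congrFun ((Quotient.exact h).2 0) 0
  have h2 := congrArg (fun f => f Fin.elim0) h1
  change iteratedFDeriv ℝ 0 (locRep x σ) (chartAt (Euc n) x x) Fin.elim0 =
    iteratedFDeriv ℝ 0 (locRep x τ) (chartAt (Euc n) x x) Fin.elim0 at h2
  rw [iteratedFDeriv_zero_apply, iteratedFDeriv_zero_apply, locRep_chart (mem_chart_source _ x),
    locRep_chart (mem_chart_source _ x)] at h2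
  exact ((trivializationAt (Euc m) E x).continuousLinearEquivAt ℝ x
    (FiberBundle.mem_baseSet_trivializationAt' x)).injective h2

theorem trivialization_snd_eq {e e' : Bundle.Trivialization (Euc m) (Bundle.TotalSpace.proj : _ → M)}
    [MemTrivializationAtlas (E := E) e] [MemTrivializationAtlas (E := E) e'] {x : M}
    (hx : x ∈ e.baseSet ∩ e'.baseSet) (v : E x) :
    (e' ⟨x, v⟩).2 = e.coordChangeL ℝ e' x (e ⟨x, v⟩).2 := by
  rw [e.coordChangeL_apply e' hx, e.symm_apply_apply_mk hx.1]

namespace PaintedPartition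

/-- The coordinates along the fibre of the value of a section, multiplied by the cutoff function. -/
def fibreFn (c : P.κ) (r : Fin m) (θ : JetSpace n m E) : ℝ :=
  P.b c θ.base * (trivializationAt (Euc m) E (P.center c θ.base) ⟨θ.base, θ.out.2 θ.base⟩).2 r

theorem fibreFn_jet (c : P.κ) (r : Fin m) (x : M) (σ : Sec n m E) :
    P.fibreFn c r (jet x σ) =
      P.b c x * (trivializationAt (Euc m) E (P.center c x) ⟨x, σ x⟩).2 r := by
  have h1 : jet (jet x σ).out.1 (jet x σ).out.2 = jet x σ := Quotient.out_eq _
  have h2 : (jet x σ).out.1 = x := (Quotient.exact h1).1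
  unfold fibreFn JetSpace.base
  generalize (jet x σ).out = a at h1 h2
  obtain ⟨y, τ⟩ := a
  obtain rfl : y = x := h2
  simp only [eq_of_jet_eq h1]

/-- In the trivialization at `x₀` the function is a component of the value of the section
transformed by the coordinate change of the bundle; the coordinate changes for the various pieces
are glued with the cutoff. -/
theorem isSmoothJetFn_fibreFn (hUo : ∀ x, IsOpen (U x)) (hUd : ∀ x, U x ⊆ domAt n m E x) (c : P.κ)
    (r : Fin m) : IsSmoothJetFn (P.fibreFn c r : JetSpace n m E → ℝ) := by
  refine ⟨0, fun x₀ => ?_⟩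
  let C : P.ι → M → Euc m →L[ℝ] Euc m := fun i x => ((trivializationAt (Euc m) E x₀).coordChangeL ℝ
    (trivializationAt (Euc m) E (P.p c i)) x : Euc m →L[ℝ] Euc m)
  have hC := P.contMDiffOn_glue c hUo (P.contMDiff_b c) le_rfl (isOpen_domAt (n := n) (m := m) (E := E) x₀)
    (G := C) fun i => (contMDiffOn_coordChangeL (IB := 𝓡 n) (n := ∞)
      (trivializationAt (Euc m) E x₀) (trivializationAt (Euc m) E (P.p c i))).mono
      fun x hx => ⟨hx.1.2, (hUd _ hx.2).2⟩
  have hC' := hC.comp_chart_symm x₀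
  rw [← image_domAt] at hC'
  refine ⟨fun w => (P.b c ((chartAt (Euc n) x₀).symm w.1) •
    C (P.idx c ((chartAt (Euc n) x₀).symm w.1)) ((chartAt (Euc n) x₀).symm w.1))
      (w.2 0 Fin.elim0) r, ?_, fun x hx σ => ?_⟩
  · have h1 : ContDiffOn ℝ ∞ (fun w : Euc n × Derivs n m 0 =>
        (P.b c ((chartAt (Euc n) x₀).symm w.1) •
          C (P.idx c ((chartAt (Euc n) x₀).symm w.1)) ((chartAt (Euc n) x₀).symm w.1)))
        ((chartAt (Euc n) x₀ '' domAt n m E x₀) ×ˢ univ) :=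
      hC'.comp contDiff_fst.contDiffOn fun w hw => hw.1
    have h2 : ContDiff ℝ ∞ (fun w : Euc n × Derivs n m 0 => w.2 0 Fin.elim0) :=
      (ContinuousMultilinearMap.apply ℝ (fun _ : Fin ((0 : Fin 1) : ℕ) => Euc n) (Euc m)
        Fin.elim0).contDiff.comp ((ContinuousLinearMap.proj (R := ℝ)
        (φ := fun j : Fin (0 + 1) => (Euc n [×(j : ℕ)]→L[ℝ] Euc m)) 0).contDiff.comp contDiff_snd)
    exact (EuclideanSpace.proj r : Euc m →L[ℝ] ℝ).contDiff.comp_contDiffOn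
      (h1.clm_apply h2.contDiffOn)
  · have h0 : derivsAt 0 x₀ x σ 0 Fin.elim0 = (trivializationAt (Euc m) E x₀ ⟨x, σ x⟩).2 := by
      rw [← locRep_chart hx.1]
      exact iteratedFDeriv_zero_apply _
    simp only [fibreFn_jet, (chartAt (Euc n) x₀).left_inv hx.1, h0]
    by_cases hb : x ∈ tsupport (P.b c)
    · have hxU := (hUd _ (P.mem_U c x hb)).2
      simp only [C, center]
      rw [trivialization_snd_eq (e := trivializationAt (Euc m) E x₀) ⟨hx.2, hxU⟩]
      simp
    · rw [image_eq_zero_of_notMem_tsupport hb]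
      simp

/-- The iterated total derivatives of the coordinates along the fibre. -/
def jetComp (c : P.κ) (r : Fin m) : (j : ℕ) → (Fin j → Fin n) → JetSpace n m E → ℝ
  | 0, _ => P.fibreFn c r
  | j + 1, I => totalDeriv (P.field c (P.b c) (EuclideanSpace.single (I 0) 1))
      (jetComp c r j (Fin.tail I))

theorem isSmoothJetFn_jetComp (hUo : ∀ x, IsOpen (U x)) (hUd : ∀ x, U x ⊆ domAt n m E x) (c : P.κ)
    (r : Fin m) : ∀ (j : ℕ) (I : Fin j → Fin n),
      IsSmoothJetFn (P.jetComp c r j I : JetSpace n m E → ℝ)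
  | 0, _ => P.isSmoothJetFn_fibreFn hUo hUd c r
  | j + 1, I => IsSmoothJetFn.totalDeriv
      (P.isSmoothField_field hUo (fun x => (hUd x).trans (domAt_subset x)) c (P.contMDiff_b c) le_rfl _)
      (isSmoothJetFn_jetComp hUo hUd c r j (Fin.tail I))

/-- Where the cutoff is one in a neighbourhood, the fields are coordinate fields and the centre is
locally constant, so iterated total derivatives are iterated partial derivatives. The induction step
differentiates, which is why `b = 1` is assumed near `x` and not only at `x`. -/
theorem jetComp_jet (hUo : ∀ x, IsOpen (U x)) (hUd : ∀ x, U x ⊆ domAt n m E x) (c : P.κ)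
    (r : Fin m) (σ : Sec n m E) : ∀ (j : ℕ) (I : Fin j → Fin n) (x : M),
      (∀ᶠ y in 𝓝 x, P.b c y = 1) → P.jetComp c r j I (jet x σ) =
        iteratedFDeriv ℝ j (locRep (P.center c x) σ) (chartAt (Euc n) (P.center c x) x)
          (fun i => EuclideanSpace.single (I i) 1) r := by
  have hUs : ∀ x, U x ⊆ (chartAt (Euc n) x).source := fun x => (hUd x).trans (domAt_subset x)
  have hmem : ∀ x, (∀ᶠ y in 𝓝 x, P.b c y = 1) → x ∈ tsupport (P.b c) := fun x hx =>
    subset_tsupport _ (by rw [Function.mem_support, hx.self_of_nhds]; exact one_ne_zero)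
  intro j
  induction j with
  | zero =>
    intro I x hx
    have hxs := P.mem_source_center hUs c (hmem x hx)
    rw [iteratedFDeriv_zero_apply, locRep_chart hxs, jetComp, fibreFn_jet, hx.self_of_nhds, one_mul]
  | succ j ih =>
    intro I x hx
    have hxb := hmem x hx
    have hxs := P.mem_source_center hUs c hxb
    have hxd : x ∈ domAt n m E (P.center c x) := hUd _ (P.mem_U c x hxb)
    have hH := P.isSmoothJetFn_jetComp (E := E) hUo hUd c r j (Fin.tail I)
    have hev : ∀ᶠ y in 𝓝 x, y ∈ (chartAt (Euc n) (P.center c x)).source ∧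
        P.jetComp c r j (Fin.tail I) (jet y σ) =
        iteratedFDeriv ℝ j (locRep (P.center c x) σ) (chartAt (Euc n) (P.center c x) y)
          (fun i => EuclideanSpace.single (I i.succ) 1) r := by
      filter_upwards [eventually_eventually_nhds.mpr hx, P.idx_eventuallyEq c x hxb,
        (chartAt (Euc n) (P.center c x)).open_source.mem_nhds hxs] with y hy hy' hys
      have hc : P.center c y = P.center c x := by rw [center, hy', center]
      rw [ih (Fin.tail I) y hy, hc]
      exact ⟨hys, rfl⟩
    have hz := (chartAt (Euc n) (P.center c x)).map_source hxs
    have hdiff := ((contDiffAt_locRep hxd σ).differentiableAt_iteratedFDeriv (m := j)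
      (by exact_mod_cast WithTop.coe_lt_top _)).hasFDerivAt
    let A : (Euc n [×j]→L[ℝ] Euc m) →L[ℝ] ℝ := (EuclideanSpace.proj r : Euc m →L[ℝ] ℝ).comp
      (ContinuousMultilinearMap.apply ℝ (fun _ : Fin j => Euc n) (Euc m)
        fun i => EuclideanSpace.single (I i.succ) 1)
    have h2 := (A.hasFDerivAt.comp _ hdiff).congr_of_eventuallyEq
      (f₁ := (fun y => P.jetComp c r j (Fin.tail I) (jet y σ)) ∘
        (chartAt (Euc n) (P.center c x)).symm) (by
      have ht := (chartAt (Euc n) (P.center c x)).continuousAt_symm hz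
      rw [ContinuousAt, (chartAt (Euc n) (P.center c x)).left_inv hxs] at ht
      filter_upwards [ht.eventually hev,
        (chartAt (Euc n) (P.center c x)).open_target.mem_nhds hz] with z hz1 hz2
      rw [Function.comp_apply, hz1.2, (chartAt (Euc n) (P.center c x)).right_inv hz2]
      rfl)
    rw [jetComp, totalDeriv_jet _ hH, mfderiv_eq_fderiv_chart hxs h2.differentiableAt, h2.fderiv,
      P.chartDeriv_field c _ _ hxs, hx.self_of_nhds, one_smul, iteratedFDeriv_succ_apply_left]
    rfl

end PaintedPartition

/-- The components of derivatives with respect to the coordinate vectors. -/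
def Derivs.components {k : ℕ} (u : Derivs n m k) (j : Fin (k + 1)) (I : Fin j → Fin n) (r : Fin m) :
    ℝ :=
  u j (fun i => EuclideanSpace.single (I i) 1) r

/-- Multilinear maps are determined by their values on basis vectors, so the components embed
linearly. A linear left inverse is defined on all arrays of numbers, also on those that come from no
multilinear map, and so can enter a globally smooth formula. -/
theorem Derivs.exists_leftInverse_components (n m k : ℕ) :
    ∃ R : ((j : Fin (k + 1)) → (Fin j → Fin n) → Fin m → ℝ) →L[ℝ] Derivs n m k,
      ∀ u : Derivs n m k, R u.components = u := by
  let T : Derivs n m k →ₗ[ℝ] ((j : Fin (k + 1)) → (Fin j → Fin n) → Fin m → ℝ) :=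
    { toFun := Derivs.components
      map_add' := fun u v => rfl
      map_smul' := fun a u => rfl }
  have hT : LinearMap.ker T = ⊥ := by
    rw [LinearMap.ker_eq_bot]
    intro u v h
    funext j
    apply ContinuousMultilinearMap.toMultilinearMap_injective
    refine Module.Basis.ext_multilinear
      (fun _ => (EuclideanSpace.basisFun (Fin n) ℝ).toBasis) fun I => ?_
    ext r
    have : u.components j I r = v.components j I r := congrFun (congrFun (congrFun h j) I) r
    simpa [Derivs.components] using this
  obtain ⟨R, hR⟩ := T.exists_leftInverse_of_injective hT
  exact ⟨LinearMap.toContinuousLinearMap R, fun u => DFunLike.congr_fun hR u⟩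

end JetComponents

/-! ### Smooth functions on the cylinder over an equation -/

theorem SmoothAlgebra.isCylFn_of_fintype {X J : Type*} [Fintype J] (A : SmoothAlgebra X)
    (a : J → A.Fn) {Γ : ℝ × (J → ℝ) → ℝ} (hΓ : ContDiff ℝ ∞ Γ) {c : X × ℝ → ℝ}
    (hc : ∀ ρ t, c (ρ, t) = Γ (t, fun j => (a j : X → ℝ) ρ)) : A.IsCylFn c := by
  let e := Fintype.equivFin J
  refine ⟨Fintype.card J, fun i => a (e.symm i), fun z => Γ (z 0, fun j => z (e j).succ), ?_, ?_⟩
  · exact hΓ.comp ((contDiff_apply ℝ ℝ 0).prodMk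
      (contDiff_pi.mpr fun j => contDiff_apply ℝ ℝ (e j).succ))
  · intro ρ t
    simp [hc]

/-- A smooth function that is one at zero and zero at all other integers. -/
def integerBump (s : ℝ) : ℝ := Real.smoothTransition (2 - 2 * s ^ 2)

theorem contDiff_integerBump : ContDiff ℝ ∞ integerBump :=
  Real.smoothTransition.contDiff.comp (by fun_prop)

theorem integerBump_zero : integerBump 0 = 1 :=
  Real.smoothTransition.one_of_one_le (by norm_num)

theorem integerBump_eq_zero {s : ℝ} (hs : 1 ≤ |s|) : integerBump s = 0 :=
  Real.smoothTransition.zero_of_nonpos (by nlinarith [sq_abs s])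

/-! ### From functions in charts to one smooth function -/

section Interpolation

open Set Topology

variable {ι V : Type*} [NormedAddCommGroup V] [NormedSpace ℝ V]

/-- Countably many smooth functions are the restrictions of one smooth function to the hyperplanes
with integral first coordinate. -/
theorem exists_contDiff_interpolation {enc : ι → ℕ} (henc : Function.Injective enc)
    {G : ι → V → ℝ} (hG : ∀ i, ContDiff ℝ ∞ (G i)) :
    ∃ γ : ℝ × V → ℝ, ContDiff ℝ ∞ γ ∧ ∀ i v, γ (enc i, v) = G i v := by
  -- The sum is locally finite because only finitely many codes lie within distance one of a bounded
  -- interval; at the code of `i` every other bump vanishes.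
  refine ⟨fun w => ∑ᶠ i, integerBump (w.1 - enc i) * G i w.2, ?_, fun i v => ?_⟩
  · rw [← contMDiff_iff_contDiff]
    refine contMDiff_finsum (fun i => ?_) ?_
    · rw [contMDiff_iff_contDiff]
      exact (contDiff_integerBump.comp (contDiff_fst.sub contDiff_const)).mul
        ((hG i).comp contDiff_snd)
    · intro w
      refine ⟨Prod.fst ⁻¹' Metric.ball w.1 1, continuous_fst.continuousAt.preimage_mem_nhds
        (Metric.ball_mem_nhds _ one_pos), ?_⟩
      obtain ⟨L, hL⟩ := exists_nat_gt (w.1 + 2)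
      refine ((finite_Iio L).preimage henc.injOn).subset ?_
      rintro i ⟨z, hz, hz'⟩
      have h1 : ¬ 1 ≤ |z.1 - enc i| := fun h => hz (by simp [integerBump_eq_zero h])
      rw [not_le, abs_lt] at h1
      rw [mem_preimage, Metric.mem_ball, Real.dist_eq, abs_lt] at hz'
      have : (enc i : ℝ) < L := by linarith [h1.1, hz'.2]
      exact_mod_cast this
  · dsimp only
    rw [finsum_eq_single _ i]
    · simp [integerBump_zero]
    · intro j hj
      have h1 : (1 : ℤ) ≤ |(enc i : ℤ) - enc j| :=
        Int.one_le_abs (sub_ne_zero.mpr fun h => hj (henc (by exact_mod_cast h.symm)))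
      have h2 : (1 : ℝ) ≤ |(enc i : ℝ) - enc j| := by exact_mod_cast h1
      simp [integerBump_eq_zero h2]

variable {n m : ℕ} {M : Type*} [TopologicalSpace M] [ChartedSpace (Euc n) M]
  [IsManifold (𝓡 n) ∞ M] {U : M → Set M} (P : PaintedPartition n U)

/-- Functions given in charts are restrictions of one smooth function. -/
theorem PaintedPartition.exists_contDiff_global {V : Type*} [NormedAddCommGroup V]
    [NormedSpace ℝ V] (c : P.κ) {D : M → Set M} (hD : ∀ x, IsOpen (D x))
    (hDs : ∀ x, D x ⊆ (chartAt (Euc n) x).source) (hUD : ∀ x, U x ⊆ D x) {g : M → Euc n × V → ℝ}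
    (hg : ∀ x₀, ContDiffOn ℝ ∞ (g x₀) ((chartAt (Euc n) x₀ '' D x₀) ×ˢ univ)) :
    ∃ γ : ℝ × Euc n × V → ℝ, ContDiff ℝ ∞ γ ∧ ∀ x, P.b c x = 1 → ∀ v,
      γ (P.enc (P.idx c x), chartAt (Euc n) (P.center c x) x, v) =
        g (P.center c x) (chartAt (Euc n) (P.center c x) x, v) := by
  classical
  let K : P.ι → Set M := fun i => {x | x ∈ tsupport (P.b c) ∧ P.idx c x = i}
  have hKD : ∀ i, K i ⊆ D (P.p c i) := by
    rintro i x ⟨hx, rfl⟩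
    exact hUD _ (P.mem_U c x hx)
  let φ : P.ι → OpenPartialHomeomorph M (Euc n) := fun i => chartAt (Euc n) (P.p c i)
  have hKs : ∀ i, K i ⊆ (φ i).source := fun i => (hKD i).trans (hDs _)
  have hKc : ∀ i, IsClosed (φ i '' K i) := fun i =>
    ((P.isCompact c i).image_of_continuousOn ((φ i).continuousOn.mono (hKs i))).isClosed
  -- The cutoff restricted to the piece with index `i` and extended by zero. Compactness of the
  -- piece makes its image closed in the whole coordinate space, so `B i` times the chart function
  -- is smooth everywhere.
  let B : P.ι → Euc n → ℝ := fun i z => if z ∈ φ i '' K i then P.b c ((φ i).symm z) else 0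
  have hG : ∀ i, ContDiff ℝ ∞ fun w : Euc n × V => B i w.1 * g (P.p c i) w := by
    intro i
    rw [contDiff_iff_contDiffAt]
    rintro ⟨z, v⟩
    by_cases hz : z ∈ φ i '' K i
    · obtain ⟨x, hx, rfl⟩ := hz
      have hzt := (φ i).map_source (hKs i hx)
      have h1 : ContDiffOn ℝ ∞ (P.b c ∘ (φ i).symm) ((φ i).target ∩ (φ i).symm ⁻¹' univ) :=
        (P.contMDiff_b c).contMDiffOn.comp_chart_symm (P.p c i)
      have h2 : ContDiffAt ℝ ∞ (P.b c ∘ (φ i).symm) (φ i x) :=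
        h1.contDiffAt (Filter.inter_mem ((φ i).open_target.mem_nhds hzt) Filter.univ_mem)
      have h3 : B i =ᶠ[𝓝 (φ i x)] P.b c ∘ (φ i).symm := by
        have ht := (φ i).continuousAt_symm hzt
        rw [ContinuousAt, (φ i).left_inv (hKs i hx)] at ht
        filter_upwards [ht.eventually (P.idx_eventuallyEq c x hx.1),
          (φ i).open_target.mem_nhds hzt] with z hz hz'
        simp only [B, Function.comp_apply]
        split_ifs with h
        · rfl
        · by_contra hne
          exact h ⟨(φ i).symm z, ⟨subset_tsupport _ (Ne.symm hne), hz.trans hx.2⟩,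
            (φ i).right_inv hz'⟩
      have h4 : ContDiffAt ℝ ∞ (g (P.p c i)) (φ i x, v) := (hg _).contDiffAt
        (((isOpen_image_chart (hD _) (hDs _)).prod isOpen_univ).mem_nhds
          ⟨mem_image_of_mem _ (hKD i hx), trivial⟩)
      exact (ContDiffAt.comp (φ i x, v) (h2.congr_of_eventuallyEq h3) contDiffAt_fst).mul h4
    · refine (contDiffAt_const (c := (0 : ℝ))).congr_of_eventuallyEq ?_
      filter_upwards [((hKc i).isOpen_compl.preimage continuous_fst).mem_nhds
        (show (z, v) ∈ Prod.fst ⁻¹' (φ i '' K i)ᶜ from hz)] with w hw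
      simp only [B]
      rw [if_neg hw, zero_mul]
  obtain ⟨γ, hγ, hγG⟩ := exists_contDiff_interpolation P.enc_injective hG
  refine ⟨γ, hγ, fun x hx v => ?_⟩
  have hxb : x ∈ tsupport (P.b c) := subset_tsupport _ (by
    rw [Function.mem_support, hx]
    exact one_ne_zero)
  have hxK : x ∈ K (P.idx c x) := ⟨hxb, rfl⟩
  rw [hγG]
  have hB : B (P.idx c x) (chartAt (Euc n) (P.center c x) x) = 1 := by
    refine (if_pos (show φ (P.idx c x) x ∈ φ (P.idx c x) '' K (P.idx c x) from
      mem_image_of_mem _ hxK)).trans ?_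
    change P.b c ((φ (P.idx c x)).symm (φ (P.idx c x) x)) = 1
    rw [(φ _).left_inv (hKs _ hxK), hx]
  simp only [hB, one_mul]
  rfl

end Interpolation

/-! ### Factorization of functions on the cylinder and conclusion -/

section Cylinder

open Set Topology

variable {n m l : ℕ} {M : Type*} [TopologicalSpace M] [ChartedSpace (Euc n) M]
  [IsManifold (𝓡 n) ∞ M]
  {E : M → Type*} [∀ x, AddCommGroup (E x)] [∀ x, Module ℝ (E x)] [∀ x, TopologicalSpace (E x)]
  [TopologicalSpace (Bundle.TotalSpace (Euc m) E)] [FiberBundle (Euc m) E]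
  [VectorBundle ℝ (Euc m) E] [ContMDiffVectorBundle ∞ (Euc m) E (𝓡 n)]

/-- A reparametrization of the line by the unit interval. -/
def smoothTime (t : ℝ) : unitInterval :=
  ⟨Real.smoothTransition t, Real.smoothTransition.nonneg t, Real.smoothTransition.le_one t⟩

theorem smoothTime_zero : smoothTime 0 = 0 := Subtype.ext Real.smoothTransition.zero

theorem smoothTime_one : smoothTime 1 = 1 := Subtype.ext Real.smoothTransition.one

/-- Smooth functions on `J^∞ × [0, 1]` are smooth functions of the time and of finitely many smooth
functions on `J^∞`. -/
theorem IsSmoothJetFnI.exists_factorization {U : M → Set M} (P : PaintedPartition n U)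
    (hUo : ∀ x, IsOpen (U x)) (hUd : ∀ x, U x ⊆ domAt n m E x)
    {H : JetSpace n m E → unitInterval → ℝ} (hH : IsSmoothJetFnI H) :
    ∃ (J : Type) (_ : Fintype J) (a : J → JetSpace n m E → ℝ) (Γ : ℝ × (J → ℝ) → ℝ),
      (∀ j, IsSmoothJetFn (a j)) ∧ ContDiff ℝ ∞ Γ ∧
      ∀ θ t, H θ (smoothTime t) = Γ (t, fun j => a j θ) := by
  obtain ⟨k, hk⟩ := hH
  choose g hg hgH using hk
  have hUs : ∀ x, U x ⊆ (chartAt (Euc n) x).source := fun x => (hUd x).trans (domAt_subset x)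
  -- Smoothness in the time is given only on the closed interval; composition with the smooth
  -- transition, which takes values there, gives a function smooth for all real times.
  have hg' : ∀ x₀, ContDiffOn ℝ ∞ (fun w : Euc n × Derivs n m k × ℝ =>
      g x₀ ((w.1, w.2.1), Real.smoothTransition w.2.2))
      ((chartAt (Euc n) x₀ '' domAt n m E x₀) ×ˢ univ) := fun x₀ =>
    (hg x₀).comp (((contDiff_fst.prodMk (contDiff_fst.comp contDiff_snd)).prodMk
      (Real.smoothTransition.contDiff.comp (contDiff_snd.comp contDiff_snd))).contDiffOn)
      fun w hw => ⟨⟨hw.1, trivial⟩, Real.smoothTransition.nonneg _, Real.smoothTransition.le_one _⟩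
  choose γ hγ hγg using fun c => P.exists_contDiff_global c
    (fun x => isOpen_domAt (n := n) (m := m) (E := E) x) domAt_subset hUd hg'
  obtain ⟨R, hR⟩ := Derivs.exists_leftInverse_components n m k
  -- For each colour: the partition function and the cut-off code of the piece (the two Boolean
  -- values), the cut-off coordinates, and the jet components.
  let J := P.κ × (Bool ⊕ Fin n ⊕ (Σ j : Fin (k + 1), (Fin j → Fin n) × Fin m))
  let f : P.κ → Bool ⊕ Fin n → M → ℝ := fun c => Sum.elim
    (fun s => if s then P.χ c else fun x => P.b c x • (P.enc (P.idx c x) : ℝ))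
    (fun i x => P.b c x • chartAt (Euc n) (P.p c (P.idx c x)) x i)
  have hf : ∀ c s, ContMDiff (𝓡 n) 𝓘(ℝ, ℝ) ∞ (f c s) := by
    rintro c ((_ | _) | i)
    · rw [← contMDiffOn_univ]
      exact P.contMDiffOn_glue c hUo (P.contMDiff_b c) le_rfl isOpen_univ
        (G := fun i _ => (P.enc i : ℝ)) fun i => contMDiffOn_const
    · exact P.contMDiff_χ c
    · rw [← contMDiffOn_univ]
      refine P.contMDiffOn_glue c hUo (P.contMDiff_b c) le_rfl isOpen_univ
        (G := fun j x => chartAt (Euc n) (P.p c j) x i) fun j => ?_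
      have h1 : ContMDiffOn (𝓡 n) 𝓘(ℝ, Euc n) ∞ (chartAt (Euc n) (P.p c j)) (univ ∩ U (P.p c j)) :=
        (contMDiffOn_chart (I := 𝓡 n)).mono fun x hx => hUs _ hx.2
      exact (EuclideanSpace.proj i : Euc n →L[ℝ] ℝ).contMDiff.comp_contMDiffOn h1
  let a : J → JetSpace n m E → ℝ := fun j => Sum.elim
    (fun s θ => f j.1 (Sum.inl s) θ.base)
    (Sum.elim (fun i θ => f j.1 (Sum.inr i) θ.base)
      (fun q => P.jetComp j.1 q.2.2 q.1 q.2.1)) j.2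
  -- Each colour recovers `H` from the code of the piece, the coordinates and the derivatives. This
  -- is correct on the support of `χ_c`; elsewhere the term is multiplied by zero.
  let Γ : ℝ × (J → ℝ) → ℝ := fun w => ∑ c, w.2 (c, Sum.inl true) *
    γ c (w.2 (c, Sum.inl false),
      (EuclideanSpace.equiv (Fin n) ℝ).symm (fun i => w.2 (c, Sum.inr (Sum.inl i))),
      R (fun j I r => w.2 (c, Sum.inr (Sum.inr ⟨j, I, r⟩))), w.1)
  refine ⟨J, inferInstance, a, Γ, ?_, ?_, fun θ t => ?_⟩
  · rintro ⟨c, s | i | q⟩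
    · exact isSmoothJetFn_base (hf c (Sum.inl s))
    · exact isSmoothJetFn_base (hf c (Sum.inr i))
    · exact P.isSmoothJetFn_jetComp hUo hUd c q.2.2 q.1 q.2.1
  · have hc : ∀ j : J, ContDiff ℝ ∞ fun w : ℝ × (J → ℝ) => w.2 j := fun j =>
      (contDiff_apply ℝ ℝ j).comp contDiff_snd
    refine ContDiff.sum fun c _ => (hc _).mul ((hγ c).comp ((hc _).prodMk (ContDiff.prodMk ?_
      (ContDiff.prodMk ?_ contDiff_fst))))
    · exact (EuclideanSpace.equiv (Fin n) ℝ).symm.contDiff.comp (contDiff_pi.mpr fun i => hc _)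
    · exact R.contDiff.comp (contDiff_pi.mpr fun j => contDiff_pi.mpr fun I =>
        contDiff_pi.mpr fun r => hc _)
  · obtain ⟨x, σ, rfl⟩ := exists_jet_eq θ
    have hterm : ∀ c, a (c, Sum.inl true) (jet x σ) *
        γ c (a (c, Sum.inl false) (jet x σ),
          (EuclideanSpace.equiv (Fin n) ℝ).symm (fun i => a (c, Sum.inr (Sum.inl i)) (jet x σ)),
          R (fun j I r => a (c, Sum.inr (Sum.inr ⟨j, I, r⟩)) (jet x σ)), t) =
        P.χ c x * H (jet x σ) (smoothTime t) := by
      intro c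
      have e1 : a (c, Sum.inl true) (jet x σ) = P.χ c x := by
        simp [a, f, JetSpace.base_jet]
      rw [e1]
      by_cases hx : x ∈ tsupport (P.χ c)
      · have hb := P.b_eventuallyEq_one c x hx
        have hxb := P.tsupport_χ_subset c hx
        have e2 : a (c, Sum.inl false) (jet x σ) = P.enc (P.idx c x) := by
          simp [a, f, JetSpace.base_jet, hb.self_of_nhds]
        have e3 : (EuclideanSpace.equiv (Fin n) ℝ).symm
            (fun i => a (c, Sum.inr (Sum.inl i)) (jet x σ)) = chartAt (Euc n) (P.center c x) x := by
          ext i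
          simp [a, f, JetSpace.base_jet, hb.self_of_nhds, PaintedPartition.center]
        have e4 : R (fun j I r => a (c, Sum.inr (Sum.inr ⟨j, I, r⟩)) (jet x σ)) =
            derivsAt k (P.center c x) x σ := by
          rw [← hR (derivsAt k (P.center c x) x σ)]
          congr 1
          funext j I r
          exact P.jetComp_jet hUo hUd c r σ j I x hb
        rw [e2, e3, e4, hγg c x hb.self_of_nhds]
        rw [hgH (P.center c x) x (hUd _ (P.mem_U c x hxb))]
        rfl
      · rw [image_eq_zero_of_notMem_tsupport hx, zero_mul, zero_mul]
    simp only [Γ, hterm]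
    rw [← Finset.sum_mul, P.sum_χ, one_mul]

variable {Z : M → Type*} [∀ x, AddCommGroup (Z x)] [∀ x, Module ℝ (Z x)]
  [∀ x, TopologicalSpace (Z x)] [TopologicalSpace (Bundle.TotalSpace (Euc l) Z)]
  [FiberBundle (Euc l) Z] [VectorBundle ℝ (Euc l) Z] [ContMDiffVectorBundle ∞ (Euc l) Z (𝓡 n)]

theorem DiffEq.isCylFn_of_isSmoothFnI (𝓔 : DiffEq n m l E Z) {U : M → Set M}
    (P : PaintedPartition n U) (hUo : ∀ x, IsOpen (U x)) (hUd : ∀ x, U x ⊆ domAt n m E x)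
    {h : 𝓔.Pts × unitInterval → ℝ} (hh : 𝓔.IsSmoothFnI h) :
    𝓔.smoothFns.IsCylFn fun w => h (w.1, smoothTime w.2) := by
  obtain ⟨H, hH, hHh⟩ := hh
  obtain ⟨J, hJ, a, Γ, ha, hΓ, hHΓ⟩ := hH.exists_factorization P hUo hUd
  exact 𝓔.smoothFns.isCylFn_of_fintype (fun j => 𝓔.restr (a j) (ha j)) hΓ fun ρ t => by
    rw [hHh, hHΓ]
    rfl

end Cylinder

/-- One painting of the first base by the coordinate domains provides both the frame of the Cartan
distribution and the factorization that makes the homotopy smooth on the cylinder; the abstract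
statement on Cartan spaces then applies. -/
theorem mainTheorem6
    {n₁ m₁ l₁ : ℕ}
    {M₁ : Type*} [TopologicalSpace M₁] [T2Space M₁] [SecondCountableTopology M₁]
    [ChartedSpace (Euc n₁) M₁] [IsManifold (𝓡 n₁) ∞ M₁]
    {E₁ : M₁ → Type*} [∀ x, AddCommGroup (E₁ x)] [∀ x, Module ℝ (E₁ x)]
    [∀ x, TopologicalSpace (E₁ x)] [TopologicalSpace (Bundle.TotalSpace (Euc m₁) E₁)]
    [FiberBundle (Euc m₁) E₁] [VectorBundle ℝ (Euc m₁) E₁]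
    [ContMDiffVectorBundle ∞ (Euc m₁) E₁ (𝓡 n₁)]
    {Z₁ : M₁ → Type*} [∀ x, AddCommGroup (Z₁ x)] [∀ x, Module ℝ (Z₁ x)]
    [∀ x, TopologicalSpace (Z₁ x)] [TopologicalSpace (Bundle.TotalSpace (Euc l₁) Z₁)]
    [FiberBundle (Euc l₁) Z₁] [VectorBundle ℝ (Euc l₁) Z₁]
    [ContMDiffVectorBundle ∞ (Euc l₁) Z₁ (𝓡 n₁)]
    {n₂ m₂ l₂ : ℕ}
    {M₂ : Type*} [TopologicalSpace M₂] [T2Space M₂] [SecondCountableTopology M₂]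
    [ChartedSpace (Euc n₂) M₂] [IsManifold (𝓡 n₂) ∞ M₂]
    {E₂ : M₂ → Type*} [∀ x, AddCommGroup (E₂ x)] [∀ x, Module ℝ (E₂ x)]
    [∀ x, TopologicalSpace (E₂ x)] [TopologicalSpace (Bundle.TotalSpace (Euc m₂) E₂)]
    [FiberBundle (Euc m₂) E₂] [VectorBundle ℝ (Euc m₂) E₂]
    [ContMDiffVectorBundle ∞ (Euc m₂) E₂ (𝓡 n₂)]
    {Z₂ : M₂ → Type*} [∀ x, AddCommGroup (Z₂ x)] [∀ x, Module ℝ (Z₂ x)]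
    [∀ x, TopologicalSpace (Z₂ x)] [TopologicalSpace (Bundle.TotalSpace (Euc l₂) Z₂)]
    [FiberBundle (Euc l₂) Z₂] [VectorBundle ℝ (Euc l₂) Z₂]
    [ContMDiffVectorBundle ∞ (Euc l₂) Z₂ (𝓡 n₂)]
    (𝓔₁ : DiffEq n₁ m₁ l₁ E₁ Z₁) (𝓔₂ : DiffEq n₂ m₂ l₂ E₂ Z₂)
    (f₀ f₁ : 𝓔₁.Pts → 𝓔₂.Pts)
    (hf₀ : IsDEMorphism 𝓔₁ 𝓔₂ f₀) (hf₁ : IsDEMorphism 𝓔₁ 𝓔₂ f₁)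
    (f : 𝓔₁.Pts × unitInterval → 𝓔₂.Pts) (hf : IsDEHomotopy 𝓔₁ 𝓔₂ f₀ f₁ f)
    (p q : ℤ) :
    hf₀.pageMap 2 p q = hf₁.pageMap 2 p q := by
  obtain ⟨P⟩ := exists_paintedPartition (n := n₁) (fun x : M₁ => domAt n₁ m₁ E₁ x) isOpen_domAt
    mem_domAt
  obtain ⟨N, ⟨Φ⟩⟩ := 𝓔₁.exists_frame P isOpen_domAt domAt_subset
  -- The homotopy extended to the whole line, constant before time `0` and after time `1`; its
  -- slices are still members of the original family and the endpoints are unchanged.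
  let F : 𝓔₁.Pts × ℝ → 𝓔₂.Pts := fun w => f (w.1, smoothTime w.2)
  have hF : IsSmoothMap 𝓔₁.cartan.fns.cyl 𝓔₂.cartan.fns F := fun b =>
    𝓔₁.isCylFn_of_isSmoothFnI P isOpen_domAt (fun x => le_rfl) (hf.smooth b)
  have hm : ∀ t, CartanSpace.IsDEMorphism 𝓔₁.cartan 𝓔₂.cartan fun ρ => F (ρ, t) := fun t =>
    hf.morphism (smoothTime t)
  have key := CartanSpace.pageMap_two_eq_of_homotopy hF Φ 𝓔₁.isDerivative_cartan hm p q
  have h0 : (fun ρ => F (ρ, 0)) = f₀ := funext fun ρ => by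
    simp only [F, smoothTime_zero, hf.zero]
  have h1 : (fun ρ => F (ρ, 1)) = f₁ := funext fun ρ => by
    simp only [F, smoothTime_one, hf.one]
  -- Once `f₀` and `f₁` are literally the end slices, the morphism proofs on both sides agree by
  -- proof irrelevance.
  subst h0 h1
  exact key

end
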